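/- Let $d\ge 3$ and $\mathbb P=\mathrm{Id}+\nabla(-\Delta)^{-1}\operatorname{div}$. For $d<p\le\infty$ let $L^p_\sigma(\mathbb R^d)$ be the space of distributionally divergence-free $L^p$ vector fields. A strong $L^p$ solution on $(0,T]$ of the Navier–Stokes equations with initial data $u_0$ is a $u\in C((0,T];L^p)\cap L^\infty(0,T;L^p)$ with $$u(t)=e^{t\Delta}u_0-\int_0^t e^{(t-s)\Delta}\mathbb P\nabla\cdot(u\otimes u)(s)\,ds\qquad(0<t\le T).$$ For $\varepsilon,\beta\in(0,1)$ and $\ell>0$, call $u_0\in L^p$ $(\varepsilon,\beta,\ell)$-sparse in $L^p$ if there is a measurable set $S$ with $\|u_0\|_{L^p(S^c)}<\varepsilon\|u_0\|_{L^p}$ and $\sup_{x_0}|S\cap B_\ell(x_0)|/|B_\ell(x_0)|\le\beta$. **Proposition.** There is $C_0>1$, depending only on $d$, such that for every $d<p\le\infty$ there are constants $c_p\in(0,1]$ and $C>0$, depending only on $d$ and $p$, with the following properties. (i) For every nonzero $u_0\in L^p_\sigma(\mathbb R^d)$, let $\bar T>0$ be given by $\|u_0\|_{L^p}\bar T^{\frac12(1-\frac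 dp)}=c_p$. There is a unique strong $L^p$ solution on $(0,\bar T]$ with initial data $u_0$, and it satisfies $\|u(t)\|_{L^p}\le 2\|u_0\|_{L^p}$ for $0<t\le\bar T$. (ii) For every $\gamma\in(0,1)$ and every nonzero $u_0\in L^p_\sigma(\mathbb R^d)$, let $T=T(d,p,\gamma,\|u_0\|_{L^p})>0$ be given by $\|u_0\|_{L^p}T^{\frac12(1-\frac dp)}=\frac{\gamma}{2C}$. Then $T<\bar T$, and the strong $L^p$ solution $u$ with initial data $u_0$ exists on $(0,T]$ and is unique. Moreover, for all $t\in(0,T]$, $\beta\in(0,1)$ and $\bar\ell>0$ with $$\beta^{1-\frac1p}\le\frac{\gamma}{2C_0\bar\ell^{\,d}},\qquad \bar\ell^2\ge C_0\ln\frac{2C_0}{\gamma},$$ if $u_0$ is $(\gamma/6,\beta,\sqrt t\,\bar\ell)$-sparse in $L^p$, then $\|u(t)\|_{L^p}\le\gamma\|u_0\|_{L^p}$. -/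

import Mathlib

open MeasureTheory Set Filter Topology
open scoped ENNReal NNReal ContDiff

noncomputable section

namespace NavierStokesSparse

/-- `ℝ^d` with its Euclidean norm. -/
abbrev Space (d : ℕ) : Type := EuclideanSpace ℝ (Fin d)

/-- The partial derivative `∂_i f`. -/
def partialDeriv {d : ℕ} (i : Fin d) (f : Space d → ℝ) (x : Space d) : ℝ :=
  fderiv ℝ f x (EuclideanSpace.single i 1)

/-- The heat kernel `G_t(x) = (4πt)^{-d/2} exp(-|x|²/(4t))`, the kernel of `e^{tΔ}`, for `t > 0`. -/
def heatKernel {d : ℕ} (t : ℝ) (x : Space d) : ℝ :=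
  (4 * Real.pi * t) ^ (-((d : ℝ) / 2)) * Real.exp (-‖x‖ ^ 2 / (4 * t))

/-- The Oseen tensor, i.e. the kernel of `e^{tΔ} ℙ` for `t > 0`, where
`ℙ = Id + ∇ (-Δ)⁻¹ div` is the Leray projection. As `(-Δ)⁻¹ e^{tΔ} = ∫_t^∞ e^{sΔ} ds`, its entries are
`δ_{ij} G_t + ∫_t^∞ ∂_i ∂_j G_s ds`. -/
def oseenTensor {d : ℕ} (i j : Fin d) (t : ℝ) (x : Space d) : ℝ :=
  (if i = j then heatKernel t x else 0) +
    ∫ s in Ioi t, partialDeriv i (partialDeriv j (heatKernel s)) x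

/-- The `i`-th component of `e^{τΔ} ℙ div (v ⊗ v)` at the point `x`, for `τ > 0`, with the derivative
on the kernel: `∑_{j,k} (∂_k O_{ij}(τ) * (v_j v_k))(x)`. -/
def oseenDivTensor {d : ℕ} (τ : ℝ) (v : Space d → Space d) (x : Space d) (i : Fin d) : ℝ :=
  ∫ y, ∑ j, ∑ k, partialDeriv k (oseenTensor i j τ) (x - y) * (v y j * v y k)

/-- `L^p_σ(ℝ^d)`: the `L^p` vector fields that are divergence free in the sense of distributions. -/
def IsSolenoidalLp {d : ℕ} (p : ℝ≥0∞) (v : Space d → Space d) : Prop :=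
  MemLp v p volume ∧
    ∀ φ : Space d → ℝ, ContDiff ℝ ∞ φ → HasCompactSupport φ → ∫ x, fderiv ℝ φ x (v x) = 0

/-- `u` is a strong `L^p` solution on `ℝ^d × (0,T]` of the Navier-Stokes equations
`∂_t u + u · ∇u - Δu + ∇π = 0`, `div u = 0`, with initial data `u₀`: a mild solution in the class
`C((0,T]; L^p) ∩ L^∞(0,T; L^p)`. The last clause is Duhamel's formula
`u(t) = e^{tΔ} u₀ - ∫_0^t e^{(t-s)Δ} ℙ div (u ⊗ u)(s) ds`. -/
structure IsStrongSolution {d : ℕ} (p : ℝ≥0∞) (u₀ : Space d → Space d) (T : ℝ)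
    (u : ℝ → Space d → Space d) : Prop where
  memLp : ∀ t ∈ Ioc 0 T, MemLp (u t) p volume
  bounded : ∃ M : ℝ≥0, ∀ t ∈ Ioc 0 T, eLpNorm (u t) p volume ≤ M
  continuous : ∀ t ∈ Ioc 0 T,
    Tendsto (fun s => eLpNorm (u s - u t) p volume) (𝓝[Ioc 0 T] t) (𝓝 0)
  duhamel : ∀ t ∈ Ioc 0 T, ∀ᵐ x ∂(volume : Measure (Space d)), ∀ i : Fin d,
    IntervalIntegrable (fun s => oseenDivTensor (t - s) (u s) x i) volume 0 t ∧
    u t x i = (∫ y, heatKernel t (x - y) * u₀ y i)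
      - ∫ s in (0 : ℝ)..t, oseenDivTensor (t - s) (u s) x i

/-- The strong `L^p` solution with initial data `u₀` exists on `ℝ^d × (0,T]` and is unique. -/
def HasUniqueStrongSolution {d : ℕ} (p : ℝ≥0∞) (u₀ : Space d → Space d) (T : ℝ) : Prop :=
  (∃ u, IsStrongSolution p u₀ T u) ∧
    ∀ u v, IsStrongSolution p u₀ T u → IsStrongSolution p u₀ T v →
      ∀ t ∈ Ioc 0 T, u t =ᵐ[volume] v t

/-- For `a, N > 0` and `d < p ≤ ∞`: the time `τ > 0` with `N τ^{(1 - d/p)/2} = a`. -/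
def subcriticalTime (d : ℕ) (p : ℝ≥0∞) (a N : ℝ) : ℝ :=
  (a / N) ^ (2 / (1 - (d : ℝ) * (p⁻¹).toReal))

theorem subcriticalExponent_pos {d : ℕ} {p : ℝ≥0∞} (hp : (d : ℝ≥0∞) < p) :
    0 < 1 - (d : ℝ) * (p⁻¹).toReal := by
  rcases eq_or_ne p ⊤ with rfl | htop
  · simp
  · have h0 : 0 < p.toReal := ENNReal.toReal_pos (ne_bot_of_gt hp) htop
    have h1 : (d : ℝ) < p.toReal := by
      have := (ENNReal.toReal_lt_toReal (ENNReal.natCast_ne_top d) htop).2 hp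
      simpa using this
    rw [ENNReal.toReal_inv, ← div_eq_mul_inv, sub_pos, div_lt_one h0]
    exact h1

/-- `subcriticalTime` is the positive number described in its documentation. -/
theorem subcriticalTime_eq_iff {d : ℕ} {p : ℝ≥0∞} (hp : (d : ℝ≥0∞) < p) {a N τ : ℝ}
    (ha : 0 < a) (hN : 0 < N) (hτ : 0 < τ) :
    N * τ ^ ((1 / 2 : ℝ) * (1 - (d : ℝ) * (p⁻¹).toReal)) = a ↔ τ = subcriticalTime d p a N := by
  have he := subcriticalExponent_pos hp
  unfold subcriticalTime
  set e := 1 - (d : ℝ) * (p⁻¹).toReal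
  constructor
  · rintro rfl
    rw [mul_div_cancel_left₀ _ hN.ne', ← Real.rpow_mul hτ.le]
    rw [show (1 / 2 : ℝ) * e * (2 / e) = 1 by field_simp, Real.rpow_one]
  · rintro rfl
    rw [← Real.rpow_mul (div_pos ha hN).le]
    rw [show 2 / e * ((1 / 2 : ℝ) * e) = 1 by field_simp, Real.rpow_one]
    field_simp

/-- `c` is an admissible constant `c_p ∈ (0,1]` in the definition of the guaranteed existence time
`T̄ = T̄(d,p,‖u₀‖_{L^p})`, given by `‖u₀‖_{L^p} T̄^{(1 - d/p)/2} = c_p`: for every nonzero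
`u₀ ∈ L^p_σ`, the strong `L^p` solution exists on `(0,T̄]`, is unique, and stays below
`2 ‖u₀‖_{L^p}`. -/
def IsExistenceConstant (d : ℕ) (p : ℝ≥0∞) (c : ℝ) : Prop :=
  0 < c ∧ c ≤ 1 ∧
    ∀ u₀ : Space d → Space d, IsSolenoidalLp p u₀ → lpNorm u₀ p volume ≠ 0 →
      HasUniqueStrongSolution p u₀ (subcriticalTime d p c (lpNorm u₀ p volume)) ∧
      ∀ u, IsStrongSolution p u₀ (subcriticalTime d p c (lpNorm u₀ p volume)) u →
        ∀ t ∈ Ioc 0 (subcriticalTime d p c (lpNorm u₀ p volume)),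
          eLpNorm (u t) p volume ≤ 2 * eLpNorm u₀ p volume

/-- `v` is `(ε,β,ℓ)`-sparse in `L^p`: outside a measurable set `S` which fills at most the fraction
`β` of every ball of radius `ℓ`, the `L^p` norm of `v` is less than the fraction `ε` of the whole.
(Meant for `ε, β ∈ (0,1)` and `ℓ > 0`.) -/
def IsSparse {d : ℕ} (p : ℝ≥0∞) (ε β ℓ : ℝ) (v : Space d → Space d) : Prop :=
  ∃ S : Set (Space d), MeasurableSet S ∧
    eLpNorm v p (volume.restrict Sᶜ) < ENNReal.ofReal ε * eLpNorm v p volume ∧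
    (⨆ x₀ : Space d, volume (S ∩ Metric.ball x₀ ℓ) / volume (Metric.ball x₀ ℓ))
      ≤ ENNReal.ofReal β

end NavierStokesSparse

end

/-! Write the Duhamel formula as `u(t) = e^{tΔ}u₀ - B(u)(t)`, and let `N` be the `L^p` norm of `u₀`.
The nonlinear part is controlled for short times, the linear part by sparseness, and each
contributes at most `γN/2`.

Nonlinear part. The kernel `∂_k O_{ij}(τ)` is bounded by `τ^{-(d+1)/2}` times an integrable profile
of `x/√τ`, so its norm in the conjugate space `L^{p'}` is of order `τ^{-α}` with `α = 1/2 + d/(2p)`.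
Since `v ⊗ v` lies in `L^{p/2}`, Young's inequality makes `v ↦ e^{τΔ}ℙ div(v ⊗ v)` a quadratic map
on `L^p` of size `A τ^{-α}` (`exists_isSingularQuadratic_oseenLp`). The condition `p > d` says
exactly `α < 1`, so the singularity is integrable in time. The rest is a fixed point argument for an
abstract singular quadratic map. If `8 A N T^{1-α} ≤ 1-α`, the Duhamel map contracts the ball of
radius `2N` (`exists_mild`); uniqueness among bounded solutions needs no smallness (`mild_unique`).
If moreover `8 A N T^{1-α} ≤ γ(1-α)`, the bound `2N` on `u` gives a Duhamel term of at most `A (2N)²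
T^{1-α}/(1-α) ≤ γN/2`.

Linear part. With `S` the sparse set and `R = √t·ℓ`, the heat flow splits into three pieces
(`enorm_heat_le_split`): the data outside `S`, small by assumption; the kernel outside the ball of
radius `R`, small by the Gaussian tail; and the data in `S` near the base point, small by Hölder's
inequality because `S` fills little of each ball. Each is at most `γN/6`
(`eLpNorm_heat_le_of_isSparse`).

Abstract solutions are curves in the Banach space `L^p`, whereas strong solutions satisfy Duhamel's
formula pointwise almost everywhere. `ae_duhamelIntegral_oseenLp` identifies the Bochner integral
with the pointwise one, and the results transfer in both directions. -/

noncomputable section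

namespace NavierStokesSparse

set_option linter.unusedSectionVars false

/-- Hölder's inequality for a product of norms. -/
theorem lintegral_enorm_mul_le_eLpNorm {α E F : Type*} [MeasurableSpace α] {μ : Measure α}
    [NormedAddCommGroup E] [NormedAddCommGroup F] {k : α → E} {f : α → F} {r q : ℝ≥0∞}
    [hrq : ENNReal.HolderTriple r q 1]
    (hk : AEStronglyMeasurable k μ) (hf : AEStronglyMeasurable f μ) :
    ∫⁻ y, ‖k y‖ₑ * ‖f y‖ₑ ∂μ ≤ eLpNorm k r μ * eLpNorm f q μ := by
  have h := eLpNorm_smul_le_mul_eLpNorm (p := r) (q := q) (r := 1) (μ := μ)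
    (f := fun y => ‖f y‖) (φ := fun y => ‖k y‖) hf.norm hk.norm
  rw [eLpNorm_norm, eLpNorm_norm] at h
  refine le_trans (le_of_eq ?_) h
  rw [eLpNorm_one_eq_lintegral_enorm]
  refine lintegral_congr fun y => ?_
  simp [enorm_mul]

/-! ### Young's convolution inequality -/

section Young

variable {G : Type*} [AddCommGroup G] [MeasurableSpace G] [MeasurableAdd₂ G] [MeasurableNeg G]
  {μ : Measure G} [SFinite μ] [μ.IsAddLeftInvariant] [μ.IsNegInvariant]
  {E F : Type*} [NormedAddCommGroup E] [NormedAddCommGroup F]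

theorem aestronglyMeasurable_comp_sub_left {k : G → E} (hk : AEStronglyMeasurable k μ) (x : G) :
    AEStronglyMeasurable (fun y => k (x - y)) μ :=
  hk.comp_measurePreserving (Measure.measurePreserving_sub_left μ x)

theorem eLpNorm_comp_sub_left {k : G → E} (hk : AEStronglyMeasurable k μ) (q : ℝ≥0∞) (x : G) :
    eLpNorm (fun y => k (x - y)) q μ = eLpNorm k q μ :=
  eLpNorm_comp_measurePreserving hk (Measure.measurePreserving_sub_left μ x)

theorem lintegral_enorm_sub_mul_le_eLpNorm {k : G → E} {f : G → F} {r q : ℝ≥0∞}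
    [hrq : ENNReal.HolderTriple r q 1]
    (hk : AEStronglyMeasurable k μ) (hf : AEStronglyMeasurable f μ) (x : G) :
    ∫⁻ y, ‖k (x - y)‖ₑ * ‖f y‖ₑ ∂μ ≤ eLpNorm k r μ * eLpNorm f q μ := by
  rw [← eLpNorm_comp_sub_left hk r x]
  exact lintegral_enorm_mul_le_eLpNorm (aestronglyMeasurable_comp_sub_left hk x) hf

theorem young_exponents_finite {p q r : ℝ≥0∞} (hr : 1 ≤ r)
    (h : r⁻¹ + q⁻¹ = 1 + p⁻¹) (hp : p ≠ ⊤) : q ≠ ⊤ := by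
  rintro rfl
  have h1 : r⁻¹ ≤ 1 := ENNReal.inv_le_one.2 hr
  have h2 : 0 < p⁻¹ := ENNReal.inv_pos.2 hp
  rw [ENNReal.inv_top, add_zero] at h
  rw [h] at h1
  exact absurd h1 (not_le.2 (ENNReal.lt_add_right ENNReal.one_ne_top h2.ne'))

/-- Young's convolution inequality for real exponents. -/
theorem lintegral_convolution_rpow_le {k f : G → ℝ≥0∞} (hk : AEMeasurable k μ)
    (hf : AEMeasurable f μ) {p q r : ℝ} (hp : 0 < p) (hq : 0 < q) (hr : 0 < r)
    (hrp : r ≤ p) (hqp : q ≤ p) (h : r⁻¹ + q⁻¹ = 1 + p⁻¹) :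
    ∫⁻ x, (∫⁻ y, k (x - y) * f y ∂μ) ^ p ∂μ ≤
      ((∫⁻ y, k y ^ r ∂μ) ^ r⁻¹ * (∫⁻ y, f y ^ q ∂μ) ^ q⁻¹) ^ p := by
  set a := ∫⁻ y, k y ^ r ∂μ
  set b := ∫⁻ y, f y ^ q ∂μ
  have hk2 (x : G) : AEMeasurable (fun y => k (x - y)) μ :=
    hk.comp_quasiMeasurePreserving
      (Measure.measurePreserving_sub_left μ x).quasiMeasurePreserving
  have ha (x : G) : ∫⁻ y, k (x - y) ^ r ∂μ = a :=
    lintegral_sub_left_eq_self (fun y => k y ^ r) x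
  have hrp' : 0 ≤ r⁻¹ - p⁻¹ := sub_nonneg.2 (inv_anti₀ hr hrp)
  have hqp' : 0 ≤ q⁻¹ - p⁻¹ := sub_nonneg.2 (inv_anti₀ hq hqp)
  -- Hölder with three factors: `k f = (k^r f^q)^{1/p} · (k^r)^{1/r-1/p} · (f^q)^{1/q-1/p}`, whose
  -- weights add up to `1` by the exponent relation. Only the first factor still depends on `x`
  -- after integration in `y`.
  have key (x : G) : (∫⁻ y, k (x - y) * f y ∂μ) ^ p ≤
      (∫⁻ y, k (x - y) ^ r * f y ^ q ∂μ) * (a ^ (r⁻¹ - p⁻¹) * b ^ (q⁻¹ - p⁻¹)) ^ p := by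
    have h3 := ENNReal.lintegral_prod_norm_pow_le (μ := μ) (Finset.univ : Finset (Fin 3))
      (f := ![fun y => k (x - y) ^ r * f y ^ q, fun y => k (x - y) ^ r, fun y => f y ^ q])
      (p := ![p⁻¹, r⁻¹ - p⁻¹, q⁻¹ - p⁻¹]) (by
        intro i _
        fin_cases i
        · exact ((hk2 x).pow_const r).mul (hf.pow_const q)
        · exact (hk2 x).pow_const r
        · exact hf.pow_const q) (by simp [Fin.sum_univ_three]; linarith) (by
        intro i _
        fin_cases i
        · exact inv_nonneg.2 hp.le
        · exact hrp'
        · exact hqp')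
    simp only [Fin.prod_univ_three, Matrix.cons_val_zero, Matrix.cons_val_one,
      Matrix.cons_val] at h3
    rw [ha x] at h3
    have h4 : ∀ y, (k (x - y) ^ r * f y ^ q) ^ p⁻¹ * (k (x - y) ^ r) ^ (r⁻¹ - p⁻¹)
        * (f y ^ q) ^ (q⁻¹ - p⁻¹) = k (x - y) * f y := by
      intro y
      rw [ENNReal.mul_rpow_of_nonneg _ _ (inv_nonneg.2 hp.le)]
      have h5 : ∀ (z : ℝ≥0∞) (s : ℝ), 0 < s → 0 ≤ s⁻¹ - p⁻¹ →
          (z ^ s) ^ p⁻¹ * (z ^ s) ^ (s⁻¹ - p⁻¹) = z := by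
        intro z s hs hs'
        rw [← ENNReal.rpow_add_of_nonneg _ _ (inv_nonneg.2 hp.le) hs', ← ENNReal.rpow_mul,
          add_sub_cancel, mul_inv_cancel₀ hs.ne', ENNReal.rpow_one]
      calc _ = ((k (x - y) ^ r) ^ p⁻¹ * (k (x - y) ^ r) ^ (r⁻¹ - p⁻¹)) *
            ((f y ^ q) ^ p⁻¹ * (f y ^ q) ^ (q⁻¹ - p⁻¹)) := by ring
        _ = _ := by rw [h5 _ r hr hrp', h5 _ q hq hqp']
    simp only [h4] at h3
    calc _ ≤ ((∫⁻ y, k (x - y) ^ r * f y ^ q ∂μ) ^ p⁻¹ * a ^ (r⁻¹ - p⁻¹) *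
          b ^ (q⁻¹ - p⁻¹)) ^ p := by gcongr
      _ = _ := by
        rw [mul_assoc, ENNReal.mul_rpow_of_nonneg _ _ hp.le, ENNReal.rpow_inv_rpow hp.ne']
  have hmeas : AEMeasurable (Function.uncurry fun x y => k (x - y) ^ r * f y ^ q) (μ.prod μ) := by
    have h1 : AEMeasurable (fun z : G × G => k (z.1 - z.2)) (μ.prod μ) :=
      hk.comp_quasiMeasurePreserving (quasiMeasurePreserving_sub_of_right_invariant μ μ)
    have h2 : AEMeasurable (fun z : G × G => f z.2) (μ.prod μ) :=
      hf.comp_quasiMeasurePreserving Measure.quasiMeasurePreserving_snd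
    exact (h1.pow_const r).mul (h2.pow_const q)
  have hfub : ∫⁻ x, ∫⁻ y, k (x - y) ^ r * f y ^ q ∂μ ∂μ = a * b := by
    rw [lintegral_lintegral_swap hmeas]
    have h1 (y : G) : ∫⁻ x, k (x - y) ^ r * f y ^ q ∂μ = a * f y ^ q := by
      have hky : AEMeasurable (fun x => k (x - y)) μ := hk.comp_quasiMeasurePreserving
        (measurePreserving_sub_right μ y).quasiMeasurePreserving
      rw [lintegral_mul_const'' _ (hky.pow_const r)]
      congr 1
      exact lintegral_sub_right_eq_self (fun y => k y ^ r) y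
    simp only [h1]
    rw [lintegral_const_mul'' _ (hf.pow_const q)]
  calc _ ≤ ∫⁻ x, (∫⁻ y, k (x - y) ^ r * f y ^ q ∂μ) *
        (a ^ (r⁻¹ - p⁻¹) * b ^ (q⁻¹ - p⁻¹)) ^ p ∂μ := lintegral_mono key
    _ = a * b * (a ^ (r⁻¹ - p⁻¹) * b ^ (q⁻¹ - p⁻¹)) ^ p := by
      rw [lintegral_mul_const'' _ (by simpa using hmeas.lintegral_prod_right'), hfub]
    _ = _ := by
      rw [ENNReal.mul_rpow_of_nonneg _ _ hp.le, ENNReal.mul_rpow_of_nonneg _ _ hp.le,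
        ← ENNReal.rpow_mul, ← ENNReal.rpow_mul, ← ENNReal.rpow_mul, ← ENNReal.rpow_mul]
      have h5 : ∀ (z : ℝ≥0∞) (s : ℝ), 0 ≤ s⁻¹ - p⁻¹ →
          z * z ^ ((s⁻¹ - p⁻¹) * p) = z ^ (s⁻¹ * p) := by
        intro z s hs
        nth_rw 1 [← ENNReal.rpow_one z]
        rw [← ENNReal.rpow_add_of_nonneg _ _ zero_le_one (mul_nonneg hs hp.le)]
        congr 1
        field_simp
        ring
      calc _ = (a * a ^ ((r⁻¹ - p⁻¹) * p)) * (b * b ^ ((q⁻¹ - p⁻¹) * p)) := by ring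
        _ = _ := by rw [h5 _ _ hrp', h5 _ _ hqp']

/-- Young's convolution inequality. -/
theorem eLpNorm_convolution_le {k : G → E} {f : G → F} (hk : AEStronglyMeasurable k μ)
    (hf : AEStronglyMeasurable f μ) {p q r : ℝ≥0∞} (hr : 1 ≤ r) (hq : 1 ≤ q)
    (h : r⁻¹ + q⁻¹ = 1 + p⁻¹) :
    eLpNorm (fun x => ∫⁻ y, ‖k (x - y)‖ₑ * ‖f y‖ₑ ∂μ) p μ ≤ eLpNorm k r μ * eLpNorm f q μ := by
  rcases eq_or_ne p ⊤ with rfl | hp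
  -- For `p = ∞` the exponents `r` and `q` are conjugate and Hölder's inequality holds at every
  -- point.
  · have : ENNReal.HolderTriple r q 1 := ⟨by simpa using h⟩
    rw [eLpNorm_exponent_top]
    exact eLpNormEssSup_le_of_ae_enorm_bound
      (Eventually.of_forall fun x => lintegral_enorm_sub_mul_le_eLpNorm hk hf x)
  have hq' : q ≠ ⊤ := young_exponents_finite hr h hp
  have hr' : r ≠ ⊤ := young_exponents_finite hq (by rwa [add_comm]) hp
  have hrp : r ≤ p := by
    rw [← ENNReal.inv_le_inv]
    have h1 : q⁻¹ ≤ 1 := ENNReal.inv_le_one.2 hq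
    have h2 : 1 + p⁻¹ ≤ 1 + r⁻¹ := by rw [← h, add_comm]; gcongr
    exact (ENNReal.add_le_add_iff_left ENNReal.one_ne_top).1 h2
  have hqp : q ≤ p := by
    rw [← ENNReal.inv_le_inv]
    have h1 : r⁻¹ ≤ 1 := ENNReal.inv_le_one.2 hr
    have h2 : 1 + p⁻¹ ≤ 1 + q⁻¹ := by rw [← h]; gcongr
    exact (ENNReal.add_le_add_iff_left ENNReal.one_ne_top).1 h2
  have hr0 : r ≠ 0 := (zero_lt_one.trans_le hr).ne'
  have hq0 : q ≠ 0 := (zero_lt_one.trans_le hq).ne'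
  have hp0 : p ≠ 0 := ((zero_lt_one.trans_le hq).trans_le hqp).ne'
  rw [eLpNorm_eq_lintegral_rpow_enorm_toReal hp0 hp, eLpNorm_eq_lintegral_rpow_enorm_toReal hq0 hq',
    eLpNorm_eq_lintegral_rpow_enorm_toReal hr0 hr']
  have hpp := ENNReal.toReal_pos hp0 hp
  rw [one_div, ENNReal.rpow_inv_le_iff hpp, one_div, one_div]
  simp only [enorm_eq_self]
  refine lintegral_convolution_rpow_le hk.enorm hf.enorm hpp (ENNReal.toReal_pos hq0 hq')
    (ENNReal.toReal_pos hr0 hr') (ENNReal.toReal_mono hp hrp) (ENNReal.toReal_mono hp hqp) ?_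
  have h3 := congrArg ENNReal.toReal h
  rw [ENNReal.toReal_add (ENNReal.inv_ne_top.2 hr0) (ENNReal.inv_ne_top.2 hq0),
    ENNReal.toReal_add ENNReal.one_ne_top (ENNReal.inv_ne_top.2 hp0)] at h3
  simpa [ENNReal.toReal_inv] using h3

end Young

/-! ### Derivatives of the heat kernel up to third order and their decay -/

section HeatKernelDerivatives

variable {d : ℕ}

theorem heatKernel_nonneg {t : ℝ} (ht : 0 ≤ t) (x : Space d) : 0 ≤ heatKernel t x := by
  unfold heatKernel
  positivity

theorem hasFDerivAt_heatKernel (s : ℝ) (x : Space d) :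
    HasFDerivAt (heatKernel s) (-(heatKernel s x / (2 * s)) • innerSL ℝ x) x := by
  have h1 : HasFDerivAt (fun y : Space d => ‖y‖ ^ 2) (2 • innerSL ℝ x) x := by
    simpa using (hasStrictFDerivAt_norm_sq x).hasFDerivAt
  have h2 := (((h1.fun_neg).mul_const ((4 * s)⁻¹)).exp).const_mul
    ((4 * Real.pi * s) ^ (-((d : ℝ) / 2)))
  refine h2.congr_fderiv ?_
  ext v
  simp [heatKernel, div_eq_mul_inv]
  ring

theorem partialDeriv_eq_of_hasFDerivAt {f : Space d → ℝ} {L : Space d →L[ℝ] ℝ} {x : Space d}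
    (h : HasFDerivAt f L x) (i : Fin d) : partialDeriv i f x = L (EuclideanSpace.single i 1) := by
  rw [partialDeriv, h.fderiv]

theorem partialDeriv_heatKernel (j : Fin d) (s : ℝ) :
    partialDeriv j (heatKernel s) = fun x : Space d => -(heatKernel s x / (2 * s)) * x j := by
  ext x
  rw [partialDeriv_eq_of_hasFDerivAt (hasFDerivAt_heatKernel s x)]
  simp [EuclideanSpace.inner_single_right]

/-- The second derivatives of the heat kernel. -/
def heatHessian (i j : Fin d) (s : ℝ) (x : Space d) : ℝ :=
  (x i * x j / (4 * s ^ 2) - (if i = j then 1 else 0) / (2 * s)) * heatKernel s x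

/-- The differential of `heatHessian i j s`. -/
def heatHessianDeriv (i j : Fin d) (s : ℝ) (x : Space d) : Space d →L[ℝ] ℝ :=
  (heatKernel s x / (4 * s ^ 2)) • (x j • EuclideanSpace.proj (𝕜 := ℝ) i + x i • EuclideanSpace.proj (𝕜 := ℝ) j)
    - (heatHessian i j s x / (2 * s)) • innerSL ℝ x

theorem hasFDerivAt_coord (i : Fin d) (x : Space d) :
    HasFDerivAt (fun y : Space d => y i) (EuclideanSpace.proj (𝕜 := ℝ) i : Space d →L[ℝ] ℝ) x :=
  (EuclideanSpace.proj (𝕜 := ℝ) i : Space d →L[ℝ] ℝ).hasFDerivAt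

theorem partialDeriv_partialDeriv_heatKernel (i j : Fin d) (s : ℝ) :
    partialDeriv i (partialDeriv j (heatKernel s)) = heatHessian (d := d) i j s := by
  ext x
  have h := ((((hasFDerivAt_heatKernel s x).fun_neg).mul_const ((2 * s)⁻¹)).fun_mul
    (hasFDerivAt_coord j x))
  rw [partialDeriv_heatKernel, show (fun x : Space d => -(heatKernel s x / (2 * s)) * x j) =
    fun x => -heatKernel s x * (2 * s)⁻¹ * x j by ext y; ring, partialDeriv_eq_of_hasFDerivAt h]
  rcases eq_or_ne i j with rfl | hij
  · simp [heatHessian, EuclideanSpace.inner_single_right, div_eq_mul_inv]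
    ring
  · simp [heatHessian, EuclideanSpace.inner_single_right, div_eq_mul_inv, hij, hij.symm]
    ring

theorem hasFDerivAt_heatHessian (i j : Fin d) (s : ℝ) (x : Space d) :
    HasFDerivAt (heatHessian i j s) (heatHessianDeriv i j s x) x := by
  have h := ((((hasFDerivAt_coord i x).fun_mul (hasFDerivAt_coord j x)).mul_const
    ((4 * s ^ 2)⁻¹)).sub_const ((if i = j then 1 else 0) / (2 * s))).fun_mul
    (hasFDerivAt_heatKernel s x)
  refine h.congr_fderiv ?_
  ext v
  simp [heatHessianDeriv, heatHessian, div_eq_mul_inv]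
  ring

/-- The spatial decay profile of the kernels at time `τ`. -/
def decayProfile (τ : ℝ) (x : Space d) : ℝ := (1 + ‖x‖ ^ 2 / τ) ^ (-((d : ℝ) / 2 + 1 / 4))

theorem decayProfile_nonneg {τ : ℝ} (hτ : 0 < τ) (x : Space d) : 0 ≤ decayProfile τ x := by
  unfold decayProfile; positivity

theorem decayProfile_le_one {τ : ℝ} (hτ : 0 < τ) (x : Space d) : decayProfile τ x ≤ 1 := by
  refine Real.rpow_le_one_of_one_le_of_nonpos ?_ ?_
  · have : 0 ≤ ‖x‖ ^ 2 / τ := by positivity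
    linarith
  · have : (0 : ℝ) ≤ d := d.cast_nonneg
    linarith

/-- Follows from `1 + |x|²/s ≥ (τ/s)(1 + |x|²/τ)`. It lets the spatial decay be pulled out of
integrals over `s > τ` at the price of a power of `s/τ`. -/
theorem decayProfile_le {τ s : ℝ} (hτ : 0 < τ) (hs : τ ≤ s) (x : Space d) :
    decayProfile s x ≤ (s / τ) ^ ((d : ℝ) / 2 + 1 / 4) * decayProfile τ x := by
  have hs0 : 0 < s := hτ.trans_le hs
  have h1 : (s / τ)⁻¹ * (1 + ‖x‖ ^ 2 / τ) ≤ 1 + ‖x‖ ^ 2 / s := by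
    have h2 : (s / τ)⁻¹ * (1 + ‖x‖ ^ 2 / τ) = τ / s + ‖x‖ ^ 2 / s := by field_simp
    have h3 : τ / s ≤ 1 := (div_le_one hs0).2 hs
    linarith
  have h4 : (0 : ℝ) ≤ d := d.cast_nonneg
  unfold decayProfile
  calc (1 + ‖x‖ ^ 2 / s) ^ (-((d : ℝ) / 2 + 1 / 4))
      ≤ ((s / τ)⁻¹ * (1 + ‖x‖ ^ 2 / τ)) ^ (-((d : ℝ) / 2 + 1 / 4)) :=
        Real.rpow_le_rpow_of_nonpos (by positivity) h1 (by linarith)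
    _ = _ := by
      rw [Real.mul_rpow (by positivity) (by positivity), Real.inv_rpow (by positivity),
        ← Real.rpow_neg (by positivity), neg_neg]

theorem decayProfile_mono {τ s : ℝ} (hτ : 0 < τ) (hs : τ ≤ s) (x : Space d) :
    decayProfile τ x ≤ decayProfile s x := by
  have h4 : (0 : ℝ) ≤ d := d.cast_nonneg
  have hs0 : 0 < s := hτ.trans_le hs
  unfold decayProfile
  refine Real.rpow_le_rpow_of_nonpos (by positivity) ?_ (by linarith)
  gcongr

theorem exists_gaussian_decay (d : ℕ) : ∃ C : ℝ, 0 < C ∧ ∀ ρ : ℝ, 0 ≤ ρ →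
    (1 + ρ) ^ 2 * Real.exp (-ρ / 4) ≤ C * (1 + ρ) ^ (-((d : ℝ) / 2 + 1 / 4)) := by
  -- The constant comes from `y^n/n! ≤ e^y` with `y = (1+ρ)/4` and `n = d+3`: two powers pay for
  -- `(1+ρ)²`, and the other `d+1` give more decay than is required.
  refine ⟨4 ^ (d + 3) * (d + 3).factorial * Real.exp (1 / 4), by positivity, fun ρ hρ => ?_⟩
  have h1 := Real.pow_div_factorial_le_exp ((1 + ρ) / 4) (by positivity) (d + 3)
  have h2 : (1 + ρ) ^ (-((d : ℝ) + 1)) ≤ (1 + ρ) ^ (-((d : ℝ) / 2 + 1 / 4)) := by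
    refine Real.rpow_le_rpow_of_exponent_le (by linarith) ?_
    have h4 : (0 : ℝ) ≤ d := d.cast_nonneg
    linarith
  refine le_trans ?_ (mul_le_mul_of_nonneg_left h2 (by positivity))
  have h3 : (1 + ρ) ^ (-((d : ℝ) + 1)) = ((1 + ρ) ^ (d + 1))⁻¹ := by
    rw [Real.rpow_neg (by positivity)]
    norm_cast
  rw [h3, ← div_eq_mul_inv, le_div_iff₀ (by positivity)]
  have h5 : (1 + ρ) ^ 2 * Real.exp (-ρ / 4) * (1 + ρ) ^ (d + 1)
      = 4 ^ (d + 3) * (d + 3).factorial * Real.exp (-ρ / 4)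
        * (((1 + ρ) / 4) ^ (d + 3) / (d + 3).factorial) := by
    rw [div_pow]
    field_simp
    ring
  rw [h5]
  calc _ ≤ 4 ^ (d + 3) * (d + 3).factorial * Real.exp (-ρ / 4) * Real.exp ((1 + ρ) / 4) := by
        gcongr
    _ = _ := by
      rw [mul_assoc, ← Real.exp_add]
      congr 2
      ring

/-- Gaussian decay of the heat kernel, with room for a polynomial factor. -/
theorem exists_heatKernel_bound (d : ℕ) : ∃ C : ℝ, 0 < C ∧ ∀ s : ℝ, 0 < s → ∀ x : Space d,
    (1 + ‖x‖ ^ 2 / s) ^ 2 * heatKernel s x ≤ C * s ^ (-((d : ℝ) / 2)) * decayProfile s x := by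
  obtain ⟨C, hC, h⟩ := exists_gaussian_decay d
  refine ⟨(4 * Real.pi) ^ (-((d : ℝ) / 2)) * C, by positivity, fun s hs x => ?_⟩
  have h1 := h (‖x‖ ^ 2 / s) (by positivity)
  have h2 : -‖x‖ ^ 2 / (4 * s) = -(‖x‖ ^ 2 / s) / 4 := by field_simp
  unfold heatKernel decayProfile
  rw [Real.mul_rpow (by positivity) hs.le, h2]
  calc _ = (4 * Real.pi) ^ (-((d : ℝ) / 2)) * s ^ (-((d : ℝ) / 2)) *
        ((1 + ‖x‖ ^ 2 / s) ^ 2 * Real.exp (-(‖x‖ ^ 2 / s) / 4)) := by ring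
    _ ≤ (4 * Real.pi) ^ (-((d : ℝ) / 2)) * s ^ (-((d : ℝ) / 2)) *
        (C * (1 + ‖x‖ ^ 2 / s) ^ (-((d : ℝ) / 2 + 1 / 4))) := by gcongr
    _ = _ := by ring

theorem abs_coord_le_norm (x : Space d) (i : Fin d) : |x i| ≤ ‖x‖ := by
  simpa using PiLp.norm_apply_le x i

/-- Turns an odd power of `|x|` into `√s` and a factor that the Gaussian absorbs, using `√ρ ≤ 1 + ρ`
with `ρ = |x|²/s`. -/
theorem norm_le_sqrt_mul {s : ℝ} (hs : 0 < s) (x : Space d) :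
    ‖x‖ ≤ s ^ (1 / 2 : ℝ) * (1 + ‖x‖ ^ 2 / s) := by
  have h1 : ‖x‖ = Real.sqrt s * Real.sqrt (‖x‖ ^ 2 / s) := by
    rw [← Real.sqrt_mul hs.le, mul_div_cancel₀ _ hs.ne', Real.sqrt_sq (norm_nonneg x)]
  rw [← Real.sqrt_eq_rpow]
  nth_rw 1 [h1]
  gcongr
  have h2 : 0 ≤ ‖x‖ ^ 2 / s := by positivity
  rw [Real.sqrt_le_left (by positivity)]
  nlinarith

theorem abs_heatKernel_mul_coord_le {C : ℝ} (hC : ∀ s : ℝ, 0 < s → ∀ x : Space d,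
    (1 + ‖x‖ ^ 2 / s) ^ 2 * heatKernel s x ≤ C * s ^ (-((d : ℝ) / 2)) * decayProfile s x)
    (k : Fin d) {s : ℝ} (hs : 0 < s) (x : Space d) :
    |-(heatKernel s x / (2 * s)) * x k| ≤
      C * s ^ (-((d : ℝ) / 2 + 1 / 2)) * decayProfile s x := by
  have h0 := heatKernel_nonneg hs.le x
  have hρ : 0 ≤ ‖x‖ ^ 2 / s := by positivity
  rw [abs_mul, abs_neg, abs_of_nonneg (by positivity)]
  have h1 : s ^ (-((d : ℝ) / 2 + 1 / 2)) = s ^ (-((d : ℝ) / 2)) * s ^ (-(1 / 2) : ℝ) := by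
    rw [← Real.rpow_add hs]; congr 1; ring
  have h2 : s⁻¹ * s ^ (1 / 2 : ℝ) = s ^ (-(1 / 2) : ℝ) := by
    rw [← Real.rpow_neg_one, ← Real.rpow_add hs]; norm_num
  have h3 := (abs_coord_le_norm x k).trans (norm_le_sqrt_mul hs x)
  calc heatKernel s x / (2 * s) * |x k|
      ≤ heatKernel s x / (2 * s) * (s ^ (1 / 2 : ℝ) * (1 + ‖x‖ ^ 2 / s)) := by gcongr
    _ = (1 / 2) * ((1 + ‖x‖ ^ 2 / s) * heatKernel s x) * (s⁻¹ * s ^ (1 / 2 : ℝ)) := by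
      field_simp
    _ ≤ ((1 + ‖x‖ ^ 2 / s) ^ 2 * heatKernel s x) * s ^ (-(1 / 2) : ℝ) := by
      rw [h2]
      refine mul_le_mul_of_nonneg_right ?_ (by positivity)
      rw [← mul_assoc]
      refine mul_le_mul_of_nonneg_right ?_ h0
      nlinarith
    _ ≤ (C * s ^ (-((d : ℝ) / 2)) * decayProfile s x) * s ^ (-(1 / 2) : ℝ) :=
      mul_le_mul_of_nonneg_right (hC s hs x) (by positivity)
    _ = _ := by rw [h1]; ring

theorem abs_heatHessian_le {C : ℝ} (hC : ∀ s : ℝ, 0 < s → ∀ x : Space d,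
    (1 + ‖x‖ ^ 2 / s) ^ 2 * heatKernel s x ≤ C * s ^ (-((d : ℝ) / 2)) * decayProfile s x)
    (i j : Fin d) {s : ℝ} (hs : 0 < s) (x : Space d) :
    |heatHessian i j s x| ≤ C * s ^ (-((d : ℝ) / 2 + 1)) * decayProfile s x := by
  have h0 := heatKernel_nonneg hs.le x
  have hρ : 0 ≤ ‖x‖ ^ 2 / s := by positivity
  have h1 : s ^ (-((d : ℝ) / 2 + 1)) = s ^ (-((d : ℝ) / 2)) * s⁻¹ := by
    rw [← Real.rpow_neg_one, ← Real.rpow_add hs]; congr 1; ring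
  unfold heatHessian
  rw [abs_mul, abs_of_nonneg h0]
  have hδ : |(if i = j then (1 : ℝ) else 0)| ≤ 1 := by split_ifs <;> simp
  have h2 : |x i * x j / (4 * s ^ 2) - (if i = j then 1 else 0) / (2 * s)|
      ≤ s⁻¹ * (1 + ‖x‖ ^ 2 / s) := by
    refine (abs_sub _ _).trans ?_
    rw [abs_div, abs_div, abs_mul, abs_of_pos (show 0 < 4 * s ^ 2 by positivity),
      abs_of_pos (show 0 < 2 * s by positivity)]
    calc _ ≤ ‖x‖ * ‖x‖ / (4 * s ^ 2) + 1 / (2 * s) := by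
          gcongr <;> exact abs_coord_le_norm x _
      _ = s⁻¹ * (1 / 2 + (‖x‖ ^ 2 / s) / 4) := by field_simp; ring
      _ ≤ _ := mul_le_mul_of_nonneg_left (by linarith) (by positivity)
  calc _ ≤ s⁻¹ * (1 + ‖x‖ ^ 2 / s) * heatKernel s x := by gcongr
    _ ≤ s⁻¹ * ((1 + ‖x‖ ^ 2 / s) ^ 2 * heatKernel s x) := by
      rw [mul_assoc]
      gcongr
      nlinarith
    _ ≤ s⁻¹ * (C * s ^ (-((d : ℝ) / 2)) * decayProfile s x) :=
      mul_le_mul_of_nonneg_left (hC s hs x) (by positivity)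
    _ = _ := by rw [h1]; ring

/-- A third derivative of the heat kernel is the kernel times `s^{-2}|x|` times a polynomial of
degree one in `|x|²/s`. One factor `|x|` costs `√s`, which leaves `s^{-3/2}`, and the two factors `1
+ |x|²/s` are the ones allowed for in the Gaussian bound. -/
theorem norm_heatHessianDeriv_le {C : ℝ} (hC : ∀ s : ℝ, 0 < s → ∀ x : Space d,
    (1 + ‖x‖ ^ 2 / s) ^ 2 * heatKernel s x ≤ C * s ^ (-((d : ℝ) / 2)) * decayProfile s x)
    (i j : Fin d) {s : ℝ} (hs : 0 < s) (x : Space d) :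
    ‖heatHessianDeriv i j s x‖ ≤ C * s ^ (-((d : ℝ) / 2 + 3 / 2)) * decayProfile s x := by
  have h0 := heatKernel_nonneg hs.le x
  have hρ : 0 ≤ ‖x‖ ^ 2 / s := by positivity
  have h1 : s ^ (-((d : ℝ) / 2 + 3 / 2)) = s ^ (-((d : ℝ) / 2)) * (s ^ (-2 : ℝ) * s ^ (1 / 2 : ℝ)) := by
    rw [← Real.rpow_add hs, ← Real.rpow_add hs]; congr 1; ring
  have h2 : s ^ (-2 : ℝ) = (s ^ 2)⁻¹ := by
    rw [Real.rpow_neg hs.le]; norm_cast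
  have hδ : |(if i = j then (1 : ℝ) else 0)| ≤ 1 := by split_ifs <;> simp
  have hx := norm_le_sqrt_mul hs x
  have hH : |heatHessian i j s x| ≤ s⁻¹ * (1 / 2 + (‖x‖ ^ 2 / s) / 4) * heatKernel s x := by
    unfold heatHessian
    rw [abs_mul, abs_of_nonneg h0]
    gcongr
    refine (abs_sub _ _).trans ?_
    rw [abs_div, abs_div, abs_mul, abs_of_pos (show 0 < 4 * s ^ 2 by positivity),
      abs_of_pos (show 0 < 2 * s by positivity)]
    calc _ ≤ ‖x‖ * ‖x‖ / (4 * s ^ 2) + 1 / (2 * s) := by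
          gcongr <;> exact abs_coord_le_norm x _
      _ = s⁻¹ * (1 / 2 + (‖x‖ ^ 2 / s) / 4) := by field_simp; ring
  have hop : ‖heatHessianDeriv i j s x‖ ≤
      heatKernel s x * (s ^ 2)⁻¹ * (‖x‖ * (3 / 4 + (‖x‖ ^ 2 / s) / 8)) := by
    refine ContinuousLinearMap.opNorm_le_bound _ (by positivity) fun v => ?_
    have e1 : heatHessianDeriv i j s x v = heatKernel s x / (4 * s ^ 2) * (x j * v i + x i * v j)
        - heatHessian i j s x / (2 * s) * inner ℝ x v := by
      simp [heatHessianDeriv]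
      ring
    rw [e1, Real.norm_eq_abs]
    refine (abs_sub _ _).trans ?_
    rw [abs_mul, abs_mul, abs_div (heatHessian _ _ _ _), abs_of_pos (show 0 < 2 * s by positivity),
      abs_of_nonneg (show 0 ≤ heatKernel s x / (4 * s ^ 2) by positivity)]
    have e2 : |x j * v i + x i * v j| ≤ 2 * (‖x‖ * ‖v‖) := by
      refine (abs_add_le _ _).trans ?_
      rw [abs_mul, abs_mul, two_mul]
      gcongr <;> exact abs_coord_le_norm _ _
    calc _ ≤ heatKernel s x / (4 * s ^ 2) * (2 * (‖x‖ * ‖v‖)) +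
          s⁻¹ * (1 / 2 + (‖x‖ ^ 2 / s) / 4) * heatKernel s x / (2 * s) * (‖x‖ * ‖v‖) := by
          gcongr
          exact abs_real_inner_le_norm x v
      _ = _ := by field_simp; ring
  refine hop.trans ?_
  calc _ ≤ heatKernel s x * (s ^ 2)⁻¹ * ((s ^ (1 / 2 : ℝ) * (1 + ‖x‖ ^ 2 / s)) *
        (1 + ‖x‖ ^ 2 / s)) := by
        refine mul_le_mul_of_nonneg_left (mul_le_mul hx (by linarith) (by positivity)
          (by positivity)) (by positivity)
    _ = (s ^ 2)⁻¹ * s ^ (1 / 2 : ℝ) * ((1 + ‖x‖ ^ 2 / s) ^ 2 * heatKernel s x) := by ring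
    _ ≤ (s ^ 2)⁻¹ * s ^ (1 / 2 : ℝ) * (C * s ^ (-((d : ℝ) / 2)) * decayProfile s x) :=
      mul_le_mul_of_nonneg_left (hC s hs x) (by positivity)
    _ = _ := by rw [h1, h2]; ring

end HeatKernelDerivatives

/-! ### The derivative of the Oseen tensor and its parabolic decay -/

section Oseen

variable {d : ℕ}

theorem measurable_heatKernel_time (x : Space d) : Measurable fun s : ℝ => heatKernel s x := by
  unfold heatKernel
  fun_prop

theorem measurable_heatKernel (s : ℝ) : Measurable (heatKernel s : Space d → ℝ) := by
  unfold heatKernel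
  fun_prop

theorem continuousOn_heatKernel_time (x : Space d) :
    ContinuousOn (fun s : ℝ => heatKernel s x) (Ioi 0) := by
  unfold heatKernel
  refine ContinuousOn.mul (ContinuousOn.rpow_const (by fun_prop) fun s hs => ?_)
    (Real.continuous_exp.comp_continuousOn (ContinuousOn.div (by fun_prop) (by fun_prop)
      fun s hs => ?_))
  · have : (0 : ℝ) < s := hs
    left; positivity
  · have : (0 : ℝ) < s := hs
    positivity

theorem measurable_heatHessian_time (i j : Fin d) (x : Space d) :
    Measurable fun s : ℝ => heatHessian i j s x := by
  have := measurable_heatKernel_time x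
  unfold heatHessian
  fun_prop

theorem stronglyMeasurable_heatHessianDeriv_time (i j : Fin d) (x : Space d) :
    StronglyMeasurable fun s : ℝ => heatHessianDeriv i j s x := by
  have h1 := measurable_heatKernel_time x
  have h2 := measurable_heatHessian_time i j x
  unfold heatHessianDeriv
  refine StronglyMeasurable.sub ?_ ?_
  · exact (Measurable.stronglyMeasurable (by fun_prop)).smul_const _
  · exact (Measurable.stronglyMeasurable (by fun_prop)).smul_const _

theorem integrableOn_heatHessian (i j : Fin d) {τ : ℝ} (hτ : 0 < τ) (x : Space d) :
    IntegrableOn (fun s => heatHessian i j s x) (Ioi τ) := by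
  obtain ⟨C, hC0, hC⟩ := exists_heatKernel_bound d
  -- In dimension `0` the bound `s^{-1}` would fail to be integrable at infinity; the index `i`
  -- rules this out.
  have hd : (0 : ℝ) < d := Nat.cast_pos.2 (i.pos)
  refine Integrable.mono' ((integrableOn_Ioi_rpow_of_lt
    (a := -((d : ℝ) / 2 + 1)) (by linarith) hτ).const_mul C)
    (measurable_heatHessian_time i j x).aestronglyMeasurable ?_
  refine (ae_restrict_iff' measurableSet_Ioi).2 (Eventually.of_forall fun s hs => ?_)
  have hs0 : 0 < s := hτ.trans hs
  refine (abs_heatHessian_le hC i j hs0 x).trans ?_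
  exact mul_le_of_le_one_right (by positivity) (decayProfile_le_one hs0 x)

theorem integrableOn_heatHessianDeriv_bound (d : ℕ) (C : ℝ) {τ : ℝ} (hτ : 0 < τ) :
    IntegrableOn (fun s : ℝ => C * s ^ (-((d : ℝ) / 2 + 3 / 2))) (Ioi τ) := by
  have hd : (0 : ℝ) ≤ d := d.cast_nonneg
  exact (integrableOn_Ioi_rpow_of_lt (by linarith) hτ).const_mul C

theorem norm_heatHessianDeriv_le_of_lt {C : ℝ} (hC0 : 0 < C) (hC : ∀ s : ℝ, 0 < s → ∀ x : Space d,
    (1 + ‖x‖ ^ 2 / s) ^ 2 * heatKernel s x ≤ C * s ^ (-((d : ℝ) / 2)) * decayProfile s x)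
    (i j : Fin d) {τ : ℝ} (hτ : 0 < τ) (x : Space d) :
    ∀ᵐ s ∂(volume.restrict (Ioi τ)),
      ‖heatHessianDeriv i j s x‖ ≤ C * s ^ (-((d : ℝ) / 2 + 3 / 2)) := by
  refine (ae_restrict_iff' measurableSet_Ioi).2 (Eventually.of_forall fun s hs => ?_)
  have hs0 : 0 < s := hτ.trans hs
  refine (norm_heatHessianDeriv_le hC i j hs0 x).trans ?_
  exact mul_le_of_le_one_right (by positivity) (decayProfile_le_one hs0 x)

theorem integrableOn_heatHessianDeriv (i j : Fin d) {τ : ℝ} (hτ : 0 < τ) (x : Space d) :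
    IntegrableOn (fun s => heatHessianDeriv i j s x) (Ioi τ) := by
  obtain ⟨C, hC0, hC⟩ := exists_heatKernel_bound d
  exact Integrable.mono' (integrableOn_heatHessianDeriv_bound d C hτ)
    (stronglyMeasurable_heatHessianDeriv_time i j x).aestronglyMeasurable
    (norm_heatHessianDeriv_le_of_lt hC0 hC i j hτ x)

/-- Differentiation under the time integral. Because the profile is at most `1`, the third
derivatives are dominated by `C s^{-(d/2+3/2)}` uniformly in space, so no localisation around `x` is
necessary. -/
theorem hasFDerivAt_oseenTensor (i j : Fin d) {τ : ℝ} (hτ : 0 < τ) (x : Space d) :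
    HasFDerivAt (oseenTensor i j τ)
      ((if i = j then (1 : ℝ) else 0) • (-(heatKernel τ x / (2 * τ)) • innerSL ℝ x) +
        ∫ s in Ioi τ, heatHessianDeriv i j s x) x := by
  obtain ⟨C, hC0, hC⟩ := exists_heatKernel_bound d
  have h1 : HasFDerivAt (fun x : Space d => ∫ s in Ioi τ, heatHessian i j s x)
      (∫ s in Ioi τ, heatHessianDeriv i j s x) x := by
    refine hasFDerivAt_integral_of_dominated_of_fderiv_le (s := univ)
      (bound := fun s => C * s ^ (-((d : ℝ) / 2 + 3 / 2))) univ_mem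
      (Eventually.of_forall fun y => (measurable_heatHessian_time i j y).aestronglyMeasurable)
      (integrableOn_heatHessian i j hτ x)
      (stronglyMeasurable_heatHessianDeriv_time i j x).aestronglyMeasurable
      ?_ (integrableOn_heatHessianDeriv_bound d C hτ)
      (Eventually.of_forall fun s y _ => hasFDerivAt_heatHessian i j s y)
    refine (ae_restrict_iff' measurableSet_Ioi).2 (Eventually.of_forall fun s hs y _ => ?_)
    have hs0 : 0 < s := hτ.trans hs
    refine (norm_heatHessianDeriv_le hC i j hs0 y).trans ?_
    exact mul_le_of_le_one_right (by positivity) (decayProfile_le_one hs0 y)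
  have h2 : oseenTensor i j τ = fun x : Space d =>
      (if i = j then (1 : ℝ) else 0) * heatKernel τ x + ∫ s in Ioi τ, heatHessian i j s x := by
    ext y
    simp only [oseenTensor, partialDeriv_partialDeriv_heatKernel]
    split_ifs <;> simp
  rw [h2]
  exact ((hasFDerivAt_heatKernel τ x).const_mul _).add h1

/-- The kernel `∂_k O_{ij}(τ)`. -/
theorem partialDeriv_oseenTensor (i j k : Fin d) {τ : ℝ} (hτ : 0 < τ) (x : Space d) :
    partialDeriv k (oseenTensor i j τ) x =
      (if i = j then (1 : ℝ) else 0) * (-(heatKernel τ x / (2 * τ)) * x k) +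
        ∫ s in Ioi τ, heatHessianDeriv i j s x (EuclideanSpace.single k 1) := by
  rw [partialDeriv_eq_of_hasFDerivAt (hasFDerivAt_oseenTensor i j hτ x),
    add_apply, ContinuousLinearMap.integral_apply
      (integrableOn_heatHessianDeriv i j hτ x)]
  split_ifs <;> simp [EuclideanSpace.inner_single_right]

/-- A family of kernels with the parabolic decay `|k_τ(x)| ≲ τ^{-a} (1 + |x|²/τ)^{-(d/2+1/4)}` that is
pointwise continuous in time. -/
structure IsParabolicKernel (a : ℝ) (k : ℝ → Space d → ℝ) : Prop where
  bound : ∃ C : ℝ, 0 < C ∧ ∀ τ : ℝ, 0 < τ → ∀ x, |k τ x| ≤ C * τ ^ (-a) * decayProfile τ x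
  continuousOn : ∀ x, ContinuousOn (fun τ => k τ x) (Ioi 0)
  measurable : ∀ τ : ℝ, 0 < τ → Measurable (k τ)

theorem isParabolicKernel_heatKernel : IsParabolicKernel ((d : ℝ) / 2) (heatKernel (d := d)) where
  bound := by
    obtain ⟨C, hC0, hC⟩ := exists_heatKernel_bound d
    refine ⟨C, hC0, fun τ hτ x => le_trans ?_ (hC τ hτ x)⟩
    have h0 := heatKernel_nonneg hτ.le x
    have hρ : 0 ≤ ‖x‖ ^ 2 / τ := by positivity
    rw [abs_of_nonneg h0]
    exact le_mul_of_one_le_left h0 (by nlinarith)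
  continuousOn := continuousOn_heatKernel_time
  measurable := fun τ _ => measurable_heatKernel τ

theorem abs_heatHessianDeriv_single_le (i j k : Fin d) (s : ℝ) (x : Space d) :
    |heatHessianDeriv i j s x (EuclideanSpace.single k 1)| ≤ ‖heatHessianDeriv i j s x‖ := by
  simpa using (heatHessianDeriv i j s x).le_opNorm (EuclideanSpace.single k 1)

/-- Replacing the profile at time `s` by the one at time `τ` leaves the integral of `s^{-(d/2+3/2)}
s^{d/2+1/4} = s^{-5/4}`, whose value `4 τ^{-1/4}` explains the factor `4`. This is the reason for
the `1/4` in the profile: the exponent `d/2 + 1/2` would leave `s^{-1}` and a logarithmic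
divergence, while any exponent above `d/2` is enough for integrability in space. -/
theorem abs_integral_heatHessianDeriv_le {C : ℝ} (hC0 : 0 < C) (hC : ∀ s : ℝ, 0 < s → ∀ x : Space d,
    (1 + ‖x‖ ^ 2 / s) ^ 2 * heatKernel s x ≤ C * s ^ (-((d : ℝ) / 2)) * decayProfile s x)
    (i j k : Fin d) {τ : ℝ} (hτ : 0 < τ) (x : Space d) :
    |∫ s in Ioi τ, heatHessianDeriv i j s x (EuclideanSpace.single k 1)| ≤
      4 * C * τ ^ (-((d : ℝ) / 2 + 1 / 2)) * decayProfile τ x := by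
  set D := C * τ ^ (-((d : ℝ) / 2 + 1 / 4)) * decayProfile τ x with hD
  have hint : IntegrableOn (fun s : ℝ => D * s ^ (-(5 / 4) : ℝ)) (Ioi τ) :=
    (integrableOn_Ioi_rpow_of_lt (by norm_num) hτ).const_mul D
  have h1 : |∫ s in Ioi τ, heatHessianDeriv i j s x (EuclideanSpace.single k 1)| ≤
      ∫ s in Ioi τ, D * s ^ (-(5 / 4) : ℝ) := by
    rw [← Real.norm_eq_abs]
    refine norm_integral_le_of_norm_le hint ?_
    refine (ae_restrict_iff' measurableSet_Ioi).2 (Eventually.of_forall fun s hs => ?_)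
    have hs' : τ < s := hs
    have hs0 : 0 < s := hτ.trans hs
    refine (abs_heatHessianDeriv_single_le i j k s x).trans
      ((norm_heatHessianDeriv_le hC i j hs0 x).trans ?_)
    calc _ ≤ C * s ^ (-((d : ℝ) / 2 + 3 / 2)) *
          ((s / τ) ^ ((d : ℝ) / 2 + 1 / 4) * decayProfile τ x) := by
          gcongr
          exact decayProfile_le hτ hs'.le x
      _ = _ := by
        have e1 : s ^ (-(5 / 4) : ℝ) = s ^ (-((d : ℝ) / 2 + 3 / 2)) * s ^ ((d : ℝ) / 2 + 1 / 4) := by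
          rw [← Real.rpow_add hs0]; congr 1; ring
        rw [Real.div_rpow hs0.le hτ.le, hD, e1, Real.rpow_neg hτ.le, div_eq_mul_inv]
        ring
  refine h1.trans (le_of_eq ?_)
  rw [integral_const_mul, integral_Ioi_rpow_of_lt (by norm_num) hτ, hD]
  have e2 : τ ^ (-((d : ℝ) / 2 + 1 / 2)) = τ ^ (-((d : ℝ) / 2 + 1 / 4)) * τ ^ (-(1 / 4) : ℝ) := by
    rw [← Real.rpow_add hτ]; congr 1; ring
  rw [e2]
  norm_num
  ring

theorem isParabolicKernel_partialDeriv_oseenTensor (i j k : Fin d) :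
    IsParabolicKernel ((d : ℝ) / 2 + 1 / 2) fun τ => partialDeriv k (oseenTensor i j τ) where
  bound := by
    obtain ⟨C, hC0, hC⟩ := exists_heatKernel_bound d
    refine ⟨C + 4 * C, by positivity, fun τ hτ x => ?_⟩
    rw [partialDeriv_oseenTensor i j k hτ, add_mul, add_mul]
    refine (abs_add_le _ _).trans (add_le_add ?_ (abs_integral_heatHessianDeriv_le hC0 hC i j k hτ x))
    have h1 := abs_heatKernel_mul_coord_le hC k hτ x
    split_ifs
    · simpa using h1
    · simpa using (abs_nonneg _).trans h1
  continuousOn := by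
    intro x
    have h1 : ContinuousOn (fun τ => (if i = j then (1 : ℝ) else 0) *
        (-(heatKernel τ x / (2 * τ)) * x k) +
        ∫ s in Ioi τ, heatHessianDeriv i j s x (EuclideanSpace.single k 1)) (Ioi 0) := by
      refine ContinuousOn.add ?_ ?_
      · have h2 := continuousOn_heatKernel_time x
        refine continuousOn_const.mul (ContinuousOn.mul (ContinuousOn.neg
          (h2.div (by fun_prop) fun s hs => ?_)) continuousOn_const)
        have : (0 : ℝ) < s := hs
        positivity
      · intro τ hτ
        have hτ0 : (0 : ℝ) < τ := hτ
        -- The integrand does not involve `τ`; only the lower limit moves. Starting from `τ/2`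
        -- leaves room on both sides of `τ`.
        have h3 : IntegrableOn (fun s => heatHessianDeriv i j s x (EuclideanSpace.single k 1))
            (Ioi (τ / 2)) :=
          (integrableOn_heatHessianDeriv i j (half_pos hτ0) x).apply_continuousLinearMap _
        exact (h3.continuousOn_Ici_primitive_Ioi.continuousAt
          (Ici_mem_nhds (half_lt_self hτ0))).continuousWithinAt
    exact h1.congr fun τ hτ => partialDeriv_oseenTensor i j k hτ x
  measurable := fun τ _ => measurable_fderiv_apply_const ℝ _ _

end Oseen

/-! ### Lebesgue norms of parabolic kernels and their continuity in time -/

section KernelLp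

variable {d : ℕ}

theorem measurable_decayProfile (τ : ℝ) : Measurable (decayProfile τ : Space d → ℝ) := by
  unfold decayProfile
  fun_prop

theorem memLp_decayProfile_one {q : ℝ≥0∞} (hq : 1 ≤ q) (hq' : q ≠ ⊤) :
    MemLp (decayProfile 1 : Space d → ℝ) q volume := by
  have hq1 : 1 ≤ q.toReal := by simpa using ENNReal.toReal_mono hq' hq
  have hq0 : q ≠ 0 := (zero_lt_one.trans_le hq).ne'
  rw [← integrable_norm_rpow_iff (measurable_decayProfile 1).aestronglyMeasurable hq0 hq']
  have hd : (0 : ℝ) ≤ d := d.cast_nonneg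
  -- The `q`-th power of the profile decays like `|x|^{-(d+1/2)q}`, and `(d+1/2)q > d` because `q ≥
  -- 1`.
  have h := integrable_rpow_neg_one_add_norm_sq (E := Space d) (μ := volume)
    (r := (d + 1 / 2) * q.toReal) (by
      rw [finrank_euclideanSpace, Fintype.card_fin]
      nlinarith)
  refine h.congr (Eventually.of_forall fun x => ?_)
  simp only
  rw [Real.norm_of_nonneg (decayProfile_nonneg one_pos x), decayProfile, div_one,
    ← Real.rpow_mul (by positivity)]
  congr 1
  ring

theorem eLpNorm_comp_smul {E : Type*} [NormedAddCommGroup E] {g : Space d → E}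
    (hg : AEStronglyMeasurable g volume) {q : ℝ≥0∞} (hq : q ≠ ⊤) {r : ℝ} (hr : 0 < r) :
    eLpNorm (fun x => g (r • x)) q volume =
      ENNReal.ofReal (r ^ (-((d : ℝ) * (q⁻¹).toReal))) * eLpNorm g q volume := by
  have hmap := Measure.map_addHaar_smul (volume : Measure (Space d)) hr.ne'
  have hm : AEMeasurable (fun x : Space d => r • x) volume := by fun_prop
  have hg' : AEStronglyMeasurable g (Measure.map (fun x : Space d => r • x) volume) := by
    rw [hmap]; exact hg.smul_measure _
  have h1 := eLpNorm_map_measure (p := q) hg' hm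
  rw [hmap, eLpNorm_smul_measure_of_ne_top hq] at h1
  change _ = eLpNorm (fun x => g (r • x)) q volume at h1
  rw [← h1, smul_eq_mul]
  congr 1
  rw [finrank_euclideanSpace, Fintype.card_fin, abs_of_pos (by positivity),
    ENNReal.ofReal_rpow_of_pos (by positivity)]
  congr 1
  rw [Real.rpow_neg hr.le, Real.rpow_mul hr.le, Real.rpow_natCast, Real.inv_rpow (by positivity)]
  simp

theorem decayProfile_eq {τ : ℝ} (hτ : 0 < τ) (x : Space d) :
    decayProfile τ x = decayProfile 1 (τ ^ (-(1 / 2) : ℝ) • x) := by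
  have h1 : (τ ^ (-(1 / 2) : ℝ)) ^ 2 = τ⁻¹ := by
    rw [← Real.rpow_natCast, ← Real.rpow_mul hτ.le, ← Real.rpow_neg_one]
    norm_num
  unfold decayProfile
  rw [norm_smul, Real.norm_of_nonneg (by positivity), mul_pow, h1]
  congr 2
  field_simp

theorem eLpNorm_decayProfile {τ : ℝ} (hτ : 0 < τ) {q : ℝ≥0∞} (hq : q ≠ ⊤) :
    eLpNorm (decayProfile τ : Space d → ℝ) q volume =
      ENNReal.ofReal (τ ^ ((d : ℝ) / 2 * (q⁻¹).toReal)) *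
        eLpNorm (decayProfile 1 : Space d → ℝ) q volume := by
  have h1 : (decayProfile τ : Space d → ℝ) =
      fun x => decayProfile 1 (τ ^ (-(1 / 2) : ℝ) • x) := funext fun x => decayProfile_eq hτ x
  rw [h1, eLpNorm_comp_smul (measurable_decayProfile 1).aestronglyMeasurable hq (by positivity),
    ← Real.rpow_mul hτ.le]
  congr 3
  ring

theorem memLp_decayProfile {τ : ℝ} (hτ : 0 < τ) {q : ℝ≥0∞} (hq : 1 ≤ q) (hq' : q ≠ ⊤) :
    MemLp (decayProfile τ : Space d → ℝ) q volume :=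
  ⟨(measurable_decayProfile τ).aestronglyMeasurable, by
    rw [eLpNorm_decayProfile hτ hq']
    exact ENNReal.mul_lt_top ENNReal.ofReal_lt_top (memLp_decayProfile_one hq hq').2⟩

namespace IsParabolicKernel

variable {a : ℝ} {k : ℝ → Space d → ℝ}

/-- Parabolic scaling: the profile at time `τ` is the profile at time `1` evaluated at `x/√τ`, which
contributes `τ^{d/(2q)}`. -/
theorem eLpNorm_le (hk : IsParabolicKernel a k) {q : ℝ≥0∞} (hq : 1 ≤ q) (hq' : q ≠ ⊤) :
    ∃ C : ℝ, 0 < C ∧ ∀ τ : ℝ, 0 < τ →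
      eLpNorm (k τ) q volume ≤ ENNReal.ofReal (C * τ ^ (-a + (d : ℝ) / 2 * (q⁻¹).toReal)) := by
  obtain ⟨C, hC, h⟩ := hk.bound
  have hm := memLp_decayProfile_one (d := d) hq hq'
  set D := (eLpNorm (decayProfile 1 : Space d → ℝ) q volume).toReal with hD
  have hDe : eLpNorm (decayProfile 1 : Space d → ℝ) q volume = ENNReal.ofReal D :=
    (ENNReal.ofReal_toReal hm.2.ne).symm
  have hD0 : 0 ≤ D := ENNReal.toReal_nonneg
  refine ⟨C * (D + 1), by positivity, fun τ hτ => ?_⟩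
  have h1 : eLpNorm (k τ) q volume ≤
      ENNReal.ofReal (C * τ ^ (-a)) * eLpNorm (decayProfile τ : Space d → ℝ) q volume := by
    refine eLpNorm_le_mul_eLpNorm_of_ae_le_mul (Eventually.of_forall fun x => ?_) q
    rw [Real.norm_eq_abs, Real.norm_of_nonneg (decayProfile_nonneg hτ x)]
    exact h τ hτ x
  refine h1.trans ?_
  rw [eLpNorm_decayProfile hτ hq', hDe, ← ENNReal.ofReal_mul (by positivity),
    ← ENNReal.ofReal_mul (by positivity)]
  refine ENNReal.ofReal_le_ofReal ?_
  rw [Real.rpow_add hτ]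
  calc _ = C * D * (τ ^ (-a) * τ ^ ((d : ℝ) / 2 * (q⁻¹).toReal)) := by ring
    _ ≤ _ := by gcongr; linarith

theorem memLp (hk : IsParabolicKernel a k) {q : ℝ≥0∞} (hq : 1 ≤ q) (hq' : q ≠ ⊤) {τ : ℝ}
    (hτ : 0 < τ) : MemLp (k τ) q volume := by
  obtain ⟨C, hC, h⟩ := hk.eLpNorm_le hq hq'
  exact ⟨(hk.measurable τ hτ).aestronglyMeasurable, (h τ hτ).trans_lt ENNReal.ofReal_lt_top⟩

/-- Dominated convergence on the time window `[τ/2, 2τ]`. The profile increases with time, so a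
multiple of the one at time `2τ` dominates all kernels in the window. -/
theorem tendsto_eLpNorm_sub (hk : IsParabolicKernel a k) {q : ℝ≥0∞} (hq : 1 ≤ q) (hq' : q ≠ ⊤)
    {τ : ℝ} (hτ : 0 < τ) :
    Tendsto (fun σ => eLpNorm (k σ - k τ) q volume) (𝓝 τ) (𝓝 0) := by
  obtain ⟨C, hC, h⟩ := hk.bound
  have hq0 : q ≠ 0 := (zero_lt_one.trans_le hq).ne'
  have hq1 : 0 < q.toReal := ENNReal.toReal_pos hq0 hq'
  obtain ⟨M, hM⟩ : ∃ M : ℝ, ∀ σ ∈ Icc (τ / 2) (2 * τ), σ ^ (-a) ≤ M := by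
    obtain ⟨M, hM⟩ := isCompact_Icc.bddAbove_image (f := fun σ : ℝ => σ ^ (-a))
      (K := Icc (τ / 2) (2 * τ)) (continuousOn_id.rpow_const fun σ hσ =>
        Or.inl ((half_pos hτ).trans_le hσ.1).ne')
    exact ⟨M, fun σ hσ => hM ⟨σ, hσ, rfl⟩⟩
  have hI : Icc (τ / 2) (2 * τ) ∈ 𝓝 τ := Icc_mem_nhds (by linarith) (by linarith)
  have hb : ∀ σ ∈ Icc (τ / 2) (2 * τ), ∀ x, |k σ x| ≤ C * M * decayProfile (2 * τ) x := by
    intro σ hσ x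
    have hσ0 : 0 < σ := (half_pos hτ).trans_le hσ.1
    refine (h σ hσ0 x).trans (mul_le_mul ?_ (decayProfile_mono hσ0 hσ.2 x)
      (decayProfile_nonneg hσ0 x) ?_)
    · gcongr
      exact hM σ hσ
    · exact mul_nonneg hC.le ((Real.rpow_nonneg hσ0.le _).trans (hM σ hσ))
  have hτI : τ ∈ Icc (τ / 2) (2 * τ) := mem_of_mem_nhds hI
  have hbound : ∀ σ ∈ Icc (τ / 2) (2 * τ), ∀ x, ‖(k σ - k τ) x‖ₑ ^ q.toReal ≤
      ‖2 * (C * M) * decayProfile (2 * τ) x‖ₑ ^ q.toReal := by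
    intro σ hσ x
    gcongr
    rw [enorm_le_iff_norm_le, Real.norm_eq_abs, Real.norm_eq_abs]
    refine le_trans ?_ (le_abs_self _)
    rw [Pi.sub_apply]
    refine (abs_sub _ _).trans ?_
    linarith [hb σ hσ x, hb τ hτI x]
  have hlim : Tendsto (fun σ => ∫⁻ x, ‖(k σ - k τ) x‖ₑ ^ q.toReal) (𝓝 τ)
      (𝓝 (∫⁻ _ : Space d, 0)) := by
    refine tendsto_lintegral_filter_of_dominated_convergence
      (fun x => ‖2 * (C * M) * decayProfile (2 * τ) x‖ₑ ^ q.toReal) ?_ ?_ ?_ ?_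
    · filter_upwards [hI] with σ hσ
      have h1 := hk.measurable σ ((half_pos hτ).trans_le hσ.1)
      have h2 := hk.measurable τ hτ
      exact ((h1.sub h2).enorm).pow_const _
    · filter_upwards [hI] with σ hσ
      exact Eventually.of_forall (hbound σ hσ)
    · have := ((memLp_decayProfile (d := d) (show 0 < 2 * τ by positivity) hq hq').const_mul
        (2 * (C * M)))
      exact (lintegral_rpow_enorm_lt_top_of_eLpNorm_lt_top hq0 hq' this.2).ne
    · refine Eventually.of_forall fun x => ?_
      have h1 : Tendsto (fun σ => k σ x) (𝓝 τ) (𝓝 (k τ x)) :=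
        (hk.continuousOn x).continuousAt (Ioi_mem_nhds hτ)
      have h2 : Tendsto (fun σ => ‖k σ x - k τ x‖ₑ ^ q.toReal) (𝓝 τ)
          (𝓝 (‖k τ x - k τ x‖ₑ ^ q.toReal)) :=
        (ENNReal.continuous_rpow_const.tendsto _).comp ((h1.sub_const _).enorm)
      simpa [hq1] using h2
  rw [lintegral_zero] at hlim
  have h3 := (ENNReal.continuous_rpow_const (y := 1 / q.toReal)).tendsto 0 |>.comp hlim
  rw [ENNReal.zero_rpow_of_pos (by positivity)] at h3
  refine h3.congr fun σ => ?_
  rw [eLpNorm_eq_lintegral_rpow_enorm_toReal hq0 hq']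
  rfl

end IsParabolicKernel

end KernelLp

/-! ### Fixed point theory for a quadratic map with an integrable time singularity -/

section AbstractDuhamel

variable {X Y : Type*} [NormedAddCommGroup X] [NormedAddCommGroup Y]

/-- A family of locally Lipschitz maps, vanishing quadratically at zero, with a singularity
`τ^{-α}` at `τ = 0`. -/
structure IsSingularQuadratic (A α : ℝ) (Q : ℝ → X → Y) : Prop where
  map_zero : ∀ τ : ℝ, 0 < τ → Q τ 0 = 0
  lipschitz : ∀ τ : ℝ, 0 < τ → ∀ u v, ‖Q τ u - Q τ v‖ ≤ A * τ ^ (-α) * ((‖u‖ + ‖v‖) * ‖u - v‖)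
  continuousOn_time : ∀ u, ContinuousOn (fun τ => Q τ u) (Ioi 0)

/-- The Duhamel integral `∫_0^t Q_{t-s}(u(s)) ds`. -/
def duhamelIntegral [NormedSpace ℝ X] (Q : ℝ → X → X) (u : ℝ → X) (t : ℝ) : X := ∫ s in (0 : ℝ)..t, Q (t - s) (u s)

namespace IsSingularQuadratic

variable {A α : ℝ}

section General

variable {Q : ℝ → X → Y}

theorem norm_le (hQ : IsSingularQuadratic A α Q) {τ : ℝ} (hτ : 0 < τ) (u : X) :
    ‖Q τ u‖ ≤ A * τ ^ (-α) * ‖u‖ ^ 2 := by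
  have h := hQ.lipschitz τ hτ u 0
  rw [hQ.map_zero τ hτ] at h
  simpa [pow_two] using h

/-- Continuity in time with the vector frozen, combined with a Lipschitz constant in the vector that
is locally bounded in `τ`, gives joint continuity. -/
theorem continuousOn_uncurry (hQ : IsSingularQuadratic A α Q) :
    ContinuousOn (Function.uncurry Q) (Ioi 0 ×ˢ univ) := by
  rintro ⟨τ₀, u₀⟩ ⟨hτ₀ : 0 < τ₀, -⟩
  refine ContinuousAt.continuousWithinAt ?_
  have h1 : ContinuousAt (fun z : ℝ × X => A * z.1 ^ (-α) * ((‖z.2‖ + ‖u₀‖) * ‖z.2 - u₀‖) +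
      ‖Q z.1 u₀ - Q τ₀ u₀‖) (τ₀, u₀) := by
    have h2 : ContinuousAt (fun z : ℝ × X => Q z.1 u₀) (τ₀, u₀) :=
      ContinuousAt.comp (g := fun τ => Q τ u₀) (f := Prod.fst)
        ((hQ.continuousOn_time u₀).continuousAt (Ioi_mem_nhds hτ₀)) continuousAt_fst
    have h3 : ContinuousAt (fun z : ℝ × X => z.1 ^ (-α)) (τ₀, u₀) :=
      continuousAt_fst.rpow_const (Or.inl hτ₀.ne')
    refine ContinuousAt.add (ContinuousAt.mul (continuousAt_const.mul h3) ?_) (h2.sub continuousAt_const).norm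
    fun_prop
  refine tendsto_iff_norm_sub_tendsto_zero.2 ?_
  have h4 : Tendsto (fun z : ℝ × X => A * z.1 ^ (-α) * ((‖z.2‖ + ‖u₀‖) * ‖z.2 - u₀‖) +
      ‖Q z.1 u₀ - Q τ₀ u₀‖) (𝓝 (τ₀, u₀)) (𝓝 0) := by
    simpa [ContinuousAt] using h1
  refine squeeze_zero' (Eventually.of_forall fun z => norm_nonneg _) ?_ h4
  filter_upwards [continuousAt_fst.eventually (Ioi_mem_nhds hτ₀)] with z hz
  calc ‖Q z.1 z.2 - Q τ₀ u₀‖ ≤ ‖Q z.1 z.2 - Q z.1 u₀‖ + ‖Q z.1 u₀ - Q τ₀ u₀‖ :=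
        norm_sub_le_norm_sub_add_norm_sub _ _ _
    _ ≤ _ := by gcongr; exact hQ.lipschitz _ hz _ _

theorem continuousOn_comp (hQ : IsSingularQuadratic A α Q) {S : Set ℝ} {σ : ℝ → ℝ} {u : ℝ → X}
    (hσ : ContinuousOn σ S) (hσ0 : ∀ s ∈ S, 0 < σ s) (hu : ContinuousOn u S) :
    ContinuousOn (fun s => Q (σ s) (u s)) S :=
  hQ.continuousOn_uncurry.comp (hσ.prodMk hu) fun s hs => ⟨hσ0 s hs, mem_univ _⟩

end General

theorem intervalIntegrable_of_norm_le {f : ℝ → X} {g : ℝ → ℝ} {t : ℝ} (ht : 0 ≤ t)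
    (hf : ContinuousOn f (Ioo 0 t)) (hg : IntervalIntegrable g volume 0 t)
    (h : ∀ s ∈ Ioo 0 t, ‖f s‖ ≤ g s) : IntervalIntegrable f volume 0 t := by
  rw [intervalIntegrable_iff_integrableOn_Ioo_of_le ht] at hg ⊢
  exact Integrable.mono' hg (hf.aestronglyMeasurable measurableSet_Ioo)
    ((ae_restrict_iff' measurableSet_Ioo).2 (Eventually.of_forall h))

variable [NormedSpace ℝ X] {Q : ℝ → X → X}

theorem intervalIntegrable_rpow_sub (hα : α < 1) (t : ℝ) :
    IntervalIntegrable (fun s : ℝ => (t - s) ^ (-α)) volume 0 t := by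
  have h := (intervalIntegral.intervalIntegrable_rpow' (a := 0) (b := t)
    (r := -α) (by linarith)).comp_sub_left t
  simpa using h.symm

theorem integral_rpow_sub (hα : α < 1) (t : ℝ) :
    ∫ s in (0 : ℝ)..t, (t - s) ^ (-α) = t ^ (1 - α) / (1 - α) := by
  rw [intervalIntegral.integral_comp_sub_left (fun s => s ^ (-α)), sub_self, sub_zero,
    integral_rpow (Or.inl (by linarith)), Real.zero_rpow (by linarith)]
  rw [neg_add_eq_sub, sub_zero]

variable {T M : ℝ} {u v a : ℝ → X}

theorem mem_Ioc_of_mem_Ioo {s t : ℝ} (ht : t ∈ Ioc 0 T) (hs : s ∈ Ioo 0 t) : s ∈ Ioc 0 T :=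
  ⟨hs.1, hs.2.le.trans ht.2⟩

theorem continuousOn_integrand (hQ : IsSingularQuadratic A α Q) (hu : ContinuousOn u (Ioc 0 T))
    {t : ℝ} (ht : t ∈ Ioc 0 T) : ContinuousOn (fun s => Q (t - s) (u s)) (Ioo 0 t) :=
  hQ.continuousOn_comp (by fun_prop) (fun s hs => sub_pos.2 hs.2)
    (hu.mono fun s hs => mem_Ioc_of_mem_Ioo ht hs)

theorem norm_integrand_le (hQ : IsSingularQuadratic A α Q) (hA : 0 ≤ A)
    (hM : ∀ t ∈ Ioc 0 T, ‖u t‖ ≤ M) {t : ℝ} (ht : t ∈ Ioc 0 T) {s : ℝ} (hs : s ∈ Ioo 0 t) :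
    ‖Q (t - s) (u s)‖ ≤ A * M ^ 2 * (t - s) ^ (-α) := by
  have hts : 0 < t - s := sub_pos.2 hs.2
  refine (hQ.norm_le hts (u s)).trans ?_
  calc _ ≤ A * (t - s) ^ (-α) * M ^ 2 := by
        gcongr
        exact hM s (mem_Ioc_of_mem_Ioo ht hs)
    _ = _ := by ring

theorem intervalIntegrable (hQ : IsSingularQuadratic A α Q) (hA : 0 ≤ A) (hα : α < 1)
    (hu : ContinuousOn u (Ioc 0 T)) (hM : ∀ t ∈ Ioc 0 T, ‖u t‖ ≤ M) {t : ℝ} (ht : t ∈ Ioc 0 T) :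
    IntervalIntegrable (fun s => Q (t - s) (u s)) volume 0 t :=
  intervalIntegrable_of_norm_le ht.1.le (hQ.continuousOn_integrand hu ht)
    ((intervalIntegrable_rpow_sub hα t).const_mul (A * M ^ 2))
    fun _ hs => hQ.norm_integrand_le hA hM ht hs

theorem norm_duhamelIntegral_le (hQ : IsSingularQuadratic A α Q) (hA : 0 ≤ A) (hα : α < 1)
    (hM : ∀ t ∈ Ioc 0 T, ‖u t‖ ≤ M) {t : ℝ} (ht : t ∈ Ioc 0 T) :
    ‖duhamelIntegral Q u t‖ ≤ A * M ^ 2 * (t ^ (1 - α) / (1 - α)) := by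
  rw [← integral_rpow_sub hα, ← intervalIntegral.integral_const_mul]
  refine intervalIntegral.norm_integral_le_of_norm_le ht.1.le ?_
    ((intervalIntegrable_rpow_sub hα t).const_mul (A * M ^ 2))
  filter_upwards [compl_mem_ae_iff.2 (measure_singleton t)] with s hst hs
  exact hQ.norm_integrand_le hA hM ht ⟨hs.1, lt_of_le_of_ne hs.2 hst⟩

/-- The majorant `W` is left free: a constant serves the contraction estimate, an exponential serves
uniqueness. -/
theorem norm_duhamelIntegral_sub_le (hQ : IsSingularQuadratic A α Q) (hA : 0 ≤ A) (hα : α < 1)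
    (hu : ContinuousOn u (Ioc 0 T)) (hMu : ∀ t ∈ Ioc 0 T, ‖u t‖ ≤ M)
    (hv : ContinuousOn v (Ioc 0 T)) (hMv : ∀ t ∈ Ioc 0 T, ‖v t‖ ≤ M) {W : ℝ → ℝ}
    (hW : Continuous W) {t : ℝ} (ht : t ∈ Ioc 0 T) (h : ∀ s ∈ Ioo 0 t, ‖u s - v s‖ ≤ W s) :
    ‖duhamelIntegral Q u t - duhamelIntegral Q v t‖ ≤
      2 * A * M * ∫ s in (0 : ℝ)..t, (t - s) ^ (-α) * W s := by
  unfold duhamelIntegral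
  rw [← intervalIntegral.integral_sub (hQ.intervalIntegrable hA hα hu hMu ht)
    (hQ.intervalIntegrable hA hα hv hMv ht), ← intervalIntegral.integral_const_mul]
  refine intervalIntegral.norm_integral_le_of_norm_le ht.1.le ?_
    (((intervalIntegrable_rpow_sub hα t).mul_continuousOn hW.continuousOn).const_mul _)
  filter_upwards [compl_mem_ae_iff.2 (measure_singleton t)] with s hst hs
  have hs' : s ∈ Ioo 0 t := ⟨hs.1, lt_of_le_of_ne hs.2 hst⟩
  have hts : 0 < t - s := sub_pos.2 hs'.2
  have hsT := mem_Ioc_of_mem_Ioo ht hs'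
  have hM0 : 0 ≤ M := (norm_nonneg _).trans (hMu s hsT)
  refine (hQ.lipschitz _ hts _ _).trans ?_
  calc _ ≤ A * (t - s) ^ (-α) * ((M + M) * W s) := by
        gcongr
        · exact hMu s hsT
        · exact hMv s hsT
        · exact h s hs'
    _ = _ := by ring

/-- The substitution `τ = t - s` moves the singularity to the fixed point `τ = 0`. Extending the
integrand by zero beyond `t` fixes the domain, and dominated convergence applies with majorant `A M²
τ^{-α}`; the integrand converges for every `τ ≠ t₀`. -/
theorem continuousOn_duhamelIntegral (hQ : IsSingularQuadratic A α Q) (hA : 0 ≤ A) (hα : α < 1)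
    (hu : ContinuousOn u (Ioc 0 T)) (hM : ∀ t ∈ Ioc 0 T, ‖u t‖ ≤ M) :
    ContinuousOn (duhamelIntegral Q u) (Ioc 0 T) := by
  have hcont : ∀ t ∈ Ioc 0 T, ContinuousOn (fun τ => Q τ (u (t - τ))) (Ioo 0 t) := by
    intro t ht
    refine hQ.continuousOn_comp continuousOn_id (fun τ hτ => hτ.1)
      (hu.comp (by fun_prop) fun τ hτ => ⟨sub_pos.2 hτ.2, ?_⟩)
    linarith [hτ.1, ht.2]
  have hrep : ∀ t ∈ Ioc 0 T, duhamelIntegral Q u t =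
      ∫ τ in Ioc 0 T, (Ioo 0 t).indicator (fun τ => Q τ (u (t - τ))) τ := by
    intro t ht
    rw [setIntegral_indicator measurableSet_Ioo,
      inter_eq_self_of_subset_right fun s hs => mem_Ioc_of_mem_Ioo ht hs,
      ← integral_Ioc_eq_integral_Ioo, ← intervalIntegral.integral_of_le ht.1.le, duhamelIntegral]
    have := intervalIntegral.integral_comp_sub_left (a := 0) (b := t)
      (fun τ => Q τ (u (t - τ))) t
    simpa using this
  refine ContinuousOn.congr ?_ hrep
  intro t₀ ht₀
  have hnorm : ∀ t ∈ Ioc 0 T, ∀ τ ∈ Ioc 0 T,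
      ‖(Ioo 0 t).indicator (fun τ => Q τ (u (t - τ))) τ‖ ≤ A * M ^ 2 * τ ^ (-α) := by
    intro t ht τ hτ
    have hτ0 : 0 < τ := hτ.1
    by_cases hmem : τ ∈ Ioo 0 t
    · rw [indicator_of_mem hmem]
      have h1 := hQ.norm_integrand_le hA hM ht (s := t - τ)
        ⟨sub_pos.2 hmem.2, sub_lt_self _ hτ0⟩
      simpa using h1
    · rw [indicator_of_notMem hmem, norm_zero]
      positivity
  refine continuousWithinAt_of_dominated (bound := fun τ => A * M ^ 2 * τ ^ (-α)) ?_ ?_ ?_ ?_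
  · filter_upwards [self_mem_nhdsWithin] with t ht
    refine AEStronglyMeasurable.restrict ?_
    exact (aestronglyMeasurable_indicator_iff measurableSet_Ioo).2
      ((hcont t ht).aestronglyMeasurable measurableSet_Ioo)
  · filter_upwards [self_mem_nhdsWithin] with t ht
    exact (ae_restrict_iff' measurableSet_Ioc).2 (Eventually.of_forall (hnorm t ht))
  · have hT : 0 ≤ T := ht₀.1.le.trans ht₀.2
    exact (((intervalIntegrable_iff_integrableOn_Ioc_of_le hT).1
      (intervalIntegral.intervalIntegrable_rpow' (r := -α) (by linarith))).const_mul _)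
  · refine (ae_restrict_iff' measurableSet_Ioc).2 ?_
    filter_upwards [compl_mem_ae_iff.2 (measure_singleton t₀)] with τ hne hτ
    rcases lt_or_gt_of_ne hne with hlt | hgt
    · have hmem : t₀ - τ ∈ Ioc 0 T := ⟨sub_pos.2 hlt, by linarith [hτ.1, ht₀.2]⟩
      have hmaps : ∀ᶠ t in 𝓝[Ioc 0 T] t₀, τ ∈ Ioo 0 t ∧ t - τ ∈ Ioc 0 T := by
        filter_upwards [self_mem_nhdsWithin, mem_nhdsWithin_of_mem_nhds (Ioi_mem_nhds hlt)]
          with t ht htτ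
        have htτ' : τ < t := htτ
        exact ⟨⟨hτ.1, htτ⟩, sub_pos.2 htτ, by linarith [hτ.1, ht.2]⟩
      have h1 : Tendsto (fun t => t - τ) (𝓝[Ioc 0 T] t₀) (𝓝[Ioc 0 T] (t₀ - τ)) := by
        refine tendsto_nhdsWithin_iff.2 ⟨?_, hmaps.mono fun t h => h.2⟩
        exact ((continuous_sub_right τ).tendsto t₀).mono_left nhdsWithin_le_nhds
      have h2 : Tendsto (fun t => u (t - τ)) (𝓝[Ioc 0 T] t₀) (𝓝 (u (t₀ - τ))) :=
        (hu _ hmem).tendsto.comp h1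
      have h3 : ContinuousAt (Function.uncurry Q) (τ, u (t₀ - τ)) :=
        hQ.continuousOn_uncurry.continuousAt (prod_mem_nhds (Ioi_mem_nhds hτ.1) univ_mem)
      have h4 : Tendsto (fun t => Q τ (u (t - τ))) (𝓝[Ioc 0 T] t₀) (𝓝 (Q τ (u (t₀ - τ)))) :=
        h3.tendsto.comp (tendsto_const_nhds.prodMk_nhds h2)
      have h5 : (Ioo 0 t₀).indicator (fun τ => Q τ (u (t₀ - τ))) τ = Q τ (u (t₀ - τ)) :=
        indicator_of_mem (show τ ∈ Ioo 0 t₀ from ⟨hτ.1, hlt⟩) _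
      unfold ContinuousWithinAt
      simp only [h5]
      refine h4.congr' ?_
      filter_upwards [hmaps] with t ht
      rw [indicator_of_mem ht.1]
    · have h6 : ∀ t < τ, (Ioo 0 t).indicator (fun τ => Q τ (u (t - τ))) τ = 0 :=
        fun t ht => indicator_of_notMem (fun h => (lt_asymm h.2 ht)) _
      unfold ContinuousWithinAt
      simp only [h6 t₀ hgt]
      refine tendsto_const_nhds.congr' ?_
      filter_upwards [mem_nhdsWithin_of_mem_nhds (Iio_mem_nhds hgt)] with t ht
      exact (h6 t ht).symm

/-- After `τ = t - s` the integral is enlarged to the half line, where it is a Gamma integral. The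
gain is the factor `l^{-(1-α)}`, which tends to `0` as the weight parameter `l` grows. -/
theorem integral_rpow_mul_exp_le (hα : α < 1) {l : ℝ} (hl : 0 < l) {t : ℝ} (ht : 0 ≤ t) :
    ∫ s in (0 : ℝ)..t, (t - s) ^ (-α) * Real.exp (l * s) ≤
      Real.exp (l * t) * ((1 / l) ^ (1 - α) * Real.Gamma (1 - α)) := by
  have h1 := intervalIntegral.integral_comp_sub_left (a := 0) (b := t)
    (fun τ => τ ^ (-α) * Real.exp (l * (t - τ))) t
  simp only [sub_sub_cancel, sub_self, sub_zero] at h1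
  rw [h1]
  have h2 : (fun τ => τ ^ (-α) * Real.exp (l * (t - τ))) =
      fun τ => Real.exp (l * t) * (τ ^ (-α) * Real.exp (-(l * τ))) := by
    ext τ
    rw [mul_sub, sub_eq_add_neg, Real.exp_add]
    ring
  rw [h2, intervalIntegral.integral_const_mul]
  refine mul_le_mul_of_nonneg_left ?_ (Real.exp_pos _).le
  have h3 := Real.integral_rpow_mul_exp_neg_mul_Ioi (a := 1 - α) (r := l) (by linarith) hl
  rw [sub_sub_cancel_left] at h3
  rw [← h3, intervalIntegral.integral_of_le ht]
  refine setIntegral_mono_set ?_ ?_ Ioc_subset_Ioi_self.eventuallyLE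
  -- A non-integrable function has Bochner integral zero by convention, so the positive value just
  -- computed proves integrability.
  · refine not_imp_comm.1 integral_undef ?_
    rw [h3]
    have := Real.Gamma_pos_of_pos (sub_pos.2 hα)
    positivity
  · refine (ae_restrict_iff' measurableSet_Ioi).2 (Eventually.of_forall fun τ hτ => ?_)
    have : (0 : ℝ) < τ := hτ
    simp only [Pi.zero_apply]
    positivity

/-- In the norm with weight `e^{-lt}` and `l` large in terms of `M`, the Duhamel difference estimate
gains a factor `1/2`. Iterating it from the trivial bound `2M` forces the difference to vanish, on
an interval of any length and for bounds of any size. -/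
theorem mild_unique (hQ : IsSingularQuadratic A α Q) (hA : 0 ≤ A) (hα : α < 1)
    (hu : ContinuousOn u (Ioc 0 T)) (hMu : ∀ t ∈ Ioc 0 T, ‖u t‖ ≤ M)
    (hv : ContinuousOn v (Ioc 0 T)) (hMv : ∀ t ∈ Ioc 0 T, ‖v t‖ ≤ M)
    (hue : ∀ t ∈ Ioc 0 T, u t = a t - duhamelIntegral Q u t)
    (hve : ∀ t ∈ Ioc 0 T, v t = a t - duhamelIntegral Q v t) :
    ∀ t ∈ Ioc 0 T, u t = v t := by
  intro t₁ ht₁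
  have hM0 : 0 ≤ M := (norm_nonneg _).trans (hMu t₁ ht₁)
  obtain ⟨l, hl, hsmall⟩ : ∃ l : ℝ, 0 < l ∧
      2 * A * M * ((1 / l) ^ (1 - α) * Real.Gamma (1 - α)) ≤ 1 / 2 := by
    have h1 : Tendsto (fun l : ℝ => 2 * A * M * ((1 / l) ^ (1 - α) * Real.Gamma (1 - α))) atTop
        (𝓝 (2 * A * M * (0 ^ (1 - α) * Real.Gamma (1 - α)))) := by
      refine ((Tendsto.rpow_const ?_ (Or.inr (by linarith))).mul_const _).const_mul _
      exact tendsto_const_nhds.div_atTop tendsto_id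
    rw [Real.zero_rpow (by linarith), zero_mul, mul_zero] at h1
    obtain ⟨l, h2, h3⟩ := ((h1.eventually_le_const (show (0 : ℝ) < 1 / 2 by norm_num)).and
      (eventually_gt_atTop 0)).exists
    exact ⟨l, h3, h2⟩
  have hind : ∀ n : ℕ, ∀ t ∈ Ioc 0 T, ‖u t - v t‖ ≤ 2 * M * (1 / 2) ^ n * Real.exp (l * t) := by
    intro n
    induction n with
    | zero =>
      intro t ht
      have h1 : 1 ≤ Real.exp (l * t) := Real.one_le_exp (mul_nonneg hl.le ht.1.le)
      have h2 := norm_sub_le (u t) (v t)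
      have h3 := hMu t ht
      have h4 := hMv t ht
      nlinarith
    | succ n ih =>
      intro t ht
      have h1 := hQ.norm_duhamelIntegral_sub_le hA hα hu hMu hv hMv
        (W := fun s => 2 * M * (1 / 2) ^ n * Real.exp (l * s)) (by fun_prop) ht
        fun s hs => ih s (mem_Ioc_of_mem_Ioo ht hs)
      have h2 : ∫ s in (0 : ℝ)..t, (t - s) ^ (-α) * (2 * M * (1 / 2) ^ n * Real.exp (l * s)) =
          2 * M * (1 / 2) ^ n * ∫ s in (0 : ℝ)..t, (t - s) ^ (-α) * Real.exp (l * s) := by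
        rw [← intervalIntegral.integral_const_mul]
        congr 1
        ext s
        ring
      rw [h2] at h1
      have h3 := integral_rpow_mul_exp_le hα hl ht.1.le
      have h4 : u t - v t = -(duhamelIntegral Q u t - duhamelIntegral Q v t) := by
        rw [hue t ht, hve t ht]; abel
      rw [h4, norm_neg]
      refine h1.trans ?_
      calc _ ≤ 2 * A * M * (2 * M * (1 / 2) ^ n *
            (Real.exp (l * t) * ((1 / l) ^ (1 - α) * Real.Gamma (1 - α)))) := by gcongr
        _ = 2 * M * (1 / 2) ^ n * Real.exp (l * t) *
            (2 * A * M * ((1 / l) ^ (1 - α) * Real.Gamma (1 - α))) := by ring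
        _ ≤ 2 * M * (1 / 2) ^ n * Real.exp (l * t) * (1 / 2) := by gcongr
        _ = _ := by ring
  have hlim : Tendsto (fun n : ℕ => 2 * M * (1 / 2) ^ n * Real.exp (l * t₁)) atTop (𝓝 0) := by
    have := ((tendsto_pow_atTop_nhds_zero_of_lt_one (r := (1 / 2 : ℝ)) (by norm_num)
      (by norm_num)).const_mul (2 * M)).mul_const (Real.exp (l * t₁))
    simpa using this
  have h0 := ge_of_tendsto' hlim fun n => hind n t₁ ht₁
  exact sub_eq_zero.1 (norm_le_zero_iff.1 h0)

/-- Banach's fixed point theorem in bounded continuous functions on `(0,T]`. On the ball of radius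
`2N` the smallness condition bounds the Duhamel term by `A(2N)² T^{1-α}/(1-α) ≤ N/2` and the
Lipschitz constant by `4AN T^{1-α}/(1-α) ≤ 1/2`. Time `0` is left out because the heat flow of `L^∞`
data need not be continuous there. -/
theorem exists_mild [CompleteSpace X] (hQ : IsSingularQuadratic A α Q) (hA : 0 ≤ A) (hα : α < 1)
    {N : ℝ} (hN : 0 ≤ N) (ha : ContinuousOn a (Ioc 0 T)) (haN : ∀ t ∈ Ioc 0 T, ‖a t‖ ≤ N)
    (hsmall : 8 * A * N * T ^ (1 - α) ≤ 1 - α) :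
    ∃ u : ℝ → X, ContinuousOn u (Ioc 0 T) ∧ (∀ t ∈ Ioc 0 T, ‖u t‖ ≤ 2 * N) ∧
      ∀ t ∈ Ioc 0 T, u t = a t - duhamelIntegral Q u t := by
  have hα' : 0 < 1 - α := sub_pos.2 hα
  -- Extension by zero to all times; the Duhamel integral at `t ≤ T` depends only on the values
  -- inside `(0,T]`.
  let ex : BoundedContinuousFunction (Ioc 0 T) X → ℝ → X :=
    fun w => Function.extend Subtype.val w 0
  have hex (w) (t : Ioc 0 T) : ex w t = w t := Subtype.val_injective.extend_apply _ _ _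
  have hexc (w) : ContinuousOn (ex w) (Ioc 0 T) := by
    rw [continuousOn_iff_continuous_domRestrict]
    convert w.continuous using 1
    ext t
    exact hex w t
  have hexn (w) : ∀ t ∈ Ioc 0 T, ‖ex w t‖ ≤ ‖w‖ := fun t ht => by
    rw [hex w ⟨t, ht⟩]
    exact w.norm_coe_le_norm _
  have htT : ∀ t ∈ Ioc 0 T, t ^ (1 - α) / (1 - α) ≤ T ^ (1 - α) / (1 - α) := fun t ht => by
    have := ht.1.le
    gcongr
    exact ht.2
  have hbound (w) : ∀ t ∈ Ioc 0 T, ‖a t - duhamelIntegral Q (ex w) t‖ ≤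
      N + A * ‖w‖ ^ 2 * (T ^ (1 - α) / (1 - α)) := fun t ht => by
    refine (norm_sub_le _ _).trans (add_le_add (haN t ht) ?_)
    exact (hQ.norm_duhamelIntegral_le hA hα (hexn w) ht).trans 
      (mul_le_mul_of_nonneg_left (htT t ht) (by positivity))
  let Ψ : BoundedContinuousFunction (Ioc 0 T) X → BoundedContinuousFunction (Ioc 0 T) X :=
    fun w => BoundedContinuousFunction.ofNormedAddCommGroup
      (fun t : Ioc 0 T => a t - duhamelIntegral Q (ex w) t)
      (continuousOn_iff_continuous_domRestrict.1
        (ha.sub (hQ.continuousOn_duhamelIntegral hA hα (hexc w) (hexn w))))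
      (N + A * ‖w‖ ^ 2 * (T ^ (1 - α) / (1 - α))) fun t => hbound w t t.2
  have hΨ (w) (t : Ioc 0 T) : Ψ w t = a t - duhamelIntegral Q (ex w) t := rfl
  have hsmall' : 8 * A * N * (T ^ (1 - α) / (1 - α)) ≤ 1 := by
    rw [← mul_div_assoc]
    exact (div_le_one hα').2 hsmall
  have hball (w) (hw : w ∈ Metric.closedBall (0 : BoundedContinuousFunction (Ioc 0 T) X) (2 * N)) :
      ‖w‖ ≤ 2 * N := by simpa using hw
  have hmaps : MapsTo Ψ (Metric.closedBall 0 (2 * N)) (Metric.closedBall 0 (2 * N)) := by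
    intro w hw
    rw [mem_closedBall_zero_iff, BoundedContinuousFunction.norm_le (by positivity)]
    intro t
    have h1 := hQ.norm_duhamelIntegral_le hA hα
      (fun s hs => (hexn w s hs).trans (hball w hw)) t.2
    have h2 : A * (2 * N) ^ 2 * ((t : ℝ) ^ (1 - α) / (1 - α)) ≤
        A * (2 * N) ^ 2 * (T ^ (1 - α) / (1 - α)) := by
      exact mul_le_mul_of_nonneg_left (htT t t.2) (by positivity)
    rw [hΨ]
    refine (norm_sub_le _ _).trans ?_
    have h3 := haN t t.2
    nlinarith
  have hcontr : ContractingWith (1 / 2) (hmaps.restrict Ψ _ _) := by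
    refine ⟨by simpa using NNReal.half_lt_self one_ne_zero, LipschitzWith.of_dist_le_mul ?_⟩
    rintro ⟨w, hw⟩ ⟨w', hw'⟩
    rw [Subtype.dist_eq, Subtype.dist_eq]
    change dist (Ψ w) (Ψ w') ≤ _ * dist w w'
    rw [BoundedContinuousFunction.dist_le (by positivity)]
    intro t
    have h1 := hQ.norm_duhamelIntegral_sub_le hA hα (hexc w)
      (fun s hs => (hexn w s hs).trans (hball w hw)) (hexc w')
      (fun s hs => (hexn w' s hs).trans (hball w' hw')) (W := fun _ => dist w w')
      continuous_const t.2 (fun s hs => by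
        have hs' := mem_Ioc_of_mem_Ioo t.2 hs
        rw [hex w ⟨s, hs'⟩, hex w' ⟨s, hs'⟩, ← dist_eq_norm]
        exact BoundedContinuousFunction.dist_coe_le_dist _)
    rw [intervalIntegral.integral_mul_const, integral_rpow_sub hα] at h1
    rw [hΨ, hΨ, dist_eq_norm, sub_sub_sub_cancel_left, norm_sub_rev]
    refine h1.trans ?_
    have h2 : 2 * A * (2 * N) * ((t : ℝ) ^ (1 - α) / (1 - α)) ≤
        2 * A * (2 * N) * (T ^ (1 - α) / (1 - α)) := by
      exact mul_le_mul_of_nonneg_left (htT t t.2) (by positivity)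
    have h3 : 2 * A * (2 * N) * ((t : ℝ) ^ (1 - α) / (1 - α)) ≤ 1 / 2 := by linarith
    calc _ = 2 * A * (2 * N) * ((t : ℝ) ^ (1 - α) / (1 - α)) * dist w w' := by ring
      _ ≤ 1 / 2 * dist w w' := by gcongr
      _ = _ := by simp
  obtain ⟨w, hw, hfix, -⟩ := hcontr.exists_fixedPoint' Metric.isClosed_closedBall.isComplete hmaps
    (Metric.mem_closedBall_self (by positivity)) (edist_ne_top _ _)
  refine ⟨ex w, hexc w, fun t ht => (hexn w t ht).trans (hball w hw), fun t ht => ?_⟩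
  have h1 : Ψ w = w := hfix
  rw [hex w ⟨t, ht⟩]
  conv_lhs => rw [← h1]
  rfl

end IsSingularQuadratic

end AbstractDuhamel

/-! ### Pointwise evaluation of Bochner integrals with values in `L^p` -/

section LpIntegral

variable {Ω S E : Type*} [MeasurableSpace Ω] [MeasurableSpace S] [NormedAddCommGroup E]
  {μ : Measure Ω} {p : ℝ≥0∞} [hp : Fact (1 ≤ p)]

theorem integrableOn_Lp (f : Lp E p μ) {A : Set Ω} (hA : μ A < ⊤) : IntegrableOn f A μ := by
  have : IsFiniteMeasure (μ.restrict A) := ⟨by simpa using hA⟩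
  exact ((Lp.memLp f).restrict A).integrable hp.out

theorem setIntegral_norm_Lp_le (f : Lp E p μ) {A : Set Ω} (hA : μ A < ⊤) :
    ∫ x in A, ‖f x‖ ∂μ ≤ (μ A ^ (1 - 1 / p.toReal)).toReal * ‖f‖ := by
  have h1 : ENNReal.ofReal (∫ x in A, ‖f x‖ ∂μ) ≤ μ A ^ (1 - 1 / p.toReal) * ‖f‖ₑ := by
    rw [ofReal_integral_norm_eq_lintegral_enorm (integrableOn_Lp f hA),
      ← eLpNorm_one_eq_lintegral_enorm]
    refine (eLpNorm_le_eLpNorm_mul_rpow_measure_univ hp.out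
      (Lp.aestronglyMeasurable f).restrict).trans ?_
    rw [mul_comm, Measure.restrict_apply_univ, Lp.enorm_def]
    simp only [ENNReal.toReal_one, div_one]
    gcongr
    exact Measure.restrict_le_self
  -- For `p = ∞` the conventions `toReal ⊤ = 0` and `1 / 0 = 0` give the exponent `1`, which is the
  -- correct one.
  have hexp : 0 ≤ 1 - 1 / p.toReal := by
    rcases eq_or_ne p ⊤ with rfl | hpt
    · simp
    · have : 1 ≤ p.toReal := by simpa using ENNReal.toReal_mono hpt hp.out
      rw [sub_nonneg]
      exact (div_le_one (by linarith)).2 this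
  have hfin : μ A ^ (1 - 1 / p.toReal) * ‖f‖ₑ ≠ ⊤ :=
    ENNReal.mul_ne_top (ENNReal.rpow_ne_top_of_nonneg hexp hA.ne) enorm_ne_top
  have h2 := (ENNReal.ofReal_le_iff_le_toReal hfin).1 h1
  rwa [ENNReal.toReal_mul, toReal_enorm] at h2

variable [NormedSpace ℝ E]

/-- Integration over a set of finite measure as a continuous linear map on `L^p`. -/
def setIntegralLp (A : Set Ω) (hA : μ A < ⊤) : Lp E p μ →L[ℝ] E :=
  LinearMap.mkContinuous
    { toFun := fun f => ∫ x in A, f x ∂μ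
      map_add' := fun f g => by
        rw [← integral_add (integrableOn_Lp f hA) (integrableOn_Lp g hA)]
        exact integral_congr_ae (ae_restrict_of_ae (Lp.coeFn_add f g))
      map_smul' := fun c f => by
        rw [RingHom.id_apply, ← integral_smul]
        exact integral_congr_ae (ae_restrict_of_ae (Lp.coeFn_smul c f)) }
    (μ A ^ (1 - 1 / p.toReal)).toReal
    fun f => (norm_integral_le_integral_norm _).trans (setIntegral_norm_Lp_le f hA)

theorem setIntegralLp_apply (A : Set Ω) (hA : μ A < ⊤) (f : Lp E p μ) :
    setIntegralLp A hA f = ∫ x in A, f x ∂μ := rfl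

variable {ν : Measure S} [SFinite ν] [SigmaFinite μ] {f : S → Lp E p μ} {F : S → Ω → E}

/-- On a set of finite measure `L^p` embeds in `L^1`, so norm integrability in time becomes joint
integrability and Fubini's theorem is available. -/
theorem integrable_prod_restrict_of_Lp (hf : Integrable f ν)
    (hF : AEStronglyMeasurable (Function.uncurry F) (ν.prod μ)) (hFf : ∀ᵐ s ∂ν, F s =ᵐ[μ] f s)
    {A : Set Ω} (hA : μ A < ⊤) : Integrable (Function.uncurry F) (ν.prod (μ.restrict A)) := by
  have hFA : AEStronglyMeasurable (Function.uncurry F) (ν.prod (μ.restrict A)) :=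
    hF.mono_ac (Measure.AbsolutelyContinuous.rfl.prod Measure.restrict_le_self.absolutelyContinuous)
  rw [integrable_prod_iff hFA]
  constructor
  · filter_upwards [hFf] with s hs
    exact (integrableOn_Lp (f s) hA).congr (ae_restrict_of_ae hs.symm)
  · refine Integrable.mono' (hf.norm.const_mul (μ A ^ (1 - 1 / p.toReal)).toReal)
      hFA.norm.integral_prod_right' ?_
    filter_upwards [hFf] with s hs
    rw [Real.norm_of_nonneg (integral_nonneg fun _ => norm_nonneg _)]
    refine le_trans (le_of_eq ?_) (setIntegral_norm_Lp_le (f s) hA)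
    refine integral_congr_ae ?_
    filter_upwards [ae_restrict_of_ae (s := A) hs] with x hx
    rw [← hx]
    rfl

/-- The Bochner integral of an `L^p`-valued function is computed pointwise. -/
theorem ae_integrable_and_integral_Lp_apply [CompleteSpace E] (hf : Integrable f ν)
    (hF : AEStronglyMeasurable (Function.uncurry F) (ν.prod μ)) (hFf : ∀ᵐ s ∂ν, F s =ᵐ[μ] f s) :
    ∀ᵐ x ∂μ, Integrable (fun s => F s x) ν ∧ (∫ s, f s ∂ν : Lp E p μ) x = ∫ s, F s x ∂ν := by
  have h1 : ∀ᵐ x ∂μ, Integrable (fun s => F s x) ν := by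
    refine ae_of_forall_measure_lt_top_ae_restrict _ fun A _ hA => ?_
    exact (integrable_prod_restrict_of_Lp hf hF hFf hA).prod_left_ae
  -- Both sides have the same integral over each set of finite measure: integration over such a set
  -- is a bounded operator on `L^p`, hence commutes with the Bochner integral. Testing against sets
  -- treats `p = ∞` on the same footing.
  have h2 : (∫ s, f s ∂ν : Lp E p μ) =ᵐ[μ] fun x => ∫ s, F s x ∂ν := by
    refine ae_eq_of_forall_setIntegral_eq_of_sigmaFinite (fun A _ hA => integrableOn_Lp _ hA)
      (fun A _ hA => (integrable_prod_restrict_of_Lp hf hF hFf hA).integral_prod_right) ?_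
    intro A _ hA
    have h3 := integrable_prod_restrict_of_Lp hf hF hFf hA
    rw [← setIntegralLp_apply A hA, ← ContinuousLinearMap.integral_comp_comm _ hf,
      ← integral_integral_swap h3]
    refine integral_congr_ae ?_
    filter_upwards [hFf] with s hs
    rw [setIntegralLp_apply]
    exact integral_congr_ae (ae_restrict_of_ae hs.symm)
  filter_upwards [h1, h2] with x hx1 hx2 using ⟨hx1, hx2⟩

end LpIntegral

/-! ### Conjugate exponents and the exponent relations of the bilinear estimate -/

section Exponents

variable {p : ℝ≥0∞}

/-- The Hölder conjugate exponent of `p`. -/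
def conjExp (p : ℝ≥0∞) : ℝ≥0∞ := (1 - p⁻¹)⁻¹

theorem inv_lt_one_of_one_lt (hp : 1 < p) : p⁻¹ < 1 := ENNReal.inv_lt_one.2 hp

theorem one_le_conjExp (p : ℝ≥0∞) : 1 ≤ conjExp p := by
  rw [conjExp, ENNReal.one_le_inv]
  exact tsub_le_self

theorem conjExp_ne_top (hp : 1 < p) : conjExp p ≠ ⊤ := by
  rw [conjExp, Ne, ENNReal.inv_eq_top]
  exact (tsub_pos_of_lt (inv_lt_one_of_one_lt hp)).ne'

theorem inv_conjExp (p : ℝ≥0∞) : (conjExp p)⁻¹ = 1 - p⁻¹ := inv_inv _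

theorem inv_conjExp_add_inv (hp : 1 < p) : (conjExp p)⁻¹ + p⁻¹ = 1 := by
  rw [inv_conjExp, tsub_add_cancel_of_le (inv_lt_one_of_one_lt hp).le]

theorem toReal_inv_conjExp (hp : 1 < p) : ((conjExp p)⁻¹).toReal = 1 - (p⁻¹).toReal := by
  rw [inv_conjExp, ENNReal.toReal_sub_of_le (inv_lt_one_of_one_lt hp).le ENNReal.one_ne_top,
    ENNReal.toReal_one]

theorem inv_half (p : ℝ≥0∞) : (p / 2)⁻¹ = p⁻¹ + p⁻¹ := by
  rw [ENNReal.inv_div (Or.inl (by norm_num)) (Or.inl (by norm_num)), div_eq_mul_inv, two_mul]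

theorem one_lt_half (hp : 2 < p) : 1 < p / 2 := by
  rw [ENNReal.lt_div_iff_mul_lt (by norm_num) (by norm_num), one_mul]
  exact hp

/-- The relation behind `L^{p'} * L^{p/2} ⊂ L^p`: the kernel is measured in `L^{p'}` and the product
`v ⊗ v` in `L^{p/2}`. -/
theorem young_exponents_half (hp : 1 < p) : (conjExp p)⁻¹ + (p / 2)⁻¹ = 1 + p⁻¹ := by
  rw [inv_half, ← add_assoc, inv_conjExp_add_inv hp]

theorem holderTriple_half (p : ℝ≥0∞) : ENNReal.HolderTriple p p (p / 2) := ⟨(inv_half p).symm⟩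

theorem holderTriple_conjExp (hp : 1 < p) : ENNReal.HolderTriple (conjExp p) p 1 :=
  ⟨by rw [inv_conjExp_add_inv hp, inv_one]⟩

end Exponents

/-! ### Convolution of tensor kernels with tensor fields -/

section TensorConvolution

variable {d : ℕ}

/-- The vector field with components `∑_{j,k} κ_{ijk} * g_{jk}`. -/
def tensorConv (κ : Fin d → Fin d → Fin d → Space d → ℝ) (g : Fin d → Fin d → Space d → ℝ)
    (x : Space d) : Space d :=
  WithLp.toLp 2 fun i => ∫ y, ∑ j, ∑ k, κ i j k (x - y) * g j k y

theorem tensorConv_apply (κ : Fin d → Fin d → Fin d → Space d → ℝ)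
    (g : Fin d → Fin d → Space d → ℝ) (x : Space d) (i : Fin d) :
    tensorConv κ g x i = ∫ y, ∑ j, ∑ k, κ i j k (x - y) * g j k y := rfl

theorem enorm_le_sum_enorm (v : Space d) : ‖v‖ₑ ≤ ∑ i, ‖v i‖ₑ := by
  have h1 : v = ∑ i, EuclideanSpace.single i (v i) := by
    ext j
    simp [Finset.sum_apply]
  calc ‖v‖ₑ = ‖∑ i, EuclideanSpace.single i (v i)‖ₑ := by rw [← h1]
    _ ≤ ∑ i, ‖EuclideanSpace.single i (v i)‖ₑ := enorm_sum_le _ _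
    _ = _ := by
      refine Finset.sum_congr rfl fun i _ => ?_
      rw [← ofReal_norm, ← ofReal_norm, PiLp.norm_single]

variable {κ κ' : Fin d → Fin d → Fin d → Space d → ℝ} {g g' : Fin d → Fin d → Space d → ℝ}

theorem enorm_tensorConv_apply_le_lintegral (hκ : ∀ i j k, AEStronglyMeasurable (κ i j k) volume)
    (hg : ∀ j k, AEStronglyMeasurable (g j k) volume) (x : Space d) (i : Fin d) :
    ‖tensorConv κ g x i‖ₑ ≤ ∑ j, ∑ k, ∫⁻ y, ‖κ i j k (x - y)‖ₑ * ‖g j k y‖ₑ := by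
  have hm (j k : Fin d) : AEMeasurable (fun y => ‖κ i j k (x - y)‖ₑ * ‖g j k y‖ₑ) volume :=
    (aestronglyMeasurable_comp_sub_left (hκ i j k) x).enorm.mul (hg j k).enorm
  rw [tensorConv_apply]
  refine (enorm_integral_le_lintegral_enorm _).trans ?_
  calc _ ≤ ∫⁻ y, ∑ j, ∑ k, ‖κ i j k (x - y)‖ₑ * ‖g j k y‖ₑ := by
        refine lintegral_mono fun y => (enorm_sum_le _ _).trans (Finset.sum_le_sum fun j _ =>
          (enorm_sum_le _ _).trans (Finset.sum_le_sum fun k _ => ?_))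
        rw [enorm_mul]
    _ = _ := by
        rw [lintegral_finsetSum' _ fun j _ => Finset.aemeasurable_fun_sum _ fun k _ => hm j k]
        exact Finset.sum_congr rfl fun j _ => lintegral_finsetSum' _ fun k _ => hm j k

theorem enorm_tensorConv_apply_le {q s : ℝ≥0∞} [ENNReal.HolderTriple s q 1]
    (hκ : ∀ i j k, AEStronglyMeasurable (κ i j k) volume)
    (hg : ∀ j k, AEStronglyMeasurable (g j k) volume) (x : Space d) (i : Fin d) :
    ‖tensorConv κ g x i‖ₑ ≤
      ∑ j, ∑ k, eLpNorm (κ i j k) s volume * eLpNorm (g j k) q volume :=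
  (enorm_tensorConv_apply_le_lintegral hκ hg x i).trans <| Finset.sum_le_sum fun j _ =>
    Finset.sum_le_sum fun k _ => lintegral_enorm_sub_mul_le_eLpNorm (hκ i j k) (hg j k) x

theorem aemeasurable_lintegral_convolution {E F : Type*} [NormedAddCommGroup E]
    [NormedAddCommGroup F] {k : Space d → E} {f : Space d → F}
    (hk : AEStronglyMeasurable k volume) (hf : AEStronglyMeasurable f volume) :
    AEMeasurable (fun x => ∫⁻ y, ‖k (x - y)‖ₑ * ‖f y‖ₑ) (volume : Measure (Space d)) := by
  have h1 : AEMeasurable (fun z : Space d × Space d => ‖k (z.1 - z.2)‖ₑ) (volume.prod volume) :=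
    hk.enorm.comp_quasiMeasurePreserving
      (quasiMeasurePreserving_sub_of_right_invariant volume volume)
  have h2 : AEMeasurable (fun z : Space d × Space d => ‖f z.2‖ₑ) (volume.prod volume) :=
    hf.enorm.comp_quasiMeasurePreserving Measure.quasiMeasurePreserving_snd
  exact (h1.mul h2).lintegral_prod_right'

theorem eLpNorm_tensorConv_le {p q r : ℝ≥0∞} (hp : 1 ≤ p) (hr : 1 ≤ r) (hq : 1 ≤ q)
    (h : r⁻¹ + q⁻¹ = 1 + p⁻¹) (hκ : ∀ i j k, AEStronglyMeasurable (κ i j k) volume)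
    (hg : ∀ j k, AEStronglyMeasurable (g j k) volume) :
    eLpNorm (tensorConv κ g) p volume ≤
      ∑ i, ∑ j, ∑ k, eLpNorm (κ i j k) r volume * eLpNorm (g j k) q volume := by
  have hm (i j k : Fin d) := aemeasurable_lintegral_convolution (hκ i j k) (hg j k)
  have h1 : eLpNorm (tensorConv κ g) p volume ≤ eLpNorm
      (∑ i, ∑ j, ∑ k, fun x => ∫⁻ y, ‖κ i j k (x - y)‖ₑ * ‖g j k y‖ₑ) p
      (volume : Measure (Space d)) := by
    refine eLpNorm_mono_enorm fun x => (enorm_le_sum_enorm _).trans ?_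
    rw [enorm_eq_self]
    simp only [Finset.sum_apply]
    exact Finset.sum_le_sum fun i _ => enorm_tensorConv_apply_le_lintegral hκ hg x i
  refine h1.trans ?_
  refine (eLpNorm_sum_le (fun i _ => (Finset.aemeasurable_sum _ fun j _ =>
    Finset.aemeasurable_sum _ fun k _ => hm i j k).aestronglyMeasurable) hp).trans
    (Finset.sum_le_sum fun i _ => ?_)
  refine (eLpNorm_sum_le (fun j _ => (Finset.aemeasurable_sum _
    fun k _ => hm i j k).aestronglyMeasurable) hp).trans (Finset.sum_le_sum fun j _ => ?_)
  refine (eLpNorm_sum_le (fun k _ => (hm i j k).aestronglyMeasurable) hp).trans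
    (Finset.sum_le_sum fun k _ => ?_)
  exact eLpNorm_convolution_le (hκ i j k) (hg j k) hr hq h

/-- For conjugate exponents the convolution integral converges at every point, so the linearity
identities hold everywhere and not just almost everywhere. -/
theorem integrable_tensorConv {q s : ℝ≥0∞} [ENNReal.HolderTriple s q 1]
    (hκ : ∀ i j k, MemLp (κ i j k) s volume) (hg : ∀ j k, MemLp (g j k) q volume)
    (x : Space d) (i : Fin d) :
    Integrable (fun y => ∑ j, ∑ k, κ i j k (x - y) * g j k y) volume := by
  refine integrable_finsetSum _ fun j _ => integrable_finsetSum _ fun k _ => ?_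
  exact ((hκ i j k).comp_measurePreserving (Measure.measurePreserving_sub_left volume x)).integrable_mul
    (hg j k)

theorem tensorConv_sub_right {q s : ℝ≥0∞} [ENNReal.HolderTriple s q 1]
    (hκ : ∀ i j k, MemLp (κ i j k) s volume) (hg : ∀ j k, MemLp (g j k) q volume)
    (hg' : ∀ j k, MemLp (g' j k) q volume) :
    tensorConv κ g - tensorConv κ g' = tensorConv κ (g - g') := by
  ext x i
  rw [Pi.sub_apply, PiLp.sub_apply, tensorConv_apply, tensorConv_apply, tensorConv_apply,
    ← integral_sub (integrable_tensorConv hκ hg x i) (integrable_tensorConv hκ hg' x i)]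
  simp only [Pi.sub_apply, mul_sub, Finset.sum_sub_distrib]

theorem tensorConv_sub_left {q s : ℝ≥0∞} [ENNReal.HolderTriple s q 1]
    (hκ : ∀ i j k, MemLp (κ i j k) s volume) (hκ' : ∀ i j k, MemLp (κ' i j k) s volume)
    (hg : ∀ j k, MemLp (g j k) q volume) :
    tensorConv κ g - tensorConv κ' g = tensorConv (κ - κ') g := by
  ext x i
  rw [Pi.sub_apply, PiLp.sub_apply, tensorConv_apply, tensorConv_apply, tensorConv_apply,
    ← integral_sub (integrable_tensorConv hκ hg x i) (integrable_tensorConv hκ' hg x i)]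
  simp only [Pi.sub_apply, sub_mul, Finset.sum_sub_distrib]

theorem tensorConv_congr (h : ∀ j k, g j k =ᵐ[volume] g' j k) :
    tensorConv κ g = tensorConv κ g' := by
  ext x i
  rw [tensorConv_apply, tensorConv_apply]
  refine integral_congr_ae ?_
  have h1 : ∀ᵐ y ∂(volume : Measure (Space d)), ∀ j k, g j k y = g' j k y :=
    ae_all_iff.2 fun j => ae_all_iff.2 fun k => h j k
  filter_upwards [h1] with y hy
  simp only [hy]

theorem stronglyMeasurable_tensorConv_apply (hκ : ∀ i j k, Measurable (κ i j k))
    (hg : ∀ j k, AEStronglyMeasurable (g j k) volume) (i : Fin d) :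
    StronglyMeasurable fun x => tensorConv κ g x i := by
  -- Passing to measurable representatives changes the convolution at no point, and makes the
  -- integrand jointly measurable.
  rw [tensorConv_congr (g' := fun j k => (hg j k).mk (g j k)) fun j k => (hg j k).ae_eq_mk]
  have h1 (j k : Fin d) : Measurable ((hg j k).mk (g j k)) := (hg j k).stronglyMeasurable_mk.measurable
  simp only [tensorConv_apply]
  refine StronglyMeasurable.integral_prod_right (Measurable.stronglyMeasurable ?_)
  refine Finset.measurable_sum _ fun j _ => Finset.measurable_sum _ fun k _ => ?_
  exact ((hκ i j k).comp (measurable_fst.sub measurable_snd)).mul ((h1 j k).comp measurable_snd)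

theorem stronglyMeasurable_tensorConv (hκ : ∀ i j k, Measurable (κ i j k))
    (hg : ∀ j k, AEStronglyMeasurable (g j k) volume) : StronglyMeasurable (tensorConv κ g) := by
  refine Measurable.stronglyMeasurable ?_
  refine (WithLp.measurable_toLp 2 _).comp (measurable_pi_lambda _ fun i => ?_)
  exact (stronglyMeasurable_tensorConv_apply hκ hg i).measurable

end TensorConvolution

/-! ### The quadratic map `v ↦ v ⊗ v` from `L^p` to `L^{p/2}` -/

section TensorProduct

variable {d : ℕ} {p : ℝ≥0∞}

/-- The components of `v ⊗ v`. -/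
def tensorSq (v : Space d → Space d) (j k : Fin d) (y : Space d) : ℝ := v y j * v y k

theorem aestronglyMeasurable_coord {v : Space d → Space d} (hv : AEStronglyMeasurable v volume)
    (i : Fin d) : AEStronglyMeasurable (fun y => v y i) volume :=
  (EuclideanSpace.proj (𝕜 := ℝ) i : Space d →L[ℝ] ℝ).continuous.comp_aestronglyMeasurable hv

theorem eLpNorm_coord_le (v : Space d → Space d) (i : Fin d) :
    eLpNorm (fun y => v y i) p volume ≤ eLpNorm v p volume :=
  eLpNorm_mono fun y => by simpa using abs_coord_le_norm (v y) i

theorem memLp_coord {v : Space d → Space d} (hv : MemLp v p volume) (i : Fin d) :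
    MemLp (fun y => v y i) p volume :=
  ⟨aestronglyMeasurable_coord hv.1 i, (eLpNorm_coord_le v i).trans_lt hv.2⟩

theorem memLp_tensorSq {v : Space d → Space d} (hv : MemLp v p volume) (j k : Fin d) :
    MemLp (tensorSq v j k) (p / 2) volume := by
  have := holderTriple_half p
  exact (memLp_coord hv k).mul (memLp_coord hv j)

theorem eLpNorm_mul_coord_le {v w : Space d → Space d} (hv : AEStronglyMeasurable v volume)
    (hw : AEStronglyMeasurable w volume) (j k : Fin d) :
    eLpNorm (fun y => v y j * w y k) (p / 2) volume ≤
      eLpNorm v p volume * eLpNorm w p volume := by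
  have := holderTriple_half p
  refine (eLpNorm_smul_le_mul_eLpNorm (p := p) (q := p) (aestronglyMeasurable_coord hw k)
    (aestronglyMeasurable_coord hv j)).trans ?_
  gcongr <;> exact eLpNorm_coord_le _ _

/-- Hölder's inequality applied to `v ⊗ v - w ⊗ w = v ⊗ (v - w) + (v - w) ⊗ w`. The triangle
inequality in `L^{p/2}` is where `p > 2` enters. -/
theorem eLpNorm_tensorSq_sub_le (hp : 2 < p) {v w : Space d → Space d}
    (hv : AEStronglyMeasurable v volume) (hw : AEStronglyMeasurable w volume) (j k : Fin d) :
    eLpNorm (tensorSq v j k - tensorSq w j k) (p / 2) volume ≤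
      (eLpNorm v p volume + eLpNorm w p volume) * eLpNorm (v - w) p volume := by
  have h1 : tensorSq v j k - tensorSq w j k =
      (fun y => v y j * (v - w) y k) + fun y => (v - w) y j * w y k := by
    ext y
    simp [tensorSq]
    ring
  have hvw := hv.sub hw
  rw [h1, add_mul]
  refine (eLpNorm_add_le ((aestronglyMeasurable_coord hv j).mul (aestronglyMeasurable_coord hvw k))
    ((aestronglyMeasurable_coord hvw j).mul (aestronglyMeasurable_coord hw k))
    (one_lt_half hp).le).trans (add_le_add (eLpNorm_mul_coord_le hv hvw j k) ?_)
  rw [mul_comm (eLpNorm w p volume)]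
  exact eLpNorm_mul_coord_le hvw hw j k

end TensorProduct

/-! ### The Oseen operator as a singular quadratic map on `L^p` -/

section OseenLp

variable {d : ℕ} {p : ℝ≥0∞}

/-- The kernels `∂_k O_{ij}(τ)`. -/
def oseenKernel (τ : ℝ) (i j k : Fin d) : Space d → ℝ := partialDeriv k (oseenTensor i j τ)

theorem isParabolicKernel_oseenKernel (i j k : Fin d) :
    IsParabolicKernel ((d : ℝ) / 2 + 1 / 2) fun τ => oseenKernel τ i j k :=
  isParabolicKernel_partialDeriv_oseenTensor i j k

theorem aestronglyMeasurable_oseenKernel (τ : ℝ) (i j k : Fin d) :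
    AEStronglyMeasurable (oseenKernel τ i j k) volume :=
  (measurable_fderiv_apply_const ℝ _ _).aestronglyMeasurable

/-- The vector field `e^{τΔ} ℙ div (v ⊗ v)`. -/
def oseenDiv (τ : ℝ) (v : Space d → Space d) : Space d → Space d :=
  tensorConv (oseenKernel τ) (tensorSq v)

theorem oseenDiv_apply (τ : ℝ) (v : Space d → Space d) (x : Space d) (i : Fin d) :
    oseenDiv τ v x i = oseenDivTensor τ v x i := rfl

theorem oseenDiv_congr {v w : Space d → Space d} (h : v =ᵐ[volume] w) (τ : ℝ) :
    oseenDiv τ v = oseenDiv τ w :=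
  tensorConv_congr fun j k => h.mono fun y hy => by simp only [tensorSq, hy]

theorem oseenDiv_zero (τ : ℝ) : oseenDiv τ (0 : Space d → Space d) = 0 := by
  ext x i
  simp [oseenDiv, tensorConv_apply, tensorSq]

theorem stronglyMeasurable_oseenDiv {v : Space d → Space d} (hv : MemLp v p volume) (τ : ℝ) :
    StronglyMeasurable (oseenDiv τ v) :=
  stronglyMeasurable_tensorConv (fun _ _ _ => measurable_fderiv_apply_const ℝ _ _)
    fun j k => (memLp_tensorSq hv j k).1

/-- The exponent of the time singularity of the Oseen kernels in `L^q`. -/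
def oseenExponent (d : ℕ) (q : ℝ≥0∞) : ℝ := 1 / 2 + (d : ℝ) / 2 * (1 - (q⁻¹).toReal)

theorem exists_sum_eLpNorm_oseenKernel_le (d : ℕ) {q : ℝ≥0∞} (hq : 1 ≤ q) (hq' : q ≠ ⊤) :
    ∃ A : ℝ, 0 ≤ A ∧ ∀ τ : ℝ, 0 < τ → ∑ i : Fin d, ∑ j, ∑ k, eLpNorm (oseenKernel τ i j k) q volume ≤
      ENNReal.ofReal (A * τ ^ (-oseenExponent d q)) := by
  choose C hC0 hC using fun i j k : Fin d => (isParabolicKernel_oseenKernel i j k).eLpNorm_le hq hq'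
  have hexp : -((d : ℝ) / 2 + 1 / 2) + (d : ℝ) / 2 * (q⁻¹).toReal = -oseenExponent d q := by
    unfold oseenExponent; ring
  rw [hexp] at hC
  refine ⟨∑ i, ∑ j, ∑ k, C i j k, Finset.sum_nonneg fun i _ => Finset.sum_nonneg fun j _ =>
    Finset.sum_nonneg fun k _ => (hC0 i j k).le, fun τ hτ => ?_⟩
  have h0 (i j k) : 0 ≤ C i j k * τ ^ (-oseenExponent d q) :=
    mul_nonneg (hC0 i j k).le (Real.rpow_nonneg hτ.le _)
  simp only [Finset.sum_mul]
  rw [ENNReal.ofReal_sum_of_nonneg fun i _ => Finset.sum_nonneg fun j _ =>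
    Finset.sum_nonneg fun k _ => h0 i j k]
  refine Finset.sum_le_sum fun i _ => ?_
  rw [ENNReal.ofReal_sum_of_nonneg fun j _ => Finset.sum_nonneg fun k _ => h0 i j k]
  refine Finset.sum_le_sum fun j _ => ?_
  rw [ENNReal.ofReal_sum_of_nonneg fun k _ => h0 i j k]
  exact Finset.sum_le_sum fun k _ => hC i j k τ hτ

theorem memLp_oseenKernel {q : ℝ≥0∞} (hq : 1 ≤ q) (hq' : q ≠ ⊤) {τ : ℝ} (hτ : 0 < τ)
    (i j k : Fin d) : MemLp (oseenKernel τ i j k) q volume :=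
  (isParabolicKernel_oseenKernel i j k).memLp hq hq' hτ

theorem sum_mul_le_sum_mul {a b : Fin d → Fin d → Fin d → ℝ≥0∞} {B : ℝ≥0∞}
    (h : ∀ i j k, b i j k ≤ B) :
    ∑ i, ∑ j, ∑ k, a i j k * b i j k ≤ (∑ i, ∑ j, ∑ k, a i j k) * B := by
  simp only [Finset.sum_mul]
  gcongr
  exact h _ _ _

theorem tendsto_sum_eLpNorm_oseenKernel_sub {q s : ℝ≥0∞} (hs : 1 ≤ s) (hs' : s ≠ ⊤)
    {g : Fin d → Fin d → Space d → ℝ} (hg : ∀ j k, MemLp (g j k) q volume) {τ : ℝ} (hτ : 0 < τ) :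
    Tendsto (fun σ => ∑ i, ∑ j, ∑ k,
      eLpNorm ((oseenKernel σ - oseenKernel τ : Fin d → Fin d → Fin d → Space d → ℝ) i j k) s volume * eLpNorm (g j k) q volume)
      (𝓝 τ) (𝓝 0) := by
  have h1 (i j k : Fin d) : Tendsto (fun σ =>
      eLpNorm ((oseenKernel σ - oseenKernel τ : Fin d → Fin d → Fin d → Space d → ℝ) i j k) s volume * eLpNorm (g j k) q volume)
      (𝓝 τ) (𝓝 0) := by
    have h2 := ENNReal.Tendsto.mul_const
      ((isParabolicKernel_oseenKernel i j k).tendsto_eLpNorm_sub hs hs' hτ)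
      (Or.inr (hg j k).2.ne)
    rwa [zero_mul] at h2
  have h3 := tendsto_finsetSum Finset.univ fun i _ => tendsto_finsetSum Finset.univ fun j _ =>
    tendsto_finsetSum Finset.univ fun k _ => h1 i j k
  simpa using h3

theorem enorm_tensorConv_apply_le_sum {q s : ℝ≥0∞} [ENNReal.HolderTriple s q 1]
    {κ : Fin d → Fin d → Fin d → Space d → ℝ} {g : Fin d → Fin d → Space d → ℝ}
    (hκ : ∀ i j k, AEStronglyMeasurable (κ i j k) volume)
    (hg : ∀ j k, AEStronglyMeasurable (g j k) volume) (x : Space d) (i : Fin d) :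
    ‖tensorConv κ g x i‖ₑ ≤
      ∑ i, ∑ j, ∑ k, eLpNorm (κ i j k) s volume * eLpNorm (g j k) q volume :=
  (enorm_tensorConv_apply_le hκ hg x i).trans (Finset.single_le_sum
    (f := fun i => ∑ j, ∑ k, eLpNorm (κ i j k) s volume * eLpNorm (g j k) q volume)
    (fun _ _ => zero_le) (Finset.mem_univ i))

variable (hp : 2 < p)
include hp

theorem one_lt_of_two_lt : 1 < p := lt_trans (by norm_num) hp

theorem oseenDiv_sub {v w : Space d → Space d} (hv : MemLp v p volume) (hw : MemLp w p volume)
    {τ : ℝ} (hτ : 0 < τ) :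
    oseenDiv τ v - oseenDiv τ w = tensorConv (oseenKernel τ) (tensorSq v - tensorSq w) := by
  have := holderTriple_conjExp (one_lt_half hp)
  exact tensorConv_sub_right (s := conjExp (p / 2)) (memLp_oseenKernel (one_le_conjExp _)
    (conjExp_ne_top (one_lt_half hp)) hτ) (memLp_tensorSq hv) (memLp_tensorSq hw)

theorem oseenDiv_sub_time {v : Space d → Space d} (hv : MemLp v p volume)
    {σ τ : ℝ} (hσ : 0 < σ) (hτ : 0 < τ) :
    oseenDiv σ v - oseenDiv τ v = tensorConv (oseenKernel σ - oseenKernel τ) (tensorSq v) := by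
  have := holderTriple_conjExp (one_lt_half hp)
  have hK := fun τ (hτ : 0 < τ) => memLp_oseenKernel (d := d) (τ := τ) (one_le_conjExp _)
    (conjExp_ne_top (one_lt_half hp)) hτ
  exact tensorConv_sub_left (hK σ hσ) (hK τ hτ) (memLp_tensorSq hv)

theorem memLp_oseenDiv {v : Space d → Space d} (hv : MemLp v p volume) {τ : ℝ} (hτ : 0 < τ) :
    MemLp (oseenDiv τ v) p volume := by
  have hp1 := one_lt_of_two_lt hp
  refine ⟨(stronglyMeasurable_oseenDiv hv τ).aestronglyMeasurable, ?_⟩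
  refine (eLpNorm_tensorConv_le hp1.le (one_le_conjExp p) (one_lt_half hp).le
    (young_exponents_half hp1) (aestronglyMeasurable_oseenKernel τ)
    fun j k => (memLp_tensorSq hv j k).1).trans_lt ?_
  refine ENNReal.sum_lt_top.2 fun i _ => ENNReal.sum_lt_top.2 fun j _ =>
    ENNReal.sum_lt_top.2 fun k _ => ENNReal.mul_lt_top ?_ (memLp_tensorSq hv j k).2
  exact (memLp_oseenKernel (one_le_conjExp _) (conjExp_ne_top hp1) hτ i j k).2

omit hp in
/-- `v ↦ e^{τΔ} ℙ div (v ⊗ v)` as a map on `L^p`. -/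
def oseenLp (p : ℝ≥0∞) (τ : ℝ) (v : Lp (Space d) p (volume : Measure (Space d))) :
    Lp (Space d) p (volume : Measure (Space d)) :=
  open Classical in if h : MemLp (oseenDiv τ v) p volume then h.toLp else 0

theorem oseenLp_eq (v : Lp (Space d) p (volume : Measure (Space d))) {τ : ℝ} (hτ : 0 < τ) :
    oseenLp p τ v = (memLp_oseenDiv hp (Lp.memLp v) hτ).toLp := by
  rw [oseenLp, dif_pos]

theorem coeFn_oseenLp (v : Lp (Space d) p (volume : Measure (Space d))) {τ : ℝ} (hτ : 0 < τ) :
    oseenLp p τ v =ᵐ[volume] oseenDiv τ v := by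
  rw [oseenLp_eq hp v hτ]
  exact MemLp.coeFn_toLp _

theorem edist_oseenLp {v w : Lp (Space d) p (volume : Measure (Space d))} {σ τ : ℝ} (hσ : 0 < σ)
    (hτ : 0 < τ) :
    edist (oseenLp p σ v) (oseenLp p τ w) = eLpNorm (oseenDiv σ v - oseenDiv τ w) p volume := by
  rw [oseenLp_eq hp v hσ, oseenLp_eq hp w hτ, Lp.edist_toLp_toLp]

omit hp in
theorem eLpNorm_tensorSq_sub_Lp_le [Fact (1 ≤ p)] (hp : 2 < p)
    (v w : Lp (Space d) p (volume : Measure (Space d))) (j k : Fin d) :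
    eLpNorm ((tensorSq v - tensorSq w : Fin d → Fin d → Space d → ℝ) j k) (p / 2) volume ≤
      ENNReal.ofReal ((‖v‖ + ‖w‖) * ‖v - w‖) := by
  refine (eLpNorm_tensorSq_sub_le hp (Lp.aestronglyMeasurable v)
    (Lp.aestronglyMeasurable w) j k).trans (le_of_eq ?_)
  rw [ENNReal.ofReal_mul (by positivity), ENNReal.ofReal_add (norm_nonneg _) (norm_nonneg _),
    ofReal_norm, ofReal_norm, ofReal_norm, Lp.enorm_def, Lp.enorm_def, Lp.enorm_def,
    eLpNorm_congr_ae (Lp.coeFn_sub v w)]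

/-- Young's inequality with the kernel in `L^{p'}` and the tensor in `L^{p/2}`. The exponent equals
`1/2 + d/(2p)`, which is below `1` precisely for `p > d`. Continuity in time is inherited from the
kernels in `L^{p'}`. -/
theorem exists_isSingularQuadratic_oseenLp [Fact (1 ≤ p)] (d : ℕ) :
    ∃ A : ℝ, 0 ≤ A ∧ IsSingularQuadratic A (oseenExponent d (conjExp p)) (oseenLp (d := d) p) := by
  have hp1 := one_lt_of_two_lt hp
  obtain ⟨A, hA0, hA⟩ := exists_sum_eLpNorm_oseenKernel_le d (one_le_conjExp p) (conjExp_ne_top hp1)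
  refine ⟨A, hA0, fun τ hτ => ?_, fun τ hτ v w => ?_, fun v τ (hτ : 0 < τ) => ?_⟩
  · rw [Lp.eq_zero_iff_ae_eq_zero]
    refine (coeFn_oseenLp hp 0 hτ).trans ?_
    rw [oseenDiv_congr (Lp.coeFn_zero _ _ _) τ, oseenDiv_zero]
  · rw [← dist_eq_norm, ← ENNReal.ofReal_le_ofReal_iff (by positivity), ← edist_dist,
      edist_oseenLp hp hτ hτ, oseenDiv_sub hp (Lp.memLp v) (Lp.memLp w) hτ]
    refine (eLpNorm_tensorConv_le hp1.le (one_le_conjExp p) (one_lt_half hp).le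
      (young_exponents_half hp1) (aestronglyMeasurable_oseenKernel τ) fun j k =>
      ((memLp_tensorSq (Lp.memLp v) j k).sub (memLp_tensorSq (Lp.memLp w) j k)).1).trans ?_
    refine (sum_mul_le_sum_mul fun i j k => eLpNorm_tensorSq_sub_Lp_le hp v w j k).trans ?_
    exact (mul_le_mul' (hA τ hτ) le_rfl).trans (ENNReal.ofReal_mul (by positivity)).ge
  · refine ContinuousAt.continuousWithinAt (tendsto_iff_edist_tendsto_0.2 ?_)
    have hg := memLp_tensorSq (Lp.memLp v)
    refine tendsto_of_tendsto_of_tendsto_of_le_of_le' tendsto_const_nhds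
      (tendsto_sum_eLpNorm_oseenKernel_sub (one_le_conjExp p) (conjExp_ne_top hp1) hg hτ)
      (Eventually.of_forall fun _ => zero_le) ?_
    filter_upwards [Ioi_mem_nhds hτ] with σ hσ
    rw [edist_oseenLp hp hσ hτ, oseenDiv_sub_time hp (Lp.memLp v) hσ hτ]
    exact eLpNorm_tensorConv_le hp1.le (one_le_conjExp p) (one_lt_half hp).le
      (young_exponents_half hp1) (fun i j k => (aestronglyMeasurable_oseenKernel σ i j k).sub
        (aestronglyMeasurable_oseenKernel τ i j k)) fun j k => (hg j k).1

/-- Pointwise version of `exists_isSingularQuadratic_oseenLp`. -/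
theorem exists_isSingularQuadratic_oseenDiv_apply [Fact (1 ≤ p)] (x : Space d) (i : Fin d) :
    ∃ A α : ℝ, IsSingularQuadratic A α
      fun τ (v : Lp (Space d) p (volume : Measure (Space d))) => oseenDiv τ v x i := by
  -- At a fixed point Hölder's inequality pairs `L^{p/2}` with its own conjugate, and the exponent
  -- becomes `1/2 + d/p`. It may reach or exceed `1`; this does no harm, since the pointwise version
  -- serves only to obtain continuity in time.
  have hp2 := one_lt_half hp
  have := holderTriple_conjExp hp2
  obtain ⟨A, hA0, hA⟩ := exists_sum_eLpNorm_oseenKernel_le d (one_le_conjExp (p / 2))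
    (conjExp_ne_top hp2)
  refine ⟨A, oseenExponent d (conjExp (p / 2)), fun τ hτ => ?_, fun τ hτ v w => ?_,
    fun v τ (hτ : 0 < τ) => ?_⟩
  · have h0 : oseenDiv τ (0 : Lp (Space d) p (volume : Measure (Space d))) = 0 :=
      (oseenDiv_congr (Lp.coeFn_zero _ _ _) τ).trans (oseenDiv_zero τ)
    simp only [h0]
    rfl
  · rw [← PiLp.sub_apply, ← Pi.sub_apply, oseenDiv_sub hp (Lp.memLp v) (Lp.memLp w) hτ,
      ← ENNReal.ofReal_le_ofReal_iff (by positivity), ofReal_norm]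
    refine (enorm_tensorConv_apply_le_sum (s := conjExp (p / 2)) (q := p / 2)
      (aestronglyMeasurable_oseenKernel τ) (fun j k =>
      ((memLp_tensorSq (Lp.memLp v) j k).sub (memLp_tensorSq (Lp.memLp w) j k)).1) x i).trans ?_
    refine (sum_mul_le_sum_mul fun i j k => eLpNorm_tensorSq_sub_Lp_le hp v w j k).trans ?_
    exact (mul_le_mul' (hA τ hτ) le_rfl).trans (ENNReal.ofReal_mul (by positivity)).ge
  · refine ContinuousAt.continuousWithinAt (tendsto_iff_edist_tendsto_0.2 ?_)
    have hg := memLp_tensorSq (Lp.memLp v)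
    refine tendsto_of_tendsto_of_tendsto_of_le_of_le' tendsto_const_nhds
      (tendsto_sum_eLpNorm_oseenKernel_sub (one_le_conjExp (p / 2)) (conjExp_ne_top hp2) hg hτ)
      (Eventually.of_forall fun _ => zero_le) ?_
    filter_upwards [Ioi_mem_nhds hτ] with σ hσ
    rw [edist_eq_enorm_sub, ← PiLp.sub_apply, ← Pi.sub_apply,
      oseenDiv_sub_time hp (Lp.memLp v) hσ hτ]
    exact enorm_tensorConv_apply_le_sum (fun i j k =>
      (aestronglyMeasurable_oseenKernel σ i j k).sub (aestronglyMeasurable_oseenKernel τ i j k))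
      (fun j k => (hg j k).1) x i

end OseenLp

/-! ### The heat semigroup on `L^p` -/

section HeatSemigroup

variable {d : ℕ} {p : ℝ≥0∞}

/-- The convolution of a scalar kernel with a vector field. -/
def vecConv (k : Space d → ℝ) (v : Space d → Space d) (x : Space d) : Space d :=
  ∫ y, k (x - y) • v y

theorem integrable_vecConv (hp : 1 < p) {k : Space d → ℝ} {v : Space d → Space d}
    (hk : MemLp k (conjExp p) volume) (hv : MemLp v p volume) (x : Space d) :
    Integrable (fun y => k (x - y) • v y) volume := by
  have := holderTriple_conjExp hp
  exact memLp_one_iff_integrable.1 (hv.smul (p := conjExp p) (r := 1)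
    (hk.comp_measurePreserving (Measure.measurePreserving_sub_left volume x)))

theorem vecConv_apply (hp : 1 < p) {k : Space d → ℝ} {v : Space d → Space d}
    (hk : MemLp k (conjExp p) volume) (hv : MemLp v p volume) (x : Space d) (i : Fin d) :
    vecConv k v x i = ∫ y, k (x - y) * v y i :=
  ((EuclideanSpace.proj (𝕜 := ℝ) i : Space d →L[ℝ] ℝ).integral_comp_comm
    (integrable_vecConv hp hk hv x)).symm

theorem vecConv_sub_left (hp : 1 < p) {k k' : Space d → ℝ} {v : Space d → Space d}
    (hk : MemLp k (conjExp p) volume) (hk' : MemLp k' (conjExp p) volume)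
    (hv : MemLp v p volume) : vecConv k v - vecConv k' v = vecConv (k - k') v := by
  ext1 x
  rw [Pi.sub_apply, vecConv, vecConv, ← integral_sub (integrable_vecConv hp hk hv x)
    (integrable_vecConv hp hk' hv x)]
  simp only [← sub_smul]
  rfl

theorem enorm_vecConv_le (k : Space d → ℝ) (v : Space d → Space d) (x : Space d) :
    ‖vecConv k v x‖ₑ ≤ ∫⁻ y, ‖k (x - y)‖ₑ * ‖v y‖ₑ := by
  refine (enorm_integral_le_lintegral_enorm _).trans (le_of_eq ?_)
  simp only [enorm_smul]

theorem eLpNorm_vecConv_le (hp : 1 ≤ p) {k : Space d → ℝ} {v : Space d → Space d}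
    (hk : AEStronglyMeasurable k volume) (hv : AEStronglyMeasurable v volume) :
    eLpNorm (vecConv k v) p volume ≤ eLpNorm k 1 volume * eLpNorm v p volume := by
  refine le_trans (eLpNorm_mono_enorm fun x => ?_)
    (eLpNorm_convolution_le hk hv le_rfl hp (by rw [inv_one]))
  rw [enorm_eq_self]
  exact enorm_vecConv_le k v x

theorem stronglyMeasurable_vecConv {k : Space d → ℝ} (hk : Measurable k) {v : Space d → Space d}
    (hv : AEStronglyMeasurable v volume) : StronglyMeasurable (vecConv k v) := by
  have h1 : vecConv k v = fun x => ∫ y, k (x - y) • hv.mk v y := by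
    ext1 x
    refine integral_congr_ae (hv.ae_eq_mk.mono fun y hy => ?_)
    simp only [hy]
  rw [h1]
  refine StronglyMeasurable.integral_prod_right (Measurable.stronglyMeasurable ?_)
  exact (hk.comp (measurable_fst.sub measurable_snd)).smul
    (hv.stronglyMeasurable_mk.measurable.comp measurable_snd)

theorem integrable_heatKernel {t : ℝ} (ht : 0 < t) : Integrable (heatKernel t : Space d → ℝ) :=
  memLp_one_iff_integrable.1 (isParabolicKernel_heatKernel.memLp le_rfl ENNReal.one_ne_top ht)

theorem integral_heatKernel {t : ℝ} (ht : 0 < t) : ∫ x : Space d, heatKernel t x = 1 := by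
  have h1 := GaussianFourier.integral_rexp_neg_mul_sq_norm (V := Space d) (b := (4 * t)⁻¹)
    (by positivity)
  have h2 : ∀ x : Space d, heatKernel t x = (4 * Real.pi * t) ^ (-((d : ℝ) / 2)) *
      Real.exp (-(4 * t)⁻¹ * ‖x‖ ^ 2) := by
    intro x
    unfold heatKernel
    congr 2
    rw [div_eq_mul_inv]
    ring
  simp only [h2]
  rw [integral_const_mul, h1, finrank_euclideanSpace, Fintype.card_fin,
    show Real.pi / (4 * t)⁻¹ = 4 * Real.pi * t by rw [div_inv_eq_mul]; ring,
    ← Real.rpow_add (by positivity), neg_add_cancel, Real.rpow_zero]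

theorem eLpNorm_heatKernel_one {t : ℝ} (ht : 0 < t) :
    eLpNorm (heatKernel t : Space d → ℝ) 1 volume = 1 := by
  rw [eLpNorm_one_eq_lintegral_enorm, ← ofReal_integral_norm_eq_lintegral_enorm
    (integrable_heatKernel ht)]
  simp only [Real.norm_of_nonneg (heatKernel_nonneg ht.le _)]
  rw [integral_heatKernel ht, ENNReal.ofReal_one]

theorem eLpNorm_heat_le (hp : 1 ≤ p) {v : Space d → Space d} (hv : AEStronglyMeasurable v volume)
    {t : ℝ} (ht : 0 < t) :
    eLpNorm (vecConv (heatKernel t) v) p volume ≤ eLpNorm v p volume := by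
  have h := eLpNorm_vecConv_le hp (measurable_heatKernel (d := d) t).aestronglyMeasurable hv
  rwa [eLpNorm_heatKernel_one ht, one_mul] at h

theorem memLp_heat (hp : 1 ≤ p) {v : Space d → Space d} (hv : MemLp v p volume) {t : ℝ}
    (ht : 0 < t) : MemLp (vecConv (heatKernel t) v) p volume :=
  ⟨(stronglyMeasurable_vecConv (measurable_heatKernel t) hv.1).aestronglyMeasurable,
    (eLpNorm_heat_le hp hv.1 ht).trans_lt hv.2⟩

/-- The heat flow `t ↦ e^{tΔ} v` as a curve in `L^p`. -/
def heatLp (p : ℝ≥0∞) (v : Space d → Space d) (t : ℝ) :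
    Lp (Space d) p (volume : Measure (Space d)) :=
  open Classical in if h : MemLp (vecConv (heatKernel t) v) p volume then h.toLp else 0

theorem heatLp_eq (hp : 1 ≤ p) {v : Space d → Space d} (hv : MemLp v p volume) {t : ℝ}
    (ht : 0 < t) : heatLp p v t = (memLp_heat hp hv ht).toLp := by
  rw [heatLp, dif_pos]

theorem coeFn_heatLp (hp : 1 ≤ p) {v : Space d → Space d} (hv : MemLp v p volume) {t : ℝ}
    (ht : 0 < t) : heatLp p v t =ᵐ[volume] vecConv (heatKernel t) v := by
  rw [heatLp_eq hp hv ht]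
  exact MemLp.coeFn_toLp _

theorem norm_heatLp_le (hp : 1 ≤ p) {v : Space d → Space d} (hv : MemLp v p volume) {t : ℝ}
    (ht : 0 < t) : ‖heatLp p v t‖ ≤ lpNorm v p volume := by
  rw [heatLp_eq hp hv ht, Lp.norm_toLp, ← toReal_eLpNorm hv.1]
  exact ENNReal.toReal_mono hv.2.ne (eLpNorm_heat_le hp hv.1 ht)

/-- At positive times continuity comes from that of the kernel in `L^1`. No density argument in the
data is involved, so `p = ∞` is included. -/
theorem continuousOn_heatLp [Fact (1 ≤ p)] (hp : 1 < p) {v : Space d → Space d} (hv : MemLp v p volume) :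
    ContinuousOn (heatLp p v) (Ioi 0) := by
  intro t ht
  refine ContinuousAt.continuousWithinAt (tendsto_iff_edist_tendsto_0.2 ?_)
  have h1 := ENNReal.Tendsto.mul_const (isParabolicKernel_heatKernel (d := d).tendsto_eLpNorm_sub
    le_rfl ENNReal.one_ne_top ht) (b := eLpNorm v p volume) (Or.inr hv.2.ne)
  rw [zero_mul] at h1
  refine tendsto_of_tendsto_of_tendsto_of_le_of_le' tendsto_const_nhds h1
    (Eventually.of_forall fun _ => zero_le) ?_
  filter_upwards [Ioi_mem_nhds ht] with s hs
  have hG := fun s (hs : 0 < s) => (isParabolicKernel_heatKernel (d := d)).memLp (τ := s)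
    (one_le_conjExp p) (conjExp_ne_top hp) hs
  rw [heatLp_eq hp.le hv hs, heatLp_eq hp.le hv ht, Lp.edist_toLp_toLp,
    vecConv_sub_left hp (hG s hs) (hG t ht) hv]
  exact eLpNorm_vecConv_le hp.le ((measurable_heatKernel s).sub
    (measurable_heatKernel t)).aestronglyMeasurable hv.1

end HeatSemigroup

/-! ### Smallness of the heat flow of sparse data -/

section Sparse

variable {d : ℕ} {p : ℝ≥0∞}

theorem toReal_inv_le_one (hp : 1 ≤ p) : (p⁻¹).toReal ≤ 1 := by
  simpa using ENNReal.toReal_mono ENNReal.one_ne_top (ENNReal.inv_le_one.2 hp)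

/-- Averages over the part of balls inside a sparse set. -/
theorem eLpNorm_setLIntegral_inter_ball_le (hp : 1 ≤ p) {v : Space d → Space d}
    (hv : AEStronglyMeasurable v volume) {S : Set (Space d)} {R : ℝ}
    {b : ℝ≥0∞} (hb' : b ≠ ⊤) (hb : ∀ x, volume (S ∩ Metric.ball x R) ≤ b) :
    eLpNorm (fun x => ∫⁻ y in S ∩ Metric.ball x R, ‖v y‖ₑ) p volume ≤
      b ^ (1 - (p⁻¹).toReal) * volume (Metric.ball (0 : Space d) R) ^ (p⁻¹).toReal *
        eLpNorm v p volume := by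
  have hp0 : p ≠ 0 := (zero_lt_one.trans_le hp).ne'
  have hexp : 0 ≤ 1 - (p⁻¹).toReal := sub_nonneg.2 (toReal_inv_le_one hp)
  have h1 (x : Space d) : ∫⁻ y in S ∩ Metric.ball x R, ‖v y‖ₑ ≤
      eLpNorm v p (volume.restrict (S ∩ Metric.ball x R)) * b ^ (1 - (p⁻¹).toReal) := by
    rw [← eLpNorm_one_eq_lintegral_enorm]
    refine (eLpNorm_le_eLpNorm_mul_rpow_measure_univ hp hv.restrict).trans ?_
    rw [Measure.restrict_apply_univ, ENNReal.toReal_one, div_one, one_div, ← ENNReal.toReal_inv]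
    gcongr
    exact hb x
  rcases eq_or_ne p ⊤ with rfl | hpt
  · rw [eLpNorm_exponent_top]
    refine eLpNormEssSup_le_of_ae_enorm_bound (Eventually.of_forall fun x => ?_)
    rw [enorm_eq_self]
    refine (h1 x).trans ?_
    simp only [ENNReal.inv_top, ENNReal.toReal_zero, ENNReal.rpow_zero, mul_one]
    rw [mul_comm]
    gcongr
    exact Measure.restrict_le_self
  have hpp := ENNReal.toReal_pos hp0 hpt
  -- Each point `y` belongs to the balls with centre within `R` of it, so integrating over the
  -- centres costs one ball volume: the `L^1` case of Young's inequality with the indicator of a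
  -- ball.
  have hvol : ∫⁻ x : Space d, ∫⁻ y in S ∩ Metric.ball x R, ‖v y‖ₑ ^ p.toReal ≤
      volume (Metric.ball (0 : Space d) R) * ∫⁻ y, ‖v y‖ₑ ^ p.toReal := by
    have h2 := lintegral_convolution_rpow_le (μ := (volume : Measure (Space d)))
      (k := (Metric.ball (0 : Space d) R).indicator 1) (f := fun y => ‖v y‖ₑ ^ p.toReal)
      ((measurable_one.indicator Metric.isOpen_ball.measurableSet).aemeasurable)
      (hv.enorm.pow_const _) (p := 1) (q := 1) (r := 1) one_pos one_pos one_pos le_rfl le_rfl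
      (by norm_num)
    simp only [ENNReal.rpow_one, inv_one] at h2
    rw [lintegral_indicator_one Metric.isOpen_ball.measurableSet] at h2
    refine le_trans (lintegral_mono fun x => ?_) h2
    refine (lintegral_mono_set inter_subset_right).trans ?_
    rw [← lintegral_indicator Metric.isOpen_ball.measurableSet]
    refine lintegral_mono fun y => ?_
    by_cases hy : y ∈ Metric.ball x R
    · have : x - y ∈ Metric.ball (0 : Space d) R := by
        rw [mem_ball_zero_iff, ← dist_eq_norm]
        exact Metric.mem_ball'.1 hy
      rw [indicator_of_mem hy, indicator_of_mem this, Pi.one_apply, one_mul]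
    · rw [indicator_of_notMem hy]
      exact zero_le
  rw [eLpNorm_eq_lintegral_rpow_enorm_toReal hp0 hpt,
    eLpNorm_eq_lintegral_rpow_enorm_toReal hp0 hpt, one_div, ENNReal.rpow_inv_le_iff hpp,
    ENNReal.mul_rpow_of_nonneg _ _ hpp.le, ENNReal.mul_rpow_of_nonneg _ _ hpp.le,
    ENNReal.rpow_inv_rpow hpp.ne', ← ENNReal.rpow_mul _ (p⁻¹).toReal, ENNReal.toReal_inv,
    inv_mul_cancel₀ hpp.ne', ENNReal.rpow_one, mul_assoc]
  refine le_trans ?_ (mul_le_mul_right hvol _)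
  rw [← lintegral_const_mul' _ _ (ENNReal.rpow_ne_top_of_nonneg hpp.le
    (ENNReal.rpow_ne_top_of_nonneg (by rwa [← ENNReal.toReal_inv]) hb'))]
  refine lintegral_mono fun x => ?_
  have h3 := ENNReal.rpow_le_rpow (h1 x) hpp.le
  rw [enorm_eq_self]
  refine h3.trans (le_of_eq ?_)
  rw [ENNReal.mul_rpow_of_nonneg _ _ hpp.le, eLpNorm_eq_lintegral_rpow_enorm_toReal hp0 hpt,
    one_div, ENNReal.rpow_inv_rpow hpp.ne', mul_comm, ENNReal.toReal_inv]

/-- Half of the Gaussian exponent is spent on the factor `e^{-l²/8}`. The other half is the exponent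
of the heat kernel at time `2t`, whose normalisation differs by `2^{d/2}` and whose integral is
again `1`. -/
theorem heatKernel_tail_le {t : ℝ} (ht : 0 < t) {l : ℝ} (hl : 0 ≤ l) {x : Space d}
    (hx : Real.sqrt t * l ≤ ‖x‖) :
    heatKernel t x ≤ (2 : ℝ) ^ ((d : ℝ) / 2) * Real.exp (-(l ^ 2 / 8)) * heatKernel (2 * t) x := by
  have h1 : t * l ^ 2 ≤ ‖x‖ ^ 2 := by
    calc t * l ^ 2 = (Real.sqrt t * l) ^ 2 := by rw [mul_pow, Real.sq_sqrt ht.le]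
      _ ≤ ‖x‖ ^ 2 := by gcongr
  have h2 : (4 * Real.pi * (2 * t)) ^ (-((d : ℝ) / 2)) =
      (2 : ℝ) ^ (-((d : ℝ) / 2)) * (4 * Real.pi * t) ^ (-((d : ℝ) / 2)) := by
    rw [← Real.mul_rpow (by norm_num) (by positivity)]
    congr 1
    ring
  have h3 : -‖x‖ ^ 2 / (4 * t) ≤ -(l ^ 2 / 8) + -‖x‖ ^ 2 / (4 * (2 * t)) := by
    have h4 : l ^ 2 ≤ ‖x‖ ^ 2 / t := by rwa [le_div_iff₀ ht, mul_comm]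
    have h5 : -‖x‖ ^ 2 / (4 * t) = -(‖x‖ ^ 2 / t) / 4 := by field_simp
    have h6 : -‖x‖ ^ 2 / (4 * (2 * t)) = -(‖x‖ ^ 2 / t) / 8 := by field_simp; ring
    rw [h5, h6]
    linarith
  unfold heatKernel
  rw [h2]
  calc _ ≤ (4 * Real.pi * t) ^ (-((d : ℝ) / 2)) *
        Real.exp (-(l ^ 2 / 8) + -‖x‖ ^ 2 / (4 * (2 * t))) := by gcongr
    _ = (2 : ℝ) ^ ((d : ℝ) / 2) * (2 : ℝ) ^ (-((d : ℝ) / 2)) *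
        ((4 * Real.pi * t) ^ (-((d : ℝ) / 2)) *
        Real.exp (-(l ^ 2 / 8) + -‖x‖ ^ 2 / (4 * (2 * t)))) := by
      rw [← Real.rpow_add (by norm_num), add_neg_cancel, Real.rpow_zero, one_mul]
    _ = _ := by rw [Real.exp_add]; ring

/-- Gaussian tail bound for the heat kernel. -/
theorem eLpNorm_heatKernel_tail_le {t : ℝ} (ht : 0 < t) {l : ℝ} (hl : 0 ≤ l) :
    eLpNorm ((Metric.ball (0 : Space d) (Real.sqrt t * l))ᶜ.indicator (heatKernel t)) 1 volume ≤
      ENNReal.ofReal ((2 : ℝ) ^ ((d : ℝ) / 2) * Real.exp (-(l ^ 2 / 8))) := by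
  have ht2 : 0 < 2 * t := by positivity
  refine (eLpNorm_le_mul_eLpNorm_of_ae_le_mul (g := heatKernel (2 * t))
    (c := (2 : ℝ) ^ ((d : ℝ) / 2) * Real.exp (-(l ^ 2 / 8)))
    (Eventually.of_forall fun x => ?_) 1).trans (by rw [eLpNorm_heatKernel_one ht2, mul_one])
  rw [Real.norm_of_nonneg (heatKernel_nonneg ht2.le x)]
  by_cases hx : x ∈ (Metric.ball (0 : Space d) (Real.sqrt t * l))ᶜ
  · rw [indicator_of_mem hx, Real.norm_of_nonneg (heatKernel_nonneg ht.le x)]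
    refine heatKernel_tail_le ht hl ?_
    simpa using hx
  · rw [indicator_of_notMem hx, norm_zero]
    have := heatKernel_nonneg ht2.le x
    positivity

theorem heatKernel_le {t : ℝ} (ht : 0 < t) (x : Space d) :
    heatKernel t x ≤ (4 * Real.pi * t) ^ (-((d : ℝ) / 2)) := by
  refine mul_le_of_le_one_right (by positivity) (Real.exp_le_one_iff.2 ?_)
  exact div_nonpos_of_nonpos_of_nonneg (by simp) (by positivity)

/-- Splitting of the heat flow into the contributions of `Sᶜ`, of the tail of the kernel, and of the
part of `S` near the base point. -/
theorem enorm_heat_le_split {v : Space d → Space d} (hv : AEStronglyMeasurable v volume)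
    {S : Set (Space d)} (hS : MeasurableSet S) {t : ℝ} (ht : 0 < t) (R : ℝ) (x : Space d) :
    ‖vecConv (heatKernel t) v x‖ₑ ≤
      (∫⁻ y, ‖heatKernel t (x - y)‖ₑ * ‖Sᶜ.indicator v y‖ₑ) +
      (∫⁻ y, ‖(Metric.ball (0 : Space d) R)ᶜ.indicator (heatKernel t) (x - y)‖ₑ * ‖v y‖ₑ) +
      ENNReal.ofReal ((4 * Real.pi * t) ^ (-((d : ℝ) / 2))) *
        ∫⁻ y in S ∩ Metric.ball x R, ‖v y‖ₑ := by
  have hmS : MeasurableSet (S ∩ Metric.ball x R) := hS.inter Metric.isOpen_ball.measurableSet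
  have hG := (measurable_heatKernel (d := d) t).aestronglyMeasurable (μ := volume)
  have m1 : AEMeasurable (fun y => ‖heatKernel t (x - y)‖ₑ * ‖Sᶜ.indicator v y‖ₑ) volume :=
    (aestronglyMeasurable_comp_sub_left hG x).enorm.mul (hv.indicator hS.compl).enorm
  have m2 : AEMeasurable (fun y =>
      ‖(Metric.ball (0 : Space d) R)ᶜ.indicator (heatKernel t) (x - y)‖ₑ * ‖v y‖ₑ) volume :=
    (aestronglyMeasurable_comp_sub_left
      (hG.indicator Metric.isOpen_ball.measurableSet.compl) x).enorm.mul hv.enorm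
  rw [← lintegral_const_mul' _ _ ENNReal.ofReal_ne_top, ← lintegral_indicator hmS,
    ← lintegral_add_left' m1, ← lintegral_add_left' (by exact m1.add m2)]
  refine (enorm_vecConv_le _ _ _).trans (lintegral_mono fun y => ?_)
  by_cases hy : y ∈ S
  · by_cases hxy : y ∈ Metric.ball x R
    · refine le_add_left ?_
      rw [indicator_of_mem (show y ∈ S ∩ Metric.ball x R from ⟨hy, hxy⟩)]
      gcongr
      rw [← ofReal_norm, Real.norm_of_nonneg (heatKernel_nonneg ht.le _)]
      exact ENNReal.ofReal_le_ofReal (heatKernel_le ht _)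
    · refine le_add_right (le_add_left ?_)
      have : x - y ∈ (Metric.ball (0 : Space d) R)ᶜ := by
        rw [mem_compl_iff, mem_ball_zero_iff, ← dist_eq_norm]
        exact fun h => hxy (Metric.mem_ball'.2 h)
      rw [indicator_of_mem this]
  · refine le_add_right (le_add_right ?_)
    rw [indicator_of_mem (show y ∈ Sᶜ from hy)]

theorem volume_inter_ball_le {S : Set (Space d)} {β R : ℝ} (hR : 0 < R)
    (hβ : (⨆ x₀ : Space d, volume (S ∩ Metric.ball x₀ R) / volume (Metric.ball x₀ R))
      ≤ ENNReal.ofReal β) (x : Space d) :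
    volume (S ∩ Metric.ball x R) ≤ ENNReal.ofReal β * volume (Metric.ball (0 : Space d) R) := by
  have h1 := (le_iSup (fun x₀ : Space d =>
    volume (S ∩ Metric.ball x₀ R) / volume (Metric.ball x₀ R)) x).trans hβ
  rw [ENNReal.div_le_iff (Metric.measure_ball_pos _ _ hR).ne' measure_ball_lt_top.ne] at h1
  rwa [Measure.addHaar_ball_center] at h1

/-- The volume of the unit ball. -/
def unitBallVolume (d : ℕ) : ℝ := (volume (Metric.ball (0 : Space d) 1)).toReal

/-- The dimensional constant in the sparseness condition. -/
def sparseConstant (d : ℕ) : ℝ := 8 + 3 * unitBallVolume d + 3 * (2 : ℝ) ^ ((d : ℝ) / 2)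

theorem unitBallVolume_nonneg (d : ℕ) : 0 ≤ unitBallVolume d := ENNReal.toReal_nonneg

/-- The powers of `t` in the kernel bound and in the ball volume cancel, and `l^d` cancels against
the hypothesis. What remains is `γ|B_1|/(2C₀)`, so the summand `3|B_1|` of the constant `C₀`
suffices. -/
theorem sparse_ball_constant_le {t l β γ P : ℝ} (ht : 0 < t) (hl : 0 < l) (hβ : 0 < β)
    (hγ : 0 < γ) (h : β ^ (1 - P) ≤ (2 * sparseConstant d)⁻¹ * γ / l ^ d) :
    (4 * Real.pi * t) ^ (-((d : ℝ) / 2)) *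
      (β ^ (1 - P) * ((Real.sqrt t * l) ^ d * unitBallVolume d)) ≤ γ / 6 := by
  have hω := unitBallVolume_nonneg d
  have h2 : 0 < (2 : ℝ) ^ ((d : ℝ) / 2) := by positivity
  have hC : 0 < sparseConstant d := by unfold sparseConstant; positivity
  have hpow : (4 * Real.pi * t) ^ (-((d : ℝ) / 2)) * Real.sqrt t ^ d ≤ 1 := by
    have e1 : Real.sqrt t ^ d = t ^ ((d : ℝ) / 2) := by
      rw [Real.sqrt_eq_rpow, ← Real.rpow_natCast, ← Real.rpow_mul ht.le]
      congr 1; ring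
    rw [e1, Real.mul_rpow (by positivity) ht.le, mul_assoc, ← Real.rpow_add ht, neg_add_cancel,
      Real.rpow_zero, mul_one]
    refine Real.rpow_le_one_of_one_le_of_nonpos ?_ (by simp; positivity)
    nlinarith [Real.pi_gt_three]
  calc _ = ((4 * Real.pi * t) ^ (-((d : ℝ) / 2)) * Real.sqrt t ^ d) *
        (β ^ (1 - P) * l ^ d * unitBallVolume d) := by rw [mul_pow]; ring
    _ ≤ 1 * (β ^ (1 - P) * l ^ d * unitBallVolume d) := by gcongr
    _ ≤ 1 * ((2 * sparseConstant d)⁻¹ * γ / l ^ d * l ^ d * unitBallVolume d) := by gcongr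
    _ = γ * unitBallVolume d / (2 * sparseConstant d) := by field_simp
    _ ≤ γ / 6 := by
      rw [div_le_div_iff₀ (by positivity) (by norm_num)]
      unfold sparseConstant
      nlinarith [mul_pos hγ h2]

/-- The summand `8` of the constant `C₀` turns the hypothesis into `l²/8 ≥ log(2C₀/γ)`, hence
`e^{-l²/8} ≤ γ/(2C₀)`; the summand `3·2^{d/2}` absorbs the prefactor. -/
theorem sparse_tail_constant_le {l γ : ℝ} (hγ : 0 < γ) (hγ1 : γ < 1)
    (h : sparseConstant d * Real.log (2 * sparseConstant d / γ) ≤ l ^ 2) :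
    (2 : ℝ) ^ ((d : ℝ) / 2) * Real.exp (-(l ^ 2 / 8)) ≤ γ / 6 := by
  have hω := unitBallVolume_nonneg d
  have h2 : 0 < (2 : ℝ) ^ ((d : ℝ) / 2) := by positivity
  have hC8 : 8 ≤ sparseConstant d := by unfold sparseConstant; linarith
  have hC : 0 < sparseConstant d := by linarith
  have hlog : 0 ≤ Real.log (2 * sparseConstant d / γ) := by
    refine Real.log_nonneg ?_
    rw [le_div_iff₀ hγ]
    linarith
  have h3 : Real.log (2 * sparseConstant d / γ) ≤ l ^ 2 / 8 := by nlinarith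
  have h4 : Real.exp (-(l ^ 2 / 8)) ≤ γ / (2 * sparseConstant d) := by
    calc _ ≤ Real.exp (-Real.log (2 * sparseConstant d / γ)) := by gcongr
      _ = _ := by rw [Real.exp_neg, Real.exp_log (by positivity), inv_div]
  calc _ ≤ (2 : ℝ) ^ ((d : ℝ) / 2) * (γ / (2 * sparseConstant d)) := by gcongr
    _ ≤ γ / 6 := by
      rw [← mul_div_assoc, div_le_div_iff₀ (by positivity) (by norm_num)]
      unfold sparseConstant
      nlinarith

/-- The heat flow of sparse data is small. -/
theorem eLpNorm_heat_le_of_isSparse (hp : 1 ≤ p) {v : Space d → Space d}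
    (hv : AEStronglyMeasurable v volume) {γ β l t : ℝ} (hγ : 0 < γ) (hγ1 : γ < 1) (hβ : 0 < β)
    (hl : 0 < l) (ht : 0 < t)
    (hβl : β ^ (1 - (p⁻¹).toReal) ≤ (2 * sparseConstant d)⁻¹ * γ / l ^ d)
    (hlog : sparseConstant d * Real.log (2 * sparseConstant d / γ) ≤ l ^ 2)
    (hs : IsSparse p (γ / 6) β (Real.sqrt t * l) v) :
    eLpNorm (vecConv (heatKernel t) v) p volume ≤ ENNReal.ofReal (γ / 2) * eLpNorm v p volume := by
  obtain ⟨S, hS, hSc, hball⟩ := hs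
  set R := Real.sqrt t * l
  have hR : 0 < R := mul_pos (Real.sqrt_pos.2 ht) hl
  have hG := (measurable_heatKernel (d := d) t).aestronglyMeasurable (μ := volume)
  have hGR := hG.indicator (Metric.isOpen_ball (x := (0 : Space d)) (ε := R)).measurableSet.compl
  have hvS := hv.indicator hS.compl
  set f₁ : Space d → ℝ≥0∞ := fun x => ∫⁻ y, ‖heatKernel t (x - y)‖ₑ * ‖Sᶜ.indicator v y‖ₑ
  set f₂ : Space d → ℝ≥0∞ := fun x =>
    ∫⁻ y, ‖(Metric.ball (0 : Space d) R)ᶜ.indicator (heatKernel t) (x - y)‖ₑ * ‖v y‖ₑ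
  set f₃ : Space d → ℝ≥0∞ := fun x => ∫⁻ y in S ∩ Metric.ball x R, ‖v y‖ₑ
  set c := (4 * Real.pi * t) ^ (-((d : ℝ) / 2))
  have b1 : eLpNorm f₁ p volume ≤ ENNReal.ofReal (γ / 6) * eLpNorm v p volume := by
    refine (eLpNorm_convolution_le hG hvS le_rfl hp (by rw [inv_one])).trans ?_
    rw [eLpNorm_heatKernel_one ht, one_mul, eLpNorm_indicator_eq_eLpNorm_restrict hS.compl]
    exact hSc.le
  have b2 : eLpNorm f₂ p volume ≤ ENNReal.ofReal (γ / 6) * eLpNorm v p volume := by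
    refine (eLpNorm_convolution_le hGR hv le_rfl hp (by rw [inv_one])).trans ?_
    gcongr
    refine (eLpNorm_heatKernel_tail_le ht hl.le).trans (ENNReal.ofReal_le_ofReal ?_)
    exact sparse_tail_constant_le hγ hγ1 hlog
  have b3 : ENNReal.ofReal c * eLpNorm f₃ p volume ≤
      ENNReal.ofReal (γ / 6) * eLpNorm v p volume := by
    have hP : 0 ≤ 1 - (p⁻¹).toReal := sub_nonneg.2 (toReal_inv_le_one hp)
    refine (mul_le_mul_right (eLpNorm_setLIntegral_inter_ball_le hp hv
      (ENNReal.mul_ne_top ENNReal.ofReal_ne_top measure_ball_lt_top.ne)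
      (volume_inter_ball_le hR hball)) _).trans ?_
    rw [← mul_assoc]
    gcongr
    have hV : volume (Metric.ball (0 : Space d) R) = ENNReal.ofReal (R ^ d * unitBallVolume d) := by
      rw [Measure.addHaar_ball_of_pos _ _ hR, finrank_euclideanSpace, Fintype.card_fin,
        ENNReal.ofReal_mul (by positivity), unitBallVolume,
        ENNReal.ofReal_toReal measure_ball_lt_top.ne]
    -- With `|B|` the volume of the ball of radius `R`, the two powers recombine as `(β|B|)^{1-1/p}
    -- |B|^{1/p} = β^{1-1/p} |B|`.
    rw [ENNReal.mul_rpow_of_nonneg _ _ hP, mul_assoc (_ ^ _),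
      ← ENNReal.rpow_add_of_nonneg _ _ hP ENNReal.toReal_nonneg, sub_add_cancel, ENNReal.rpow_one,
      hV, ENNReal.ofReal_rpow_of_pos hβ, ← ENNReal.ofReal_mul (by positivity),
      ← ENNReal.ofReal_mul (by positivity)]
    exact ENNReal.ofReal_le_ofReal (sparse_ball_constant_le ht hl hβ hγ hβl)
  have hm₁ : AEMeasurable f₁ volume := aemeasurable_lintegral_convolution hG hvS
  have hm₂ : AEMeasurable f₂ volume := aemeasurable_lintegral_convolution hGR hv
  have h1 : eLpNorm (vecConv (heatKernel t) v) p volume ≤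
      eLpNorm (f₁ + f₂ + fun x => ENNReal.ofReal c * f₃ x) p volume :=
    eLpNorm_mono_enorm fun x => enorm_heat_le_split hv hS ht R x
  have hm₃ : AEMeasurable (fun x => ENNReal.ofReal c * f₃ x) volume := by
    refine AEMeasurable.const_mul ?_ _
    -- Measurability in the centre `x` is obtained by writing the local integral as a convolution
    -- with the indicator of a ball.
    have h2 : f₃ = fun x => ∫⁻ y, ‖(Metric.ball (0 : Space d) R).indicator (1 : Space d → ℝ) (x - y)‖ₑ *
        ‖S.indicator v y‖ₑ := by
      ext1 x
      simp only [f₃]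
      rw [← lintegral_indicator (hS.inter Metric.isOpen_ball.measurableSet)]
      refine lintegral_congr fun y => ?_
      have hiff : x - y ∈ Metric.ball (0 : Space d) R ↔ y ∈ Metric.ball x R := by
        rw [mem_ball_zero_iff, ← dist_eq_norm, Metric.mem_ball']
      by_cases hy : y ∈ S <;> by_cases hxy : y ∈ Metric.ball x R <;>
        simp only [indicator, mem_inter_iff, hiff, hy, hxy] <;> simp
    rw [h2]
    exact aemeasurable_lintegral_convolution ((measurable_one.indicator
      Metric.isOpen_ball.measurableSet).aestronglyMeasurable) (hv.indicator hS)
  have b3' : eLpNorm (fun x => ENNReal.ofReal c * f₃ x) p volume ≤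
      ENNReal.ofReal c * eLpNorm f₃ p volume :=
    eLpNorm_le_mul_eLpNorm_of_ae_le_mul' (c := c.toNNReal) (Eventually.of_forall fun x => by
      rw [enorm_eq_self, enorm_eq_self]; rfl) p
  calc _ ≤ eLpNorm f₁ p volume + eLpNorm f₂ p volume +
        eLpNorm (fun x => ENNReal.ofReal c * f₃ x) p volume :=
        h1.trans ((eLpNorm_add_le (hm₁.add hm₂).aestronglyMeasurable hm₃.aestronglyMeasurable
          hp).trans (add_le_add_left (eLpNorm_add_le hm₁.aestronglyMeasurable
            hm₂.aestronglyMeasurable hp) _))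
    _ ≤ ENNReal.ofReal (γ / 6) * eLpNorm v p volume + ENNReal.ofReal (γ / 6) * eLpNorm v p volume +
        ENNReal.ofReal (γ / 6) * eLpNorm v p volume :=
      add_le_add (add_le_add b1 b2) (b3'.trans b3)
    _ = _ := by
      rw [← add_mul, ← add_mul, ← ENNReal.ofReal_add (by positivity) (by positivity),
        ← ENNReal.ofReal_add (by positivity) (by positivity)]
      congr 2
      ring

end Sparse

/-! ### Strong solutions as mild curves in `L^p`, and local well-posedness -/

section MildSolutions

variable {d : ℕ} {p : ℝ≥0∞} [Fact (1 ≤ p)] {T M : ℝ} {u₀ : Space d → Space d}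

/-- Continuity in time at each fixed point of space; with measurability in space it yields the joint
measurability that Fubini's theorem asks for. -/
theorem continuousOn_oseenDiv_integrand (hp : 2 < p)
    {u : ℝ → Lp (Space d) p (volume : Measure (Space d))} (hu : ContinuousOn u (Ioc 0 T)) {t : ℝ}
    (ht : t ∈ Ioc 0 T) (x : Space d) :
    ContinuousOn (fun s => oseenDiv (t - s) (u s) x) (Ioo 0 t) := by
  refine (PiLp.continuous_toLp 2 _).comp_continuousOn (g := WithLp.toLp 2)
    (f := fun s i => oseenDiv (t - s) (u s) x i) (continuousOn_pi.2 fun i => ?_)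
  obtain ⟨A, α, hQ⟩ := exists_isSingularQuadratic_oseenDiv_apply hp x i
  exact hQ.continuousOn_comp (by fun_prop) (fun s hs => sub_pos.2 hs.2)
    (hu.mono fun s hs => ⟨hs.1, hs.2.le.trans ht.2⟩)

theorem aestronglyMeasurable_oseenDiv_integrand (hp : 2 < p)
    {u : ℝ → Lp (Space d) p (volume : Measure (Space d))} (hu : ContinuousOn u (Ioc 0 T)) {t : ℝ}
    (ht : t ∈ Ioc 0 T) :
    AEStronglyMeasurable (Function.uncurry fun s (x : Space d) => oseenDiv (t - s) (u s) x)
      ((volume.restrict (Ioo 0 t)).prod volume) := by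
  -- A Carathéodory function is jointly measurable. Continuity is known only for `s` in `(0,t)`, so
  -- the argument runs on the subtype and the result is then extended along a measurable embedding.
  have h1 : StronglyMeasurable (Function.uncurry fun (s : Ioo 0 t) (x : Space d) =>
      oseenDiv (t - s) (u s) x) :=
    stronglyMeasurable_uncurry_of_continuous_of_stronglyMeasurable
      (fun x => continuousOn_iff_continuous_domRestrict.1
        (continuousOn_oseenDiv_integrand hp hu ht x))
      fun s => stronglyMeasurable_oseenDiv (Lp.memLp (u s)) _
  have he : MeasurableEmbedding (Prod.map Subtype.val id : Ioo 0 t × Space d → ℝ × Space d) :=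
    (MeasurableEmbedding.subtype_coe measurableSet_Ioo).prodMap .id
  obtain ⟨g, hg, hge⟩ := he.exists_stronglyMeasurable_extend h1 fun _ => inferInstance
  refine ⟨g, hg, ?_⟩
  have hprod : ((volume : Measure ℝ).restrict (Ioo 0 t)).prod (volume : Measure (Space d)) =
      (volume.prod volume).restrict (Ioo 0 t ×ˢ univ) := by
    rw [← Measure.prod_restrict, Measure.restrict_univ]
  rw [hprod]
  refine (ae_restrict_iff' (measurableSet_Ioo.prod .univ)).2 (Eventually.of_forall ?_)
  rintro ⟨s, x⟩ ⟨hs, -⟩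
  exact (congrFun hge (⟨s, hs⟩, x)).symm

/-- The Duhamel integral in `L^p` is the pointwise one. -/
theorem ae_duhamelIntegral_oseenLp (hp : 2 < p) {A α : ℝ} (hA : 0 ≤ A) (hα : α < 1)
    (hQ : IsSingularQuadratic A α (oseenLp (d := d) p))
    {u : ℝ → Lp (Space d) p (volume : Measure (Space d))} (hu : ContinuousOn u (Ioc 0 T))
    (hM : ∀ t ∈ Ioc 0 T, ‖u t‖ ≤ M) {t : ℝ} (ht : t ∈ Ioc 0 T) :
    ∀ᵐ x ∂(volume : Measure (Space d)), ∀ i : Fin d,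
      IntervalIntegrable (fun s => oseenDivTensor (t - s) (u s) x i) volume 0 t ∧
      duhamelIntegral (oseenLp p) u t x i = ∫ s in (0 : ℝ)..t, oseenDivTensor (t - s) (u s) x i := by
  have hint := hQ.intervalIntegrable hA hα hu hM ht
  rw [intervalIntegrable_iff_integrableOn_Ioo_of_le ht.1.le] at hint
  have h1 := ae_integrable_and_integral_Lp_apply hint
    (aestronglyMeasurable_oseenDiv_integrand hp hu ht)
    ((ae_restrict_iff' measurableSet_Ioo).2 (Eventually.of_forall fun s hs =>
      (coeFn_oseenLp hp (u s) (sub_pos.2 hs.2)).symm))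
  filter_upwards [h1] with x hx i
  constructor
  · rw [intervalIntegrable_iff_integrableOn_Ioo_of_le ht.1.le]
    exact (EuclideanSpace.proj (𝕜 := ℝ) i : Space d →L[ℝ] ℝ).integrable_comp hx.1
  · rw [duhamelIntegral, intervalIntegral.integral_of_le ht.1.le,
      intervalIntegral.integral_of_le ht.1.le, integral_Ioc_eq_integral_Ioo,
      integral_Ioc_eq_integral_Ioo, hx.2]
    exact ((EuclideanSpace.proj (𝕜 := ℝ) i : Space d →L[ℝ] ℝ).integral_comp_comm hx.1).symm

omit [Fact (1 ≤ p)] in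
theorem heat_apply (hp : 1 < p) (hu₀ : MemLp u₀ p volume) {t : ℝ} (ht : 0 < t) (x : Space d)
    (i : Fin d) : vecConv (heatKernel t) u₀ x i = ∫ y, heatKernel t (x - y) * u₀ y i :=
  vecConv_apply hp (isParabolicKernel_heatKernel.memLp (one_le_conjExp p) (conjExp_ne_top hp) ht)
    hu₀ x i

/-- Mild solutions in the Banach space `L^p` are strong solutions. -/
theorem isStrongSolution_of_mild (hp : 2 < p) {A α : ℝ} (hA : 0 ≤ A) (hα : α < 1)
    (hQ : IsSingularQuadratic A α (oseenLp (d := d) p)) (hu₀ : MemLp u₀ p volume)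
    {u : ℝ → Lp (Space d) p (volume : Measure (Space d))} (hu : ContinuousOn u (Ioc 0 T))
    (hM : ∀ t ∈ Ioc 0 T, ‖u t‖ ≤ M)
    (he : ∀ t ∈ Ioc 0 T, u t = heatLp p u₀ t - duhamelIntegral (oseenLp p) u t) :
    IsStrongSolution p u₀ T fun t => u t where
  memLp := fun t _ => Lp.memLp _
  bounded := ⟨M.toNNReal, fun t ht => by
    rw [← Lp.enorm_def, ← ofReal_norm]
    exact ENNReal.ofReal_le_ofReal (hM t ht)⟩
  continuous := fun t ht => by
    have h1 := tendsto_iff_edist_tendsto_0.1 (hu t ht)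
    simpa only [Lp.edist_def] using h1
  duhamel := fun t ht => by
    have hp1 := one_lt_of_two_lt hp
    filter_upwards [ae_duhamelIntegral_oseenLp hp hA hα hQ hu hM ht,
      coeFn_heatLp hp1.le hu₀ ht.1,
      Lp.coeFn_sub (heatLp p u₀ t) (duhamelIntegral (oseenLp p) u t)] with x h1 h2 h3 i
    refine ⟨(h1 i).1, ?_⟩
    rw [← (h1 i).2, ← heat_apply hp1 hu₀ ht.1, ← h2]
    conv_lhs => rw [he t ht, h3]
    rfl

/-- The curve in `L^p` defined by a time-dependent vector field. -/
def lpCurve (p : ℝ≥0∞) (u : ℝ → Space d → Space d) (t : ℝ) :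
    Lp (Space d) p (volume : Measure (Space d)) :=
  open Classical in if h : MemLp (u t) p volume then h.toLp else 0

namespace IsStrongSolution

variable {u : ℝ → Space d → Space d}

omit [Fact (1 ≤ p)] in
theorem lpCurve_eq (h : IsStrongSolution p u₀ T u) {t : ℝ} (ht : t ∈ Ioc 0 T) :
    lpCurve p u t = (h.memLp t ht).toLp := by
  rw [lpCurve, dif_pos]

omit [Fact (1 ≤ p)] in
theorem coeFn_lpCurve (h : IsStrongSolution p u₀ T u) {t : ℝ} (ht : t ∈ Ioc 0 T) :
    lpCurve p u t =ᵐ[volume] u t := by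
  rw [h.lpCurve_eq ht]
  exact MemLp.coeFn_toLp _

theorem eLpNorm_eq (h : IsStrongSolution p u₀ T u) {t : ℝ} (ht : t ∈ Ioc 0 T) :
    eLpNorm (u t) p volume = ENNReal.ofReal ‖lpCurve p u t‖ := by
  rw [ofReal_norm, h.lpCurve_eq ht, Lp.enorm_toLp]

theorem continuousOn_lpCurve (h : IsStrongSolution p u₀ T u) :
    ContinuousOn (lpCurve p u) (Ioc 0 T) := by
  intro t ht
  refine tendsto_iff_edist_tendsto_0.2 ((h.continuous t ht).congr' ?_)
  filter_upwards [self_mem_nhdsWithin] with s hs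
  rw [h.lpCurve_eq ht, h.lpCurve_eq hs, Lp.edist_toLp_toLp]

theorem exists_norm_lpCurve_le (h : IsStrongSolution p u₀ T u) :
    ∃ M : ℝ, ∀ t ∈ Ioc 0 T, ‖lpCurve p u t‖ ≤ M := by
  obtain ⟨M, hM⟩ := h.bounded
  refine ⟨M, fun t ht => ?_⟩
  have h1 := hM t ht
  rw [h.eLpNorm_eq ht] at h1
  exact (ENNReal.ofReal_le_ofReal_iff M.2).1 (by simpa using h1)

/-- The converse passage, from the pointwise formula to an identity in `L^p`. Changing `u(s)` on a
null set leaves the Oseen term unchanged at every point, so choosing representatives is harmless. -/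
theorem lpCurve_mild (hp : 2 < p) {A α : ℝ} (hA : 0 ≤ A) (hα : α < 1)
    (hQ : IsSingularQuadratic A α (oseenLp (d := d) p)) (hu₀ : MemLp u₀ p volume)
    (h : IsStrongSolution p u₀ T u) {t : ℝ} (ht : t ∈ Ioc 0 T) :
    lpCurve p u t = heatLp p u₀ t - duhamelIntegral (oseenLp p) (lpCurve p u) t := by
  have hp1 := one_lt_of_two_lt hp
  obtain ⟨M, hM⟩ := h.exists_norm_lpCurve_le
  refine Lp.ext ?_
  filter_upwards [ae_duhamelIntegral_oseenLp hp hA hα hQ h.continuousOn_lpCurve hM ht,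
    coeFn_heatLp hp1.le hu₀ ht.1, h.duhamel t ht, h.coeFn_lpCurve ht,
    Lp.coeFn_sub (heatLp p u₀ t) (duhamelIntegral (oseenLp p) (lpCurve p u) t)]
    with x h1 h2 h3 h4 h5
  rw [h5, h4]
  ext i
  rw [(h3 i).2, Pi.sub_apply, PiLp.sub_apply, (h1 i).2, h2, heat_apply hp1 hu₀ ht.1]
  congr 1
  refine intervalIntegral.integral_congr_ae (Eventually.of_forall fun s hs => ?_)
  rw [uIoc_of_le ht.1.le] at hs
  rw [← oseenDiv_apply, ← oseenDiv_apply,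
    oseenDiv_congr (h.coeFn_lpCurve ⟨hs.1, hs.2.trans ht.2⟩) (t - s)]

theorem lpCurve_unique (hp : 2 < p) {A α : ℝ} (hA : 0 ≤ A) (hα : α < 1)
    (hQ : IsSingularQuadratic A α (oseenLp (d := d) p)) (hu₀ : MemLp u₀ p volume)
    {v : ℝ → Space d → Space d} (hu : IsStrongSolution p u₀ T u) (hv : IsStrongSolution p u₀ T v)
    {t : ℝ} (ht : t ∈ Ioc 0 T) : lpCurve p u t = lpCurve p v t := by
  obtain ⟨M, hM⟩ := hu.exists_norm_lpCurve_le
  obtain ⟨M', hM'⟩ := hv.exists_norm_lpCurve_le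
  exact hQ.mild_unique hA hα hu.continuousOn_lpCurve
    (fun t ht => (hM t ht).trans (le_max_left M M')) hv.continuousOn_lpCurve
    (fun t ht => (hM' t ht).trans (le_max_right M M'))
    (fun t ht => hu.lpCurve_mild hp hA hα hQ hu₀ ht)
    (fun t ht => hv.lpCurve_mild hp hA hα hQ hu₀ ht) t ht

end IsStrongSolution

/-- Local well-posedness for small `‖u₀‖_p T^{1-α}`. -/
theorem wellPosed_of_small (hp : 2 < p) {A α : ℝ} (hA : 0 ≤ A) (hα : α < 1)
    (hQ : IsSingularQuadratic A α (oseenLp (d := d) p)) (hu₀ : MemLp u₀ p volume)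
    (hsmall : 8 * A * (lpNorm u₀ p volume * T ^ (1 - α)) ≤ 1 - α) :
    HasUniqueStrongSolution p u₀ T ∧ ∀ u, IsStrongSolution p u₀ T u → ∀ t ∈ Ioc 0 T,
      ‖lpCurve p u t‖ ≤ 2 * lpNorm u₀ p volume := by
  have hp1 := one_lt_of_two_lt hp
  obtain ⟨w, hw, hwN, hwe⟩ := hQ.exists_mild hA hα (lpNorm_nonneg (f := u₀) (p := p) (μ := volume))
    ((continuousOn_heatLp hp1 hu₀).mono fun t (ht : t ∈ Ioc 0 T) => ht.1)
    (fun t ht => norm_heatLp_le hp1.le hu₀ ht.1) (by rwa [mul_assoc])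
  have hws := isStrongSolution_of_mild hp hA hα hQ hu₀ hw hwN hwe
  refine ⟨⟨⟨_, hws⟩, fun u v hu hv t ht => ?_⟩, fun u hu t ht => ?_⟩
  · have h1 := hu.lpCurve_unique hp hA hα hQ hu₀ hv ht
    have h2 := hu.coeFn_lpCurve ht
    rw [h1] at h2
    exact h2.symm.trans (hv.coeFn_lpCurve ht)
  · rw [hu.lpCurve_unique hp hA hα hQ hu₀ hws ht]
    have h1 : lpCurve p (fun t => (w t : Space d → Space d)) t = w t :=
      Lp.ext (hws.coeFn_lpCurve ht)
    rw [h1]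
    exact hwN t ht

end MildSolutions

/-! ### The time scale attached to a subcritical norm -/

section SubcriticalTime

variable {d : ℕ} {p : ℝ≥0∞}

theorem subcriticalTime_pos {a N : ℝ} (ha : 0 < a) (hN : 0 < N) : 0 < subcriticalTime d p a N :=
  Real.rpow_pos_of_pos (div_pos ha hN) _

theorem subcriticalTime_lt (hp : (d : ℝ≥0∞) < p) {a b N : ℝ} (ha : 0 < a) (hab : a < b)
    (hN : 0 < N) : subcriticalTime d p a N < subcriticalTime d p b N :=
  Real.rpow_lt_rpow (div_pos ha hN).le (div_lt_div_of_pos_right hab hN)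
    (div_pos two_pos (subcriticalExponent_pos hp))

theorem mul_subcriticalTime_rpow (hp : (d : ℝ≥0∞) < p) {a N : ℝ} (ha : 0 < a) (hN : 0 < N) :
    N * subcriticalTime d p a N ^ ((1 / 2 : ℝ) * (1 - (d : ℝ) * (p⁻¹).toReal)) = a :=
  (subcriticalTime_eq_iff hp ha hN (subcriticalTime_pos ha hN)).2 rfl

theorem one_sub_oseenExponent (hp : 1 < p) :
    1 - oseenExponent d (conjExp p) = (1 / 2 : ℝ) * (1 - (d : ℝ) * (p⁻¹).toReal) := by
  rw [oseenExponent, toReal_inv_conjExp hp]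
  ring

theorem two_lt_of_dim_lt (hd : 3 ≤ d) (hp : (d : ℝ≥0∞) < p) : 2 < p := by
  refine lt_of_lt_of_le ?_ hp.le
  exact_mod_cast hd

end SubcriticalTime

/-! ### Decay of the solution for sparse data -/

section SparseDecay

variable {d : ℕ} {p : ℝ≥0∞} [Fact (1 ≤ p)] {u₀ : Space d → Space d}

/-- Half of `γ` pays for the heat flow, through sparseness at time `t`, and half for the Duhamel
term, through the a priori bound `2N` and the smallness of `T`. -/
theorem eLpNorm_le_of_isSparse (hp : 2 < p) {A α : ℝ} (hA : 0 ≤ A) (hα : α < 1)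
    (hQ : IsSingularQuadratic A α (oseenLp (d := d) p)) (hu₀ : MemLp u₀ p volume) {γ T : ℝ}
    (hγ : 0 < γ) (hγ1 : γ < 1)
    (hsmall : 8 * A * (lpNorm u₀ p volume * T ^ (1 - α)) ≤ γ * (1 - α))
    {u : ℝ → Space d → Space d} (hu : IsStrongSolution p u₀ T u) {t : ℝ} (ht : t ∈ Ioc 0 T)
    {β l : ℝ} (hβ : 0 < β) (hl : 0 < l)
    (hβl : β ^ (1 - (p⁻¹).toReal) ≤ (2 * sparseConstant d)⁻¹ * γ / l ^ d)
    (hlog : sparseConstant d * Real.log (2 * sparseConstant d / γ) ≤ l ^ 2)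
    (hs : IsSparse p (γ / 6) β (Real.sqrt t * l) u₀) :
    eLpNorm (u t) p volume ≤ ENNReal.ofReal γ * eLpNorm u₀ p volume := by
  have hp1 := one_lt_of_two_lt hp
  have hα' : 0 < 1 - α := sub_pos.2 hα
  set N := lpNorm u₀ p volume with hN
  have hN0 : 0 ≤ N := lpNorm_nonneg
  have hb := (wellPosed_of_small hp hA hα hQ hu₀ (hsmall.trans (by nlinarith))).2 u hu
  have h1 : ‖duhamelIntegral (oseenLp p) (lpCurve p u) t‖ ≤ γ / 2 * N := by
    refine (hQ.norm_duhamelIntegral_le hA hα hb ht).trans ?_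
    have ht0 : 0 ≤ t := ht.1.le
    calc A * (2 * N) ^ 2 * (t ^ (1 - α) / (1 - α))
        ≤ A * (2 * N) ^ 2 * (T ^ (1 - α) / (1 - α)) := by
          gcongr
          exact ht.2
      _ = 8 * A * (N * T ^ (1 - α)) / (1 - α) * (N / 2) := by ring
      _ ≤ γ * (1 - α) / (1 - α) * (N / 2) := by gcongr
      _ = γ / 2 * N := by field_simp
  have h2 : ‖heatLp p u₀ t‖ ≤ γ / 2 * N := by
    have h3 := eLpNorm_heat_le_of_isSparse hp1.le hu₀.1 hγ hγ1 hβ hl ht.1 hβl hlog hs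
    rw [heatLp_eq hp1.le hu₀ ht.1, Lp.norm_toLp]
    refine ENNReal.toReal_le_of_le_ofReal (by positivity) ?_
    rwa [ENNReal.ofReal_mul (by positivity), hN, ofReal_lpNorm hu₀]
  rw [hu.eLpNorm_eq ht, hu.lpCurve_mild hp hA hα hQ hu₀ ht, ← ofReal_lpNorm hu₀,
    ← ENNReal.ofReal_mul hγ.le]
  refine ENNReal.ofReal_le_ofReal ((norm_sub_le _ _).trans ?_)
  linarith

end SparseDecay

end NavierStokesSparse

end

/-! ### Choice of the constants and conclusion -/

theorem proposition3p1 (d : ℕ) (hd : 3 ≤ d) :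
    -- `C₀` depends only on the dimension
    ∃ C₀ : ℝ, 1 < C₀ ∧ ∀ p : ℝ≥0∞, (d : ℝ≥0∞) < p →
    -- `c_p` and `C` depend only on `d` and `p`
    ∃ c : ℝ, NavierStokesSparse.IsExistenceConstant d p c ∧ ∃ C : ℝ, 0 < C ∧
    ∀ γ : ℝ, 0 < γ → γ < 1 →
    ∀ u₀ : NavierStokesSparse.Space d → NavierStokesSparse.Space d,
      NavierStokesSparse.IsSolenoidalLp p u₀ → lpNorm u₀ p volume ≠ 0 →
    ∃ T : ℝ, 0 < T ∧
      T < NavierStokesSparse.subcriticalTime d p c (lpNorm u₀ p volume) ∧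
      lpNorm u₀ p volume * T ^ ((1 / 2 : ℝ) * (1 - (d : ℝ) * (p⁻¹).toReal))
        = γ / (2 * C) ∧
      NavierStokesSparse.HasUniqueStrongSolution p u₀ T ∧
      ∀ u : ℝ → NavierStokesSparse.Space d → NavierStokesSparse.Space d,
        NavierStokesSparse.IsStrongSolution p u₀ T u →
        ∀ t ∈ Ioc 0 T, ∀ β ℓ : ℝ, 0 < β → β < 1 → 0 < ℓ →
          β ^ (1 - (p⁻¹).toReal) ≤ (2 * C₀)⁻¹ * γ / ℓ ^ d →
          C₀ * Real.log (2 * C₀ / γ) ≤ ℓ ^ 2 →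
          NavierStokesSparse.IsSparse p (γ / 6) β (Real.sqrt t * ℓ) u₀ →
          eLpNorm (u t) p volume ≤ ENNReal.ofReal γ * eLpNorm u₀ p volume := by
  open NavierStokesSparse in
  refine ⟨sparseConstant d, ?_, fun p hdp => ?_⟩
  · have h1 := unitBallVolume_nonneg d
    have h2 : 0 < (2 : ℝ) ^ ((d : ℝ) / 2) := by positivity
    unfold sparseConstant
    linarith
  have hp := two_lt_of_dim_lt hd hdp
  have hp1 := one_lt_of_two_lt hp
  have : Fact (1 ≤ p) := ⟨hp1.le⟩
  obtain ⟨A, hA, hQ⟩ := exists_isSingularQuadratic_oseenLp hp d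
  have hexp := one_sub_oseenExponent (d := d) hp1
  set α := oseenExponent d (conjExp p)
  have hα' : 0 < 1 - α := by
    rw [hexp]
    exact mul_pos (by norm_num) (subcriticalExponent_pos hdp)
  have hα : α < 1 := sub_pos.1 hα'
  -- The largest size of `N T^{1-α}` compatible with the contraction condition, up to the `+ 1` that
  -- covers `A = 0` and the cap required by `c_p ≤ 1`.
  set c := min 1 ((1 - α) / (8 * A + 1))
  have hc : 0 < c := lt_min one_pos (by positivity)
  have hcA : 8 * A * c ≤ 1 - α := by
    have h1 : c ≤ (1 - α) / (8 * A + 1) := min_le_right _ _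
    rw [le_div_iff₀ (by positivity)] at h1
    linarith
  have hsmall : ∀ a, 0 < a → ∀ u₀ : Space d → Space d, lpNorm u₀ p volume ≠ 0 →
      lpNorm u₀ p volume * subcriticalTime d p a (lpNorm u₀ p volume) ^ (1 - α) = a := by
    intro a ha u₀ hN
    rw [hexp]
    exact mul_subcriticalTime_rpow hdp ha (lt_of_le_of_ne lpNorm_nonneg hN.symm)
  -- With `C = 1/c` the prescribed size of `N T^{1-α}` is `γ/(2C) = γc/2`. This is less than `c`,
  -- which gives `T < T̄`, and it meets the smallness condition with the extra factor `γ`.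
  refine ⟨c, ⟨hc, min_le_left _ _, fun u₀ hu₀ hN => ?_⟩, 1 / c, by positivity,
    fun γ hγ hγ1 u₀ hu₀ hN => ?_⟩
  · obtain ⟨h1, h2⟩ := wellPosed_of_small (T := subcriticalTime d p c (lpNorm u₀ p volume)) hp hA hα
      hQ hu₀.1 (by rwa [hsmall c hc u₀ hN])
    refine ⟨h1, fun u hu t ht => ?_⟩
    rw [hu.eLpNorm_eq ht, ← ofReal_lpNorm hu₀.1]
    refine (ENNReal.ofReal_le_ofReal (h2 u hu t ht)).trans ?_
    rw [ENNReal.ofReal_mul two_pos.le, ENNReal.ofReal_ofNat]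
  · have hN0 : 0 < lpNorm u₀ p volume := lt_of_le_of_ne lpNorm_nonneg hN.symm
    have ha : 0 < γ / (2 * (1 / c)) := by positivity
    have hac : γ / (2 * (1 / c)) = γ * c / 2 := by field_simp
    have hT := hsmall _ ha u₀ hN
    have hs : 8 * A * (lpNorm u₀ p volume *
        subcriticalTime d p (γ / (2 * (1 / c))) (lpNorm u₀ p volume) ^ (1 - α)) ≤ γ * (1 - α) := by
      rw [hT, hac]
      nlinarith [mul_nonneg hγ.le (mul_nonneg hA hc.le)]
    refine ⟨subcriticalTime d p (γ / (2 * (1 / c))) (lpNorm u₀ p volume),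
      subcriticalTime_pos ha hN0, subcriticalTime_lt hdp ha ?_ hN0,
      mul_subcriticalTime_rpow hdp ha hN0,
      (wellPosed_of_small hp hA hα hQ hu₀.1 (hs.trans (by nlinarith))).1, ?_⟩
    · rw [hac]
      nlinarith
    · intro u hu t ht β l hβ _ hl hβl hlog hsp
      exact eLpNorm_le_of_isSparse hp hA hα hQ hu₀.1 hγ hγ1 hs hu ht hβ hl hβl hlog hsp
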